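/- Let $n\ge 3$ and let $(M^n,g)$ be a connected smooth Riemannian spin manifold with a fixed spin structure and complex spinor bundle $\Sigma$ (of complex rank $2^{[n/2]}$), with Clifford multiplication normalized by $X\cdot Y+Y\cdot X=-2g(X,Y)$. Let $T$ be a smooth 3-form on $M$, and let $T(X,Y)$ denote the vector with $g(T(X,Y),Z)=T(X,Y,Z)$. For $s\in\mathbb R$ let $\nabla^s$ be the metric connection $\nabla^s_XY=\nabla^g_XY+2s\,T(X,Y)$, where $\nabla^g$ is the Levi-Civita connection, and denote in the same way its lift to spinors, $\nabla^s_X\varphi=\nabla^g_X\varphi+s\,(X\lrcorner T)\cdot\varphi$; here a $k$-form $\omega$ acts on spinors by $\sum_{i_1<\dots<i_k}\omega(e_{i_1},\dots,e_{i_k})\,e_{i_1}\cdots e_{i_k}$ for a local orthonormal frame $(e_i)$. Put $\nabla^c=\nabla^{1/4}$ and assume $\nabla^cT=0$. Fix $s\in\mathbb R$. Let $D^s\varphi=\sum_i e_i\cdot\nabla^s_{e_i}\varphi$, and let $\ker P^s$ be the complex vector space of twistor spinors with torsion, i.e. of smooth sections $\varphi$ of $\Sigma$ with $\nabla^s_X\varphi+\frac1n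 X\cdot D^s\varphi=0$ for all $X$. Let $R^s(X,Y)Z=\nabla^s_X\nabla^s_YZ-\nabla^s_Y\nabla^s_XZ-\nabla^s_{[X,Y]}Z$, $\mathrm{Ric}^s(X,Y)=\sum_i g(R^s(X,e_i)e_i,Y)$, $\mathrm{Ric}^s(X)=\sum_i\mathrm{Ric}^s(X,e_i)e_i$, $\mathrm{Scal}^s=\sum_i\mathrm{Ric}^s(e_i,e_i)$, $\mathrm{Sch}^s(X)=\frac1{n-2}\bigl(-\mathrm{Ric}^s(X)+\frac{\mathrm{Scal}^s}{2(n-1)}X\bigr)$ and $\sigma_T=\frac12\sum_i(e_i\lrcorner T)\wedge(e_i\lrcorner T)$. On the vector bundle $\Sigma\oplus\Sigma$ consider the connection $$\begin{aligned}\nabla^{s,E}_X(\varphi_1\oplus\varphi_2)=\Bigl(&\nabla^s_X\varphi_1+\tfrac1nX\cdot\varphi_2\Bigr)\oplus\Bigl(-\tfrac n2\mathrm{Sch}^s(X)\cdot\varphi_1-\tfrac{sn(3-4s)}{(n-1)(n-2)}\bigl[X\cdot dT+(n-1)(X\lrcorner\sigma_T)\bigr]\cdot\varphi_1\\&-\tfrac{sn}{(n-1)(n-2)}\bigl[\tfrac{8(n-1)}n(X\lrcorner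 T)+\tfrac{12}nX\cdot T\bigr]\cdot\varphi_2+\nabla^s_X\varphi_2\Bigr).\end{aligned}$$ Then: 1. for every $\varphi\in\ker P^s$ the smooth section $\varphi\oplus D^s\varphi$ of $\Sigma\oplus\Sigma$ satisfies $\nabla^{s,E}(\varphi\oplus D^s\varphi)=0$; 2. conversely, if $\varphi,\psi$ are smooth sections of $\Sigma$ with $\nabla^{s,E}(\varphi\oplus\psi)=0$, then $\varphi\in\ker P^s$ and $D^s\varphi=\psi$; 3. $\ker P^s$ is finite dimensional, with $\dim_{\mathbb C}\ker P^s\le 2^{[n/2]+1}$; 4. if $\varphi\in\ker P^s$ and both $\varphi$ and $D^s\varphi$ vanish at some point $p\in M$, then $\varphi\equiv 0$. -/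

import Mathlib

open scoped Manifold ContDiff Bundle
open Bundle

noncomputable section

namespace TwistorTorsion

/-! ### Clifford algebra, spin group and spin representation -/

/-- The negative definite quadratic form `v ↦ -∑ vᵢ²` on `ℝⁿ`, so that vectors satisfy
`v · w + w · v = -2 ⟨v, w⟩` in its Clifford algebra. -/
abbrev negQ (n : ℕ) : QuadraticForm ℝ (Fin n → ℝ) :=
  QuadraticMap.weightedSumSquares ℝ (fun _ : Fin n => (-1 : ℝ))

/-- The real Clifford algebra of `ℝⁿ`. Its spin group is Mathlib's `spinGroup (negQ n)`. -/
abbrev Cl (n : ℕ) : Type := CliffordAlgebra (negQ n)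

/-- The generators of the Clifford algebra (images of the standard basis of `ℝⁿ`). -/
def gen {n : ℕ} (i : Fin n) : Cl n := CliffordAlgebra.ι (negQ n) (Pi.single i 1)

/-- The space `ℂ^(2^[n/2])` underlying the complex spin representation. -/
abbrev SpinorSpace (n : ℕ) : Type := Fin (2 ^ (n / 2)) → ℂ

/-- A spin representation: a complex representation of the Clifford algebra of `ℝⁿ` in dimension
`2^[n/2]`. (Such a representation is automatically irreducible; it is unique up to equivalence for
even `n`, and there are two of them, equivalent as representations of the spin group, for odd
`n`.) -/
abbrev SpinRep (n : ℕ) : Type :=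
  Cl n →ₐ[ℝ] Matrix (Fin (2 ^ (n / 2))) (Fin (2 ^ (n / 2))) ℂ

/-- The element `∑_{i₁ < ⋯ < i_k} c(i₁, …, i_k) e_{i₁} ⋯ e_{i_k}` of the Clifford algebra given by
the `k`-form with components `c` in an orthonormal basis. -/
def formCl {n k : ℕ} (c : (Fin k → Fin n) → ℝ) : Cl n :=
  open Classical in
  ∑ f : Fin k → Fin n with StrictMono f, c f • (List.ofFn fun a => gen (f a)).prod

/-- A Clifford algebra element acting on spinors, as a real-linear map. -/
def repCLM {n : ℕ} (ρ : SpinRep n) (a : Cl n) : SpinorSpace n →L[ℝ] SpinorSpace n :=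
  ((Matrix.mulVecLin (ρ a)).restrictScalars ℝ).toContinuousLinearMap

theorem repCLM_apply {n : ℕ} (ρ : SpinRep n) (a : Cl n) (ψ : SpinorSpace n) :
    repCLM ρ a ψ = (ρ a).mulVec ψ := rfl

/-- `repCLM` as a linear function of the Clifford algebra element. -/
def repLin {n : ℕ} (ρ : SpinRep n) : Cl n →ₗ[ℝ] (SpinorSpace n →L[ℝ] SpinorSpace n) where
  toFun := repCLM ρ
  map_add' a b := by ext1 ψ; simp [repCLM_apply, Matrix.add_mulVec]
  map_smul' c a := by ext1 ψ; simp [repCLM_apply, Matrix.smul_mulVec]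

/-! ### Spin structures and the spinor bundle -/

section Geometry

variable {n : ℕ} {M : Type*} [TopologicalSpace M] [ChartedSpace (EuclideanSpace ℝ (Fin n)) M]
  [RiemannianBundle (fun x : M => TangentSpace (𝓡 n) x)]

instance (x : M) : FiniteDimensional ℝ (TangentSpace (𝓡 n) x) :=
  inferInstanceAs (FiniteDimensional ℝ (EuclideanSpace ℝ (Fin n)))

/-- A vector field, without any regularity. -/
abbrev VField (n : ℕ) (M : Type*) [TopologicalSpace M]
    [ChartedSpace (EuclideanSpace ℝ (Fin n)) M] : Type _ :=
  Π x : M, TangentSpace (𝓡 n) x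

/-- A vector field is smooth on a set. -/
def SmoothFieldOn [IsManifold (𝓡 n) ∞ M] (X : VField n M) (U : Set M) : Prop :=
  ContMDiffOn (𝓡 n) ((𝓡 n).prod 𝓘(ℝ, EuclideanSpace ℝ (Fin n))) ∞
    (fun x => TotalSpace.mk' (EuclideanSpace ℝ (Fin n)) x (X x)) U

theorem Form3.update0 {V : Type*} (a b c d : V) :
    Function.update ![a, b, c] 0 d = ![d, b, c] := by
  ext i; fin_cases i <;> rfl

theorem Form3.update1 {V : Type*} (a b c d : V) :
    Function.update ![a, b, c] 1 d = ![a, d, c] := by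
  ext i; fin_cases i <;> rfl

theorem Form3.cons_add {V : Type*} [AddCommGroup V] [Module ℝ V] (T : V [⋀^Fin 3]→ₗ[ℝ] ℝ)
    (u v a b : V) : T ![u + v, a, b] = T ![u, a, b] + T ![v, a, b] := by
  have h := T.map_update_add ![u, a, b] 0 u v
  rw [Form3.update0, Form3.update0, Form3.update0] at h
  exact h

theorem Form3.cons_smul {V : Type*} [AddCommGroup V] [Module ℝ V] (T : V [⋀^Fin 3]→ₗ[ℝ] ℝ)
    (c : ℝ) (v a b : V) : T ![c • v, a, b] = c * T ![v, a, b] := by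
  have h := T.map_update_smul ![v, a, b] 0 c v
  rw [Form3.update0, Form3.update0] at h
  exact h

theorem Form3.cons_add₂ {V : Type*} [AddCommGroup V] [Module ℝ V] (T : V [⋀^Fin 3]→ₗ[ℝ] ℝ)
    (u v a b : V) : T ![a, u + v, b] = T ![a, u, b] + T ![a, v, b] := by
  have h := T.map_update_add ![a, u, b] 1 u v
  rw [Form3.update1, Form3.update1, Form3.update1] at h
  exact h

theorem Form3.cons_smul₂ {V : Type*} [AddCommGroup V] [Module ℝ V] (T : V [⋀^Fin 3]→ₗ[ℝ] ℝ)
    (c : ℝ) (v a b : V) : T ![a, c • v, b] = c * T ![a, v, b] := by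
  have h := T.map_update_smul ![a, v, b] 1 c v
  rw [Form3.update1, Form3.update1] at h
  exact h

variable (n M) in
/-- A spin structure on the Riemannian manifold `M`, given by local trivializations: smooth local
orthonormal frames over the sets of an open cover, together with smooth lifts to the spin group of
the `SO(n)`-valued transition functions between these frames, which satisfy the cocycle condition.
If `(e_i)` is the `a`-th and `(f_j)` the `b`-th frame, then `f_j = ∑ᵢ λᵢⱼ e_i` with
`λᵢⱼ = ⟨e_i, f_j⟩`, and `lift a b` takes values in the spin group elements `g` with
`g · v · g⁻¹ = λ v`. -/
structure SpinStructure [IsManifold (𝓡 n) ∞ M] (ι : Type*) where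
  /-- the open cover -/
  baseSet : ι → Set M
  isOpen_baseSet : ∀ a, IsOpen (baseSet a)
  /-- a preferred member of the cover around each point -/
  indexAt : M → ι
  mem_baseSet_at : ∀ x, x ∈ baseSet (indexAt x)
  /-- the local orthonormal frames (with irrelevant values outside of `baseSet a`) -/
  frame : ι → Fin n → VField n M
  smooth_frame : ∀ a i, SmoothFieldOn (frame a i) (baseSet a)
  orthonormal_frame : ∀ a, ∀ x ∈ baseSet a, Orthonormal ℝ (fun i => frame a i x)
  /-- the lifted transition functions -/
  lift : ι → ι → M → spinGroup (negQ n)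
  smooth_lift : ∀ a b, ∀ l : Cl n →ₗ[ℝ] ℝ,
    ContMDiffOn (𝓡 n) 𝓘(ℝ) ∞ (fun x => l (lift a b x)) (baseSet a ∩ baseSet b)
  lift_spec : ∀ a b, ∀ x ∈ baseSet a ∩ baseSet b, ∀ j,
    (lift a b x : Cl n) * gen j * star (lift a b x : Cl n) =
      ∑ i, inner ℝ (frame a i x) (frame b j x) • gen i
  lift_comp : ∀ a b c, ∀ x ∈ baseSet a ∩ baseSet b ∩ baseSet c,
    lift a b x * lift b c x = lift a c x

namespace SpinStructure

variable [IsManifold (𝓡 n) ∞ M] {ι : Type*} (S : SpinStructure n M ι) (ρ : SpinRep n)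

theorem lift_self (a : ι) (x : M) (hx : x ∈ S.baseSet a) : S.lift a a x = 1 := by
  have h := S.lift_comp a a a x ⟨⟨hx, hx⟩, hx⟩
  simpa using h

theorem smooth_repCLM (a b : ι) : ContMDiffOn (𝓡 n) 𝓘(ℝ, SpinorSpace n →L[ℝ] SpinorSpace n) ∞
    (fun x => repCLM ρ (S.lift a b x)) (S.baseSet a ∩ S.baseSet b) := by
  classical
  let bs := Module.finBasis ℝ (SpinorSpace n →L[ℝ] SpinorSpace n)
  have key : (fun x => repCLM ρ (S.lift a b x)) =
      fun x => ∑ k, (((bs.coord k).comp (repLin ρ)) (S.lift a b x)) • bs k := by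
    funext x
    exact (bs.sum_repr (repCLM ρ (S.lift a b x))).symm
  rw [key]
  refine contMDiffOn_finsetSum fun k _ => ?_
  exact (S.smooth_lift a b _).smul contMDiffOn_const

/-- The vector bundle core of the spinor bundle: the local representatives `φ_a`, `φ_b` of a spinor
are related by `φ_a = ρ(lift a b) φ_b`. -/
def spinorCore : VectorBundleCore ℝ M (SpinorSpace n) ι where
  baseSet := S.baseSet
  isOpen_baseSet := S.isOpen_baseSet
  indexAt := S.indexAt
  mem_baseSet_at := S.mem_baseSet_at
  coordChange a b x := repCLM ρ (S.lift b a x)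
  coordChange_self a x hx v := by
    rw [S.lift_self a x hx]
    simp [repCLM_apply]
  continuousOn_coordChange a b := by
    rw [Set.inter_comm]
    exact (S.smooth_repCLM ρ b a).continuousOn
  coordChange_comp a b c x hx v := by
    rw [← S.lift_comp c b a x ⟨⟨hx.2, hx.1.2⟩, hx.1.1⟩]
    simp [repCLM_apply]

instance : (S.spinorCore ρ).IsContMDiff (𝓡 n) ∞ where
  contMDiffOn_coordChange a b := by
    rw [Set.inter_comm]
    exact S.smooth_repCLM ρ b a

/-- The spinor bundle `Σ → M` associated to the spin structure. -/
abbrev Spinor : M → Type := (S.spinorCore ρ).Fiber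

instance (x : M) : IsTopologicalAddGroup (S.Spinor ρ x) :=
  inferInstanceAs (IsTopologicalAddGroup (SpinorSpace n))

instance (x : M) : ContinuousSMul ℝ (S.Spinor ρ x) :=
  inferInstanceAs (ContinuousSMul ℝ (SpinorSpace n))

/-- The complex structure of the fibres of the spinor bundle. -/
instance (x : M) : Module ℂ (S.Spinor ρ x) := inferInstanceAs (Module ℂ (SpinorSpace n))

/-! ### The Riemannian side: Levi-Civita connection, torsion form, curvature -/

/-- A covariant derivative on the tangent bundle (Mathlib's notion; `∇ Y x v` is `(∇_v Y)(x)`). -/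
abbrev _root_.TwistorTorsion.TangentConn (n : ℕ) (M : Type*) [TopologicalSpace M]
    [ChartedSpace (EuclideanSpace ℝ (Fin n)) M] [IsManifold (𝓡 n) ∞ M] : Type _ :=
  CovariantDerivative (𝓡 n) (EuclideanSpace ℝ (Fin n)) (fun x : M => TangentSpace (𝓡 n) x)

instance instRiemannianOne [h : IsContMDiffRiemannianBundle (𝓡 n) ∞ (EuclideanSpace ℝ (Fin n))
      (fun x : M => TangentSpace (𝓡 n) x)] :
    IsContMDiffRiemannianBundle (𝓡 n) 1 (EuclideanSpace ℝ (Fin n))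
      (fun x : M => TangentSpace (𝓡 n) x) := h.of_le (by decide)

/-- The Levi-Civita connection: metric and torsion free. -/
structure _root_.TwistorTorsion.IsLeviCivita
    [IsContMDiffRiemannianBundle (𝓡 n) ∞ (EuclideanSpace ℝ (Fin n))
      (fun x : M => TangentSpace (𝓡 n) x)] (nab : TangentConn n M) : Prop where
  metric : nab.IsMetricCompatible
  torsion_free : nab.torsion = 0

/-- A field of alternating trilinear forms on the tangent spaces. -/
abbrev _root_.TwistorTorsion.Form3 (n : ℕ) (M : Type*) [TopologicalSpace M]
    [ChartedSpace (EuclideanSpace ℝ (Fin n)) M] : Type _ :=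
  Π x : M, TangentSpace (𝓡 n) x [⋀^Fin 3]→ₗ[ℝ] ℝ

/-- The field of forms is smooth, i.e. a differential 3-form: its values on smooth local vector
fields are smooth. -/
def _root_.TwistorTorsion.IsSmooth3 (T : Form3 n M) : Prop :=
  ∀ (U : Set M) (X Y Z : VField n M), IsOpen U →
    SmoothFieldOn X U → SmoothFieldOn Y U → SmoothFieldOn Z U →
      ContMDiffOn (𝓡 n) 𝓘(ℝ) ∞ (fun x => T x ![X x, Y x, Z x]) U

/-- The exterior derivative `dT(X, Y, Z, W)` of a 3-form, evaluated on vector fields. -/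
def _root_.TwistorTorsion.extD (T : Form3 n M) (X Y Z W : VField n M) (x : M) : ℝ :=
  mvfderiv (𝓡 n) (fun y => T y ![Y y, Z y, W y]) x (X x)
  - mvfderiv (𝓡 n) (fun y => T y ![X y, Z y, W y]) x (Y x)
  + mvfderiv (𝓡 n) (fun y => T y ![X y, Y y, W y]) x (Z x)
  - mvfderiv (𝓡 n) (fun y => T y ![X y, Y y, Z y]) x (W x)
  - T x ![VectorField.mlieBracket (𝓡 n) X Y x, Z x, W x]
  + T x ![VectorField.mlieBracket (𝓡 n) X Z x, Y x, W x]
  - T x ![VectorField.mlieBracket (𝓡 n) X W x, Y x, Z x]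
  - T x ![VectorField.mlieBracket (𝓡 n) Y Z x, X x, W x]
  + T x ![VectorField.mlieBracket (𝓡 n) Y W x, X x, Z x]
  - T x ![VectorField.mlieBracket (𝓡 n) Z W x, X x, Y x]

/-- The `i`-th vector at `x` of the preferred orthonormal frame around `x`. -/
def e (x : M) (i : Fin n) : TangentSpace (𝓡 n) x := S.frame (S.indexAt x) i x

/-- The Clifford algebra element of a tangent vector, in the preferred frame. -/
def vecCl (x : M) : TangentSpace (𝓡 n) x →ₗ[ℝ] Cl n where
  toFun v := ∑ i, inner ℝ (S.e x i) v • gen i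
  map_add' u v := by simp [inner_add_right, add_smul, Finset.sum_add_distrib]
  map_smul' c v := by simp [inner_smul_right, mul_smul, Finset.smul_sum]

/-- The vector `T(u, v)` with `g(T(u, v), w) = T(u, v, w)`. -/
def torVec (T : Form3 n M) (x : M) (u v : TangentSpace (𝓡 n) x) : TangentSpace (𝓡 n) x :=
  ∑ k, T x ![u, v, S.e x k] • S.e x k

/-- The metric connection `∇ˢ` with torsion `4sT`:
`g(∇ˢ_v Y, Z) = g(∇ᵍ_v Y, Z) + 2s T(v, Y, Z)`. -/
def conn (nab : TangentConn n M) (T : Form3 n M) (s : ℝ) (Y : VField n M) (x : M)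
    (v : TangentSpace (𝓡 n) x) : TangentSpace (𝓡 n) x :=
  nab Y x v + (2 * s) • S.torVec T x v (Y x)

/-- `∇ᶜT = 0`, where `∇ᶜ = ∇ˢ` for `s = 1/4`, i.e. `∇ᶜ = ∇ᵍ + T/2`. -/
def ParallelTorsion (nab : TangentConn n M) (T : Form3 n M) : Prop :=
  ∀ (x : M) (v : TangentSpace (𝓡 n) x) (X Y Z : VField n M),
    MDifferentiableAt (𝓡 n) ((𝓡 n).prod 𝓘(ℝ, EuclideanSpace ℝ (Fin n)))
      (fun y => TotalSpace.mk' (EuclideanSpace ℝ (Fin n)) y (X y)) x →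
    MDifferentiableAt (𝓡 n) ((𝓡 n).prod 𝓘(ℝ, EuclideanSpace ℝ (Fin n)))
      (fun y => TotalSpace.mk' (EuclideanSpace ℝ (Fin n)) y (Y y)) x →
    MDifferentiableAt (𝓡 n) ((𝓡 n).prod 𝓘(ℝ, EuclideanSpace ℝ (Fin n)))
      (fun y => TotalSpace.mk' (EuclideanSpace ℝ (Fin n)) y (Z y)) x →
    mvfderiv (𝓡 n) (fun y => T y ![X y, Y y, Z y]) x v
      - T x ![S.conn nab T (1 / 4) X x v, Y x, Z x]
      - T x ![X x, S.conn nab T (1 / 4) Y x v, Z x]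
      - T x ![X x, Y x, S.conn nab T (1 / 4) Z x v] = 0

/-- The curvature `Rˢ(X, Y)Z = ∇ˢ_X ∇ˢ_Y Z - ∇ˢ_Y ∇ˢ_X Z - ∇ˢ_[X,Y] Z`. -/
def curv (nab : TangentConn n M) (T : Form3 n M) (s : ℝ) (X Y Z : VField n M) (x : M) :
    TangentSpace (𝓡 n) x :=
  S.conn nab T s (fun y => S.conn nab T s Z y (Y y)) x (X x)
  - S.conn nab T s (fun y => S.conn nab T s Z y (X y)) x (Y x)
  - S.conn nab T s Z x (VectorField.mlieBracket (𝓡 n) X Y x)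

/-- The components `Ricˢ(e_j, e_k) = ∑ᵢ g(Rˢ(e_j, e_i)e_i, e_k)` in the preferred frame. -/
def ricComp (nab : TangentConn n M) (T : Form3 n M) (s : ℝ) (x : M) (j k : Fin n) : ℝ :=
  ∑ i, inner ℝ (S.curv nab T s (S.frame (S.indexAt x) j) (S.frame (S.indexAt x) i)
    (S.frame (S.indexAt x) i) x) (S.e x k)

/-- The Clifford algebra element of the vector `Ricˢ(v) = ∑_k Ricˢ(v, e_k) e_k`. -/
def ricCl (nab : TangentConn n M) (T : Form3 n M) (s : ℝ) (x : M) :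
    TangentSpace (𝓡 n) x →ₗ[ℝ] Cl n where
  toFun v := ∑ k, (∑ j, inner ℝ (S.e x j) v * S.ricComp nab T s x j k) • gen k
  map_add' u v := by simp [inner_add_right, add_smul, add_mul, Finset.sum_add_distrib]
  map_smul' c v := by
    simp [inner_smul_right, mul_smul, Finset.smul_sum, mul_assoc, ← Finset.mul_sum]

/-- The scalar curvature `Scalˢ`. -/
def scal (nab : TangentConn n M) (T : Form3 n M) (s : ℝ) (x : M) : ℝ :=
  ∑ i, S.ricComp nab T s x i i

/-- The Schouten endomorphism
`v ↦ (1/(n-2)) (-Ricˢ(v) + (Scalˢ / (2(n-1))) v)`, in the Clifford algebra. -/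
def schoutenCl (nab : TangentConn n M) (T : Form3 n M) (s : ℝ) (x : M) :
    TangentSpace (𝓡 n) x →ₗ[ℝ] Cl n :=
  (1 / ((n : ℝ) - 2)) •
    (-S.ricCl nab T s x + (S.scal nab T s x / (2 * ((n : ℝ) - 1))) • S.vecCl x)

/-- The 4-form `σ_T = ½ ∑ᵢ (e_i ⌟ T) ∧ (e_i ⌟ T)`; here
`(α ∧ α)(u, v, w, z) = 2 (α(u, v) α(w, z) - α(u, w) α(v, z) + α(u, z) α(v, w))` for 2-forms. -/
def sigma (T : Form3 n M) (x : M) (u v w z : TangentSpace (𝓡 n) x) : ℝ :=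
  (1 / 2) * ∑ i, 2 * (T x ![S.e x i, u, v] * T x ![S.e x i, w, z]
    - T x ![S.e x i, u, w] * T x ![S.e x i, v, z]
    + T x ![S.e x i, u, z] * T x ![S.e x i, v, w])

/-- The Clifford algebra element of `T`. -/
def torCl (T : Form3 n M) (x : M) : Cl n :=
  formCl fun f : Fin 3 → Fin n => T x ![S.e x (f 0), S.e x (f 1), S.e x (f 2)]

/-- The Clifford algebra element of `dT`. -/
def extDCl (T : Form3 n M) (x : M) : Cl n :=
  formCl fun f : Fin 4 → Fin n => extD T (S.frame (S.indexAt x) (f 0))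
    (S.frame (S.indexAt x) (f 1)) (S.frame (S.indexAt x) (f 2)) (S.frame (S.indexAt x) (f 3)) x

/-- The Clifford algebra element of `v ⌟ T`. -/
def contrTorCl (T : Form3 n M) (x : M) : TangentSpace (𝓡 n) x →ₗ[ℝ] Cl n where
  toFun v := formCl fun f : Fin 2 → Fin n => T x ![v, S.e x (f 0), S.e x (f 1)]
  map_add' u v := by
    simp only [Form3.cons_add]
    simp [formCl, add_smul, Finset.sum_add_distrib]
  map_smul' c v := by
    simp only [Form3.cons_smul]
    simp [formCl, mul_smul, Finset.smul_sum]

/-- The Clifford algebra element of `v ⌟ σ_T`. -/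
def contrSigmaCl (T : Form3 n M) (x : M) : TangentSpace (𝓡 n) x →ₗ[ℝ] Cl n where
  toFun v := formCl fun f : Fin 3 → Fin n =>
    S.sigma T x v (S.e x (f 0)) (S.e x (f 1)) (S.e x (f 2))
  map_add' u v := by
    have h : ∀ a b c, S.sigma T x (u + v) a b c = S.sigma T x u a b c + S.sigma T x v a b c := by
      intro a b c
      simp only [sigma, Form3.cons_add₂]
      rw [← mul_add, ← Finset.sum_add_distrib]
      exact congrArg _ (Finset.sum_congr rfl fun i _ => by ring)
    simp only [h]
    simp [formCl, add_smul, Finset.sum_add_distrib]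
  map_smul' r v := by
    have h : ∀ a b c, S.sigma T x (r • v) a b c = r * S.sigma T x v a b c := by
      intro a b c
      simp only [sigma, Form3.cons_smul₂]
      rw [mul_left_comm]
      refine congrArg _ ?_
      rw [Finset.mul_sum]
      exact Finset.sum_congr rfl fun i _ => by ring
    simp only [h]
    simp [formCl, mul_smul, Finset.smul_sum]

/-! ### The spinorial side -/

/-- A Clifford algebra element at `x`, expressed in the preferred frame, acting on the fibre of the
spinor bundle. -/
def act (x : M) (a : Cl n) : S.Spinor ρ x →L[ℝ] S.Spinor ρ x := repCLM ρ a

/-- The bundle map `v ↦ B(v) · ψ` defined by a linear map `B` from the tangent space at `x` to the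
Clifford algebra. -/
def actLin (x : M) (B : TangentSpace (𝓡 n) x →ₗ[ℝ] Cl n) (ψ : S.Spinor ρ x) :
    TangentSpace (𝓡 n) x →L[ℝ] S.Spinor ρ x :=
  LinearMap.toContinuousLinearMap
    { toFun := fun v => S.act ρ x (B v) ψ
      map_add' := fun u v => by
        rw [map_add]
        exact congrArg (fun L => L ψ) ((repLin ρ).map_add (B u) (B v))
      map_smul' := fun c v => by
        rw [map_smul]
        exact congrArg (fun L => L ψ) ((repLin ρ).map_smul c (B v)) }

theorem actLin_apply (x : M) (B : TangentSpace (𝓡 n) x →ₗ[ℝ] Cl n) (ψ : S.Spinor ρ x)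
    (v : TangentSpace (𝓡 n) x) : S.actLin ρ x B ψ v = S.act ρ x (B v) ψ := rfl

theorem actLin_add (x : M) (B : TangentSpace (𝓡 n) x →ₗ[ℝ] Cl n) (ψ ψ' : S.Spinor ρ x) :
    S.actLin ρ x B (ψ + ψ') = S.actLin ρ x B ψ + S.actLin ρ x B ψ' := by
  ext1 v; simp only [actLin_apply, map_add, add_apply]

theorem actLin_smul (x : M) (B : TangentSpace (𝓡 n) x →ₗ[ℝ] Cl n) (c : ℝ) (ψ : S.Spinor ρ x) :
    S.actLin ρ x B (c • ψ) = c • S.actLin ρ x B ψ := by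
  ext1 v; simp only [actLin_apply, map_smul, smul_apply]

/-- The representative of a section of the spinor bundle in the `a`-th trivialization. -/
def localRep (a : ι) (φ : Π x, S.Spinor ρ x) (x : M) : SpinorSpace n :=
  (S.spinorCore ρ).coordChange (S.indexAt x) a x (φ x)

/-- Smooth sections of the spinor bundle. -/
def IsSmoothSpinor (φ : Π x, S.Spinor ρ x) : Prop :=
  ContMDiff (𝓡 n) ((𝓡 n).prod 𝓘(ℝ, SpinorSpace n)) ∞
    (fun x => TotalSpace.mk' (SpinorSpace n) x (φ x))

/-- Differentiability at `x` of a section of the spinor bundle. -/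
def MDiffSpinorAt (φ : Π x, S.Spinor ρ x) (x : M) : Prop :=
  MDifferentiableAt (𝓡 n) ((𝓡 n).prod 𝓘(ℝ, SpinorSpace n))
    (fun y => TotalSpace.mk' (SpinorSpace n) y (φ y)) x

theorem MDiffSpinorAt.localRep {φ : Π x, S.Spinor ρ x} {x : M} (h : S.MDiffSpinorAt ρ φ x) :
    MDifferentiableAt (𝓡 n) 𝓘(ℝ, SpinorSpace n) (S.localRep ρ (S.indexAt x) φ) x :=
  (mdifferentiableAt_section (𝓡 n) φ).1 h

theorem localRep_self (φ : Π x, S.Spinor ρ x) (x : M) :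
    S.localRep ρ (S.indexAt x) φ x = φ x :=
  (S.spinorCore ρ).coordChange_self _ x (S.mem_baseSet_at x) (φ x)

theorem localRep_add (a : ι) (φ φ' : Π x, S.Spinor ρ x) :
    S.localRep ρ a (φ + φ') = S.localRep ρ a φ + S.localRep ρ a φ' := by
  funext x
  exact map_add ((S.spinorCore ρ).coordChange (S.indexAt x) a x) _ _

theorem localRep_smul (a : ι) (f : M → ℝ) (φ : Π x, S.Spinor ρ x) :
    S.localRep ρ a (f • φ) = f • S.localRep ρ a φ := by
  funext x
  exact map_smul ((S.spinorCore ρ).coordChange (S.indexAt x) a x) _ _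

/-- The differential at `x` of the representative of a section in the preferred trivialization. -/
def dRep (φ : Π x, S.Spinor ρ x) (x : M) : TangentSpace (𝓡 n) x →L[ℝ] S.Spinor ρ x :=
  mvfderiv (𝓡 n) (S.localRep ρ (S.indexAt x) φ) x

theorem dRep_add {φ φ' : Π x, S.Spinor ρ x} {x : M} (h : S.MDiffSpinorAt ρ φ x)
    (h' : S.MDiffSpinorAt ρ φ' x) :
    S.dRep ρ (φ + φ') x = S.dRep ρ φ x + S.dRep ρ φ' x := by
  have := mvfderiv_add (h.localRep S ρ) (h'.localRep S ρ)
  rw [← localRep_add] at this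
  exact this

theorem dRep_leibniz {φ : Π x, S.Spinor ρ x} {f : M → ℝ} {x : M} (h : S.MDiffSpinorAt ρ φ x)
    (hf : MDifferentiableAt (𝓡 n) 𝓘(ℝ) f x) :
    S.dRep ρ (f • φ) x = f x • S.dRep ρ φ x + (mvfderiv (𝓡 n) f x).smulRight (φ x) := by
  have := mvfderiv_smul hf (h.localRep S ρ)
  rw [← localRep_smul, localRep_self] at this
  exact this

/-- The local connection form `v ↦ ½ ∑_{i<j} g(∇ᵍ_v e_i, e_j) e_i e_j` of the spinor connection. -/
def connCl (nab : TangentConn n M) (x : M) : TangentSpace (𝓡 n) x →ₗ[ℝ] Cl n where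
  toFun v := (1 / 2 : ℝ) • ∑ i, ∑ j ∈ Finset.Ioi i,
    inner ℝ (nab (S.frame (S.indexAt x) i) x v) (S.e x j) • (gen i * gen j)
  map_add' u v := by
    simp [inner_add_left, add_smul, Finset.sum_add_distrib]
  map_smul' c v := by
    simp only [map_smul, inner_smul_left, mul_smul, Finset.smul_sum, RingHom.id_apply,
      conj_trivial]
    exact Finset.sum_congr rfl fun i _ => Finset.sum_congr rfl fun j _ => smul_comm _ _ _

/-- The spinor connection `∇ᵍ` induced by the Levi-Civita connection. -/
def spinConnG (nab : TangentConn n M) :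
    CovariantDerivative (𝓡 n) (SpinorSpace n) (S.Spinor ρ) where
  toFun φ x := S.dRep ρ φ x + S.actLin ρ x (S.connCl nab x) (φ x)
  isCovariantDerivativeOnUniv :=
    { add := fun {φ φ' x} h h' _ => by
        rw [S.dRep_add ρ h h', Pi.add_apply, actLin_add]
        abel
      leibniz := fun {φ f x} h hf _ => by
        rw [S.dRep_leibniz ρ h hf, Pi.smul_apply', actLin_smul, smul_add]
        abel }

/-- The spinor connection `∇ˢ_v φ = ∇ᵍ_v φ + s (v ⌟ T) · φ`. -/
def spinConn (nab : TangentConn n M) (T : Form3 n M) (s : ℝ) :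
    CovariantDerivative (𝓡 n) (SpinorSpace n) (S.Spinor ρ) where
  toFun φ x := S.spinConnG ρ nab φ x + s • S.actLin ρ x (S.contrTorCl T x) (φ x)
  isCovariantDerivativeOnUniv :=
    { add := fun {φ φ' x} h h' _ => by
        rw [(S.spinConnG ρ nab).isCovariantDerivativeOnUniv.add h h', Pi.add_apply, actLin_add,
          smul_add]
        abel
      leibniz := fun {φ f x} h hf _ => by
        rw [(S.spinConnG ρ nab).isCovariantDerivativeOnUniv.leibniz h hf, Pi.smul_apply',
          actLin_smul, smul_add, smul_comm s]
        abel }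

/-- The Dirac operator `Dˢφ = ∑ᵢ e_i · ∇ˢ_{e_i} φ`. -/
def dirac (nab : TangentConn n M) (T : Form3 n M) (s : ℝ) (φ : Π x, S.Spinor ρ x) :
    Π x, S.Spinor ρ x :=
  fun x => ∑ i, S.act ρ x (gen i) (S.spinConn ρ nab T s φ x (S.e x i))

/-- The twistor operator, `(Pˢφ)(v) = ∇ˢ_v φ + (1/n) v · Dˢφ`. -/
def twistorOp (nab : TangentConn n M) (T : Form3 n M) (s : ℝ) (φ : Π x, S.Spinor ρ x) (x : M) :
    TangentSpace (𝓡 n) x →L[ℝ] S.Spinor ρ x :=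
  S.spinConn ρ nab T s φ x + (1 / (n : ℝ)) • S.actLin ρ x (S.vecCl x) (S.dirac ρ nab T s φ x)

/-- Differentiability of a section of `Σ ⊕ Σ` amounts to that of its components. -/
theorem mdiff_components {Φ : Π x, S.Spinor ρ x × S.Spinor ρ x} {x : M}
    (h : MDifferentiableAt (𝓡 n) ((𝓡 n).prod 𝓘(ℝ, SpinorSpace n × SpinorSpace n))
      (fun y => TotalSpace.mk' (SpinorSpace n × SpinorSpace n)
        (E := (S.Spinor ρ) ×ᵇ (S.Spinor ρ)) y (Φ y)) x) :
    S.MDiffSpinorAt ρ (fun y => (Φ y).1) x ∧ S.MDiffSpinorAt ρ (fun y => (Φ y).2) x := by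
  have h' := (mdifferentiableAt_section (𝓡 n) (E := (S.Spinor ρ) ×ᵇ (S.Spinor ρ)) Φ).1 h
  exact ⟨(mdifferentiableAt_section (𝓡 n) _).2
      ((ContinuousLinearMap.fst ℝ (SpinorSpace n) (SpinorSpace n)).mdifferentiableAt.comp x h'),
    (mdifferentiableAt_section (𝓡 n) _).2
      ((ContinuousLinearMap.snd ℝ (SpinorSpace n) (SpinorSpace n)).mdifferentiableAt.comp x h')⟩

/-- The zeroth order terms of the connection `∇ˢᴱ` on `Σ ⊕ Σ`. -/
def twistorPot (nab : TangentConn n M) (T : Form3 n M) (s : ℝ) (x : M)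
    (ψ : S.Spinor ρ x × S.Spinor ρ x) :
    TangentSpace (𝓡 n) x →L[ℝ] S.Spinor ρ x × S.Spinor ρ x :=
  ((1 / (n : ℝ)) • S.actLin ρ x (S.vecCl x) ψ.2).prod
    (-((n : ℝ) / 2) • S.actLin ρ x (S.schoutenCl nab T s x) ψ.1
      - (s * n * (3 - 4 * s) / (((n : ℝ) - 1) * ((n : ℝ) - 2))) •
        S.actLin ρ x (LinearMap.mulRight ℝ (S.extDCl T x) ∘ₗ S.vecCl x
          + ((n : ℝ) - 1) • S.contrSigmaCl T x) ψ.1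
      - (s * n / (((n : ℝ) - 1) * ((n : ℝ) - 2))) •
        S.actLin ρ x ((8 * ((n : ℝ) - 1) / n) • S.contrTorCl T x
          + (12 / (n : ℝ)) • (LinearMap.mulRight ℝ (S.torCl T x) ∘ₗ S.vecCl x)) ψ.2)

theorem twistorPot_add (nab : TangentConn n M) (T : Form3 n M) (s : ℝ) (x : M)
    (ψ ψ' : S.Spinor ρ x × S.Spinor ρ x) :
    S.twistorPot ρ nab T s x (ψ + ψ') =
      S.twistorPot ρ nab T s x ψ + S.twistorPot ρ nab T s x ψ' := by
  ext1 v
  simp only [twistorPot, Prod.fst_add, Prod.snd_add, actLin_add, ContinuousLinearMap.prod_apply,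
    add_apply, sub_apply, smul_apply,
    Prod.mk_add_mk, Prod.mk.injEq]
  constructor <;> module

theorem twistorPot_smul (nab : TangentConn n M) (T : Form3 n M) (s : ℝ) (x : M) (c : ℝ)
    (ψ : S.Spinor ρ x × S.Spinor ρ x) :
    S.twistorPot ρ nab T s x (c • ψ) = c • S.twistorPot ρ nab T s x ψ := by
  ext1 v
  simp only [twistorPot, Prod.smul_fst, Prod.smul_snd, actLin_smul, ContinuousLinearMap.prod_apply,
    sub_apply, smul_apply, Prod.smul_mk, Prod.mk.injEq]
  constructor <;> module

/-- The connection `∇ˢᴱ` on the vector bundle `E = Σ ⊕ Σ`: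
`∇ˢᴱ_v (φ₁ ⊕ φ₂) = (∇ˢ_v φ₁ + (1/n) v · φ₂) ⊕
  (-(n/2) Schoutenˢ(v) · φ₁ - (sn(3-4s)/((n-1)(n-2))) [v · dT + (n-1) (v ⌟ σ_T)] · φ₁
    - (sn/((n-1)(n-2))) [(8(n-1)/n) (v ⌟ T) + (12/n) v · T] · φ₂ + ∇ˢ_v φ₂)`. -/
def twistorConn (nab : TangentConn n M) (T : Form3 n M) (s : ℝ) :
    CovariantDerivative (𝓡 n) (SpinorSpace n × SpinorSpace n) ((S.Spinor ρ) ×ᵇ (S.Spinor ρ)) where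
  toFun Φ x :=
    (S.spinConn ρ nab T s (fun y => (Φ y).1) x).prod (S.spinConn ρ nab T s (fun y => (Φ y).2) x)
      + S.twistorPot ρ nab T s x (Φ x)
  isCovariantDerivativeOnUniv :=
    { add := fun {Φ Φ' x} h h' _ => by
        have h₁ := S.mdiff_components ρ h
        have h₂ := S.mdiff_components ρ h'
        have e₁ := (S.spinConn ρ nab T s).isCovariantDerivativeOnUniv.add h₁.1 h₂.1
        have e₂ := (S.spinConn ρ nab T s).isCovariantDerivativeOnUniv.add h₁.2 h₂.2
        have e₃ := S.twistorPot_add ρ nab T s x (Φ x) (Φ' x)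
        ext1 v
        have e₁' := congrArg (fun L => L v) e₁
        have e₂' := congrArg (fun L => L v) e₂
        have e₃' := congrArg (fun L => L v) e₃
        refine (congrArg₂ (· + ·) (congrArg₂ Prod.mk e₁' e₂') e₃').trans ?_
        exact add_add_add_comm (G := S.Spinor ρ x × S.Spinor ρ x)
          (S.spinConn ρ nab T s (fun y => (Φ y).1) x v, S.spinConn ρ nab T s (fun y => (Φ y).2) x v)
          (S.spinConn ρ nab T s (fun y => (Φ' y).1) x v, S.spinConn ρ nab T s (fun y => (Φ' y).2) x v)
          (S.twistorPot ρ nab T s x (Φ x) v) (S.twistorPot ρ nab T s x (Φ' x) v)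
      leibniz := fun {Φ f x} h hf _ => by
        have h₁ := S.mdiff_components ρ h
        have e₁ := (S.spinConn ρ nab T s).isCovariantDerivativeOnUniv.leibniz h₁.1 hf
        have e₂ := (S.spinConn ρ nab T s).isCovariantDerivativeOnUniv.leibniz h₁.2 hf
        have e₃ := S.twistorPot_smul ρ nab T s x (f x) (Φ x)
        ext1 v
        have e₁' := congrArg (fun L => L v) e₁
        have e₂' := congrArg (fun L => L v) e₂
        have e₃' := congrArg (fun L => L v) e₃
        refine (congrArg₂ (· + ·) (congrArg₂ Prod.mk e₁' e₂') e₃').trans ?_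
        have key : ∀ (c d : ℝ) (A P B : S.Spinor ρ x × S.Spinor ρ x),
            (c • A + d • B) + c • P = c • (A + P) + d • B := by
          intro c d A P B
          module
        exact key (f x) (mvfderiv (𝓡 n) f x v)
          (S.spinConn ρ nab T s (fun y => (Φ y).1) x v, S.spinConn ρ nab T s (fun y => (Φ y).2) x v)
          (S.twistorPot ρ nab T s x (Φ x) v) (Φ x) }

/-! ### The kernel of the twistor operator -/

theorem IsSmoothSpinor.mdiff {φ : Π x, S.Spinor ρ x} (h : S.IsSmoothSpinor ρ φ) (x : M) :
    S.MDiffSpinorAt ρ φ x :=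
  (h x).mdifferentiableAt (by simp)

/-- Multiplication by a complex number on the spinor space, as a real-linear map. -/
def mulC (c : ℂ) : SpinorSpace n →L[ℝ] SpinorSpace n :=
  ((LinearMap.lsmul ℂ (SpinorSpace n) c).restrictScalars ℝ).toContinuousLinearMap

theorem localRep_smulC (a : ι) (c : ℂ) (φ : Π x, S.Spinor ρ x) :
    S.localRep ρ a (fun x => c • φ x) = mulC c ∘ S.localRep ρ a φ := by
  funext x
  exact Matrix.mulVec_smul (ρ (S.lift a (S.indexAt x) x)) c _

theorem IsSmoothSpinor.add {φ φ' : Π x, S.Spinor ρ x} (h : S.IsSmoothSpinor ρ φ)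
    (h' : S.IsSmoothSpinor ρ φ') : S.IsSmoothSpinor ρ (φ + φ') :=
  ContMDiff.add_section h h'

theorem IsSmoothSpinor.zero : S.IsSmoothSpinor ρ 0 :=
  contMDiff_zeroSection (n := ∞) ℝ (S.Spinor ρ)

theorem IsSmoothSpinor.smulC {φ : Π x, S.Spinor ρ x} (c : ℂ) (h : S.IsSmoothSpinor ρ φ) :
    S.IsSmoothSpinor ρ (c • φ) := by
  intro x
  refine (contMDiffAt_section x).2 ?_
  have h' := (contMDiffAt_section x).1 (h x)
  have := (mulC (n := n) c).contMDiff.contMDiffAt.comp x h'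
  have e := S.localRep_smulC ρ (S.indexAt x) c φ
  change ContMDiffAt (𝓡 n) 𝓘(ℝ, SpinorSpace n) ∞
    (S.localRep ρ (S.indexAt x) (fun x => c • φ x)) x
  rw [e]
  exact this

theorem act_smulC (x : M) (a : Cl n) (c : ℂ) (ψ : S.Spinor ρ x) :
    S.act ρ x a (c • ψ) = c • S.act ρ x a ψ :=
  Matrix.mulVec_smul (ρ a) c _

theorem dRep_smulC (c : ℂ) {φ : Π x, S.Spinor ρ x} {x : M} (h : S.MDiffSpinorAt ρ φ x)
    (v : TangentSpace (𝓡 n) x) : S.dRep ρ (c • φ) x v = c • S.dRep ρ φ x v := by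
  have h₁ : HasMFDerivAt (𝓡 n) 𝓘(ℝ, SpinorSpace n)
      (mulC c ∘ S.localRep ρ (S.indexAt x) φ) x
      ((mulC c).comp (mfderiv (𝓡 n) 𝓘(ℝ, SpinorSpace n) (S.localRep ρ (S.indexAt x) φ) x)) :=
    (mulC c).hasMFDerivAt.comp x (h.localRep S ρ).hasMFDerivAt
  rw [← localRep_smulC] at h₁
  exact congrArg (fun L => L v) h₁.mfderiv

theorem spinConn_smulC (nab : TangentConn n M) (T : Form3 n M) (s : ℝ) (c : ℂ)
    {φ : Π x, S.Spinor ρ x} {x : M} (h : S.MDiffSpinorAt ρ φ x) (v : TangentSpace (𝓡 n) x) :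
    S.spinConn ρ nab T s (c • φ) x v = c • S.spinConn ρ nab T s φ x v := by
  have e : ∀ χ : Π x, S.Spinor ρ x, S.spinConn ρ nab T s χ x v =
      S.dRep ρ χ x v + S.act ρ x (S.connCl nab x v) (χ x)
        + s • S.act ρ x (S.contrTorCl T x v) (χ x) := fun _ => rfl
  rw [e, e, S.dRep_smulC ρ c h, Pi.smul_apply, act_smulC, act_smulC, smul_add, smul_add]
  congr 1
  exact smul_comm (M := ℝ) (N := ℂ) (α := SpinorSpace n) s c _

theorem dirac_add (nab : TangentConn n M) (T : Form3 n M) (s : ℝ) {φ φ' : Π x, S.Spinor ρ x}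
    {x : M} (h : S.MDiffSpinorAt ρ φ x) (h' : S.MDiffSpinorAt ρ φ' x) :
    S.dirac ρ nab T s (φ + φ') x = S.dirac ρ nab T s φ x + S.dirac ρ nab T s φ' x := by
  simp only [dirac]
  rw [(S.spinConn ρ nab T s).isCovariantDerivativeOnUniv.add h h', ← Finset.sum_add_distrib]
  exact Finset.sum_congr rfl fun i _ => by rw [add_apply, map_add]

theorem dirac_smulC (nab : TangentConn n M) (T : Form3 n M) (s : ℝ) (c : ℂ)
    {φ : Π x, S.Spinor ρ x} {x : M} (h : S.MDiffSpinorAt ρ φ x) :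
    S.dirac ρ nab T s (c • φ) x = c • S.dirac ρ nab T s φ x := by
  simp only [dirac, Finset.smul_sum]
  exact Finset.sum_congr rfl fun i _ => by rw [S.spinConn_smulC ρ nab T s c h, act_smulC]

theorem twistorOp_add (nab : TangentConn n M) (T : Form3 n M) (s : ℝ) {φ φ' : Π x, S.Spinor ρ x}
    {x : M} (h : S.MDiffSpinorAt ρ φ x) (h' : S.MDiffSpinorAt ρ φ' x) :
    S.twistorOp ρ nab T s (φ + φ') x = S.twistorOp ρ nab T s φ x + S.twistorOp ρ nab T s φ' x := by
  simp only [twistorOp]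
  rw [S.dirac_add ρ nab T s h h', (S.spinConn ρ nab T s).isCovariantDerivativeOnUniv.add h h',
    actLin_add, smul_add]
  abel

theorem twistorOp_smulC (nab : TangentConn n M) (T : Form3 n M) (s : ℝ) (c : ℂ)
    {φ : Π x, S.Spinor ρ x} {x : M} (h : S.MDiffSpinorAt ρ φ x) (v : TangentSpace (𝓡 n) x) :
    S.twistorOp ρ nab T s (c • φ) x v = c • S.twistorOp ρ nab T s φ x v := by
  have e : ∀ χ : Π x, S.Spinor ρ x, S.twistorOp ρ nab T s χ x v =
      S.spinConn ρ nab T s χ x v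
        + (1 / (n : ℝ)) • S.act ρ x (S.vecCl x v) (S.dirac ρ nab T s χ x) := fun _ => rfl
  rw [e, e, S.spinConn_smulC ρ nab T s c h, S.dirac_smulC ρ nab T s c h, act_smulC, smul_add]
  congr 1
  exact smul_comm (M := ℝ) (N := ℂ) (α := SpinorSpace n) _ c _

/-- The smooth spinor fields in the kernel of the twistor operator `Pˢ` (the twistor spinors with
torsion), as a complex vector space. -/
def kerTwistor (nab : TangentConn n M) (T : Form3 n M) (s : ℝ) :
    Submodule ℂ (Π x, S.Spinor ρ x) where
  carrier := {φ | S.IsSmoothSpinor ρ φ ∧ ∀ x, S.twistorOp ρ nab T s φ x = 0}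
  zero_mem' := by
    refine ⟨IsSmoothSpinor.zero S ρ, fun x => ?_⟩
    have h₀ := (IsSmoothSpinor.zero S ρ).mdiff S ρ x
    have := S.twistorOp_add ρ nab T s h₀ h₀
    rw [add_zero] at this
    exact left_eq_add.1 this
  add_mem' := by
    rintro φ φ' ⟨h, hφ⟩ ⟨h', hφ'⟩
    refine ⟨h.add S ρ h', fun x => ?_⟩
    rw [S.twistorOp_add ρ nab T s (h.mdiff S ρ x) (h'.mdiff S ρ x), hφ x, hφ' x, add_zero]
  smul_mem' := by
    rintro c φ ⟨h, hφ⟩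
    refine ⟨h.smulC S ρ c, fun x => ?_⟩
    ext1 v
    rw [S.twistorOp_smulC ρ nab T s c (h.mdiff S ρ x), hφ x]
    exact smul_zero c

end SpinStructure
end Geometry
end TwistorTorsion
end

open TwistorTorsion

noncomputable section

namespace TwistorTorsion

open Filter CliffordAlgebra
open scoped Topology

/-! ### The Clifford algebra of `ℝⁿ` -/

/-! The twistor equation closes up after one differentiation. Let `φ` be a twistor spinor and `V_i =
∇ˢ_{e_i} Dˢφ`. Differentiating `∇ˢ_X φ = -(1/n) X · Dˢφ` and antisymmetrizing gives an integrability
condition (`FrameJet.bivCl_riem_apply`): `Rˢ(e_i, e_j)φ` equals `-(4s/n) T(e_i, e_j) · Dˢφ -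
(1/n)(e_j · V_i - e_i · V_j)`. Multiplying by `e_j` and summing over `j` determines `V_i` up to the
term `e_i · ∑ e_j · V_j`; a second contraction determines that sum. The coefficients to be inverted
are `1 - 2/n` and `2 - 2/n`, nonzero for `n ≥ 3` (`FrameJet.twistor_prolongation`).

What remains is the Clifford contraction of the curvature. It sees only the Ricci contraction and
the cyclic sum over three indices (`sum_gen_mul_bivCl`). Since `∇ᶜT = 0`, derivatives of `T` become
quadratic in `T`; hence `dT = 2σ_T`, the cyclic sum is `(6s - 8s²)σ_T`, and `Ricˢ` is symmetric
(`FrameJet.ext_eq`, `FrameJet.riem_cycle`, `FrameJet.ric_symm`). This produces exactly the zeroth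
order terms of `∇ˢᴱ`. The converse needs only the first component: contracting it with `e_i` gives
`Dˢφ = ψ`, and then it is the twistor equation.

All this algebra takes place at one point, in a `FrameJet`: the numbers `⟨∇_{e_i} e_j, e_k⟩`,
`T(e_i, e_j, e_k)` and their first derivatives. The analytic input is the Koszul formula (smoothness
of Christoffel symbols), the Jacobi identity (first Bianchi identity) and `[X, Y]f = X(Yf) - Y(Xf)`.

The spinor connection and the Dirac operator at `x` are defined in the preferred frame at `x`, which
may jump with `x`, so they cannot be differentiated as they stand. `SpinStructure.spinConn_localRep`
shows that the same formula holds in every trivialization; it rests on `spin_gauge`, the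
transformation rule of the connection form under the lifted transition functions.

Finally, in a fixed frame the pair `(φ, Dˢφ)` solves a linear total differential equation with
continuous coefficients. A Grönwall estimate along segments in a chart shows that its zero set is
open and closed (`exists_nhds_eq_zero`). On connected `M`, evaluation of `(φ, Dˢφ)` at one point is
therefore injective, which gives both the dimension bound and unique continuation. -/

theorem gen_mul_self {n : ℕ} (i : Fin n) : gen i * gen i = (-1 : Cl n) := by
  rw [gen, ι_sq_scalar]
  simp [negQ, QuadraticMap.weightedSumSquares_apply, Pi.single_apply]

theorem gen_anticomm {n : ℕ} {i j : Fin n} (h : i ≠ j) :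
    gen i * gen j = -(gen j * gen i : Cl n) := by
  rw [← add_eq_zero_iff_eq_neg, gen, gen, ι_mul_ι_add_swap, QuadraticMap.polar]
  simp only [negQ, QuadraticMap.weightedSumSquares_apply, Pi.single_apply, Pi.add_apply]
  rw [← Finset.sum_sub_distrib, ← Finset.sum_sub_distrib, Finset.sum_eq_zero, map_zero]
  intro k _
  by_cases hi : k = i
  · subst hi
    simp [h]
  · simp [hi]

theorem gen_mul_gen {n : ℕ} (i j : Fin n) :
    gen i * gen j = -(gen j * gen i : Cl n) - (if i = j then (2 : ℝ) else 0) • 1 := by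
  by_cases h : i = j
  · subst h
    rw [gen_mul_self, if_pos rfl, neg_neg, two_smul]
    abel
  · rw [gen_anticomm h, if_neg h, zero_smul, sub_zero]

theorem involute_gen {n : ℕ} (i : Fin n) : involute (gen i : Cl n) = -gen i := involute_ι _

theorem star_gen {n : ℕ} (i : Fin n) : star (gen i : Cl n) = -gen i := CliffordAlgebra.star_ι _

theorem ι_eq_sum_gen {n : ℕ} (v : Fin n → ℝ) : ι (negQ n) v = ∑ i, v i • gen i := by
  conv_lhs => rw [← Finset.univ_sum_single v]
  rw [map_sum]
  refine Finset.sum_congr rfl fun i _ => ?_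
  rw [gen, ← map_smul, ← Pi.single_smul, smul_eq_mul, mul_one]

theorem adjoin_gen {n : ℕ} : Algebra.adjoin ℝ (Set.range (gen : Fin n → Cl n)) = ⊤ := by
  rw [eq_top_iff, ← adjoin_range_ι, Algebra.adjoin_le_iff]
  rintro _ ⟨v, rfl⟩
  rw [ι_eq_sum_gen]
  exact sum_mem fun i _ => Subalgebra.smul_mem _ (Algebra.subset_adjoin (Set.mem_range_self i)) _

/-- Each generator with index in `s` anticommutes with `e_k`, so the sign picked up is the parity,
which `involute` records. -/
theorem mul_gen_of_mem_adjoin {n : ℕ} {s : Finset (Fin n)} {k : Fin n} (hk : k ∉ s) {z : Cl n}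
    (hz : z ∈ Algebra.adjoin ℝ (gen '' (s : Set (Fin n)))) : z * gen k = gen k * involute z := by
  induction hz using Algebra.adjoin_induction with
  | mem x hx =>
    obtain ⟨j, hj, rfl⟩ := hx
    rw [involute_gen, gen_anticomm (fun h : j = k => hk (h ▸ hj)), mul_neg]
  | algebraMap r => rw [AlgHom.commutes, Algebra.commutes]
  | add x y _ _ hx hy => rw [add_mul, hx, hy, map_add, mul_add]
  | mul x y _ _ hx hy => rw [mul_assoc, hy, ← mul_assoc, hx, map_mul, mul_assoc]

theorem involute_mem_adjoin {n : ℕ} {s : Set (Fin n)} {z : Cl n}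
    (hz : z ∈ Algebra.adjoin ℝ (gen '' s)) : involute z ∈ Algebra.adjoin ℝ (gen '' s) := by
  induction hz using Algebra.adjoin_induction with
  | mem x hx =>
    obtain ⟨j, hj, rfl⟩ := hx
    rw [involute_gen]
    exact neg_mem (Algebra.subset_adjoin ⟨j, hj, rfl⟩)
  | algebraMap r => rw [AlgHom.commutes]; exact Subalgebra.algebraMap_mem _ r
  | add x y _ _ hx hy => rw [map_add]; exact add_mem hx hy
  | mul x y _ _ hx hy => rw [map_mul]; exact mul_mem hx hy

/-- An element of the subalgebra generated by `s ∪ {k}` is of the form `a + e_k b`, with `a` and `b`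
in the subalgebra generated by `s`. -/
theorem exists_of_mem_adjoin_insert {n : ℕ} {s : Finset (Fin n)} {k : Fin n} (hk : k ∉ s)
    {z : Cl n} (hz : z ∈ Algebra.adjoin ℝ (gen '' ((insert k s : Finset (Fin n)) : Set (Fin n)))) :
    ∃ a ∈ Algebra.adjoin ℝ (gen '' (s : Set (Fin n))),
      ∃ b ∈ Algebra.adjoin ℝ (gen '' (s : Set (Fin n))), z = a + gen k * b := by
  induction hz using Algebra.adjoin_induction with
  | mem x hx =>
    obtain ⟨j, hj, rfl⟩ := hx
    rcases Finset.mem_insert.1 (Finset.mem_coe.1 hj) with rfl | hj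
    · exact ⟨0, zero_mem _, 1, one_mem _, by simp⟩
    · exact ⟨gen j, Algebra.subset_adjoin ⟨j, hj, rfl⟩, 0, zero_mem _, by simp⟩
  | algebraMap r => exact ⟨_, Subalgebra.algebraMap_mem _ r, 0, zero_mem _, by simp⟩
  | add x y _ _ hx hy =>
    obtain ⟨a, ha, b, hb, rfl⟩ := hx
    obtain ⟨a', ha', b', hb', rfl⟩ := hy
    exact ⟨a + a', add_mem ha ha', b + b', add_mem hb hb', by rw [mul_add]; abel⟩
  | mul x y _ _ hx hy =>
    obtain ⟨a, ha, b, hb, rfl⟩ := hx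
    obtain ⟨a', ha', b', hb', rfl⟩ := hy
    refine ⟨a * a' - involute b * b',
      sub_mem (mul_mem ha ha') (mul_mem (involute_mem_adjoin hb) hb'),
      involute a * b' + b * a', add_mem (mul_mem (involute_mem_adjoin ha) hb') (mul_mem hb ha'), ?_⟩
    have h₁ : a * (gen k * b') = gen k * (involute a * b') := by
      rw [← mul_assoc, mul_gen_of_mem_adjoin hk ha, mul_assoc]
    have h₂ : gen k * b * (gen k * b') = -(involute b * b') := by
      rw [mul_assoc, ← mul_assoc b, mul_gen_of_mem_adjoin hk hb, ← mul_assoc, ← mul_assoc,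
        gen_mul_self, neg_one_mul, neg_mul]
    rw [add_mul, mul_add, mul_add, h₁, h₂, mul_add, mul_assoc (gen k) b a']
    abel

/-- Adjoining one more generator at most doubles a spanning set, by the normal form `a + e_k b`.
Finiteness provides the coordinates used to differentiate Clifford algebra valued functions. -/
instance finite_Cl {n : ℕ} : Module.Finite ℝ (Cl n) := by
  have key : ∀ s : Finset (Fin n),
      (Subalgebra.toSubmodule (Algebra.adjoin ℝ (gen '' (s : Set (Fin n))))).FG := by
    intro s
    induction s using Finset.induction_on with
    | empty =>
      rw [Finset.coe_empty, Set.image_empty, Algebra.adjoin_empty, Algebra.toSubmodule_bot]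
      exact Submodule.one_eq_span (R := ℝ) (A := Cl n) ▸ Submodule.fg_span_singleton 1
    | insert k s hk ih =>
      have h := ih.sup (ih.map (LinearMap.mulLeft ℝ (gen k : Cl n)))
      have this : Subalgebra.toSubmodule
          (Algebra.adjoin ℝ (gen '' ((insert k s : Finset (Fin n)) : Set (Fin n)))) ≤
          Subalgebra.toSubmodule (Algebra.adjoin ℝ (gen '' (s : Set (Fin n)))) ⊔
            (Subalgebra.toSubmodule (Algebra.adjoin ℝ (gen '' (s : Set (Fin n))))).map
              (LinearMap.mulLeft ℝ (gen k : Cl n)) := by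
        intro z hz
        obtain ⟨a, ha, b, hb, rfl⟩ := exists_of_mem_adjoin_insert hk hz
        exact Submodule.add_mem_sup ha ⟨b, hb, rfl⟩
      have hfin := Module.Finite.iff_fg.2 h
      exact Module.Finite.iff_fg.1 (Submodule.finiteDimensional_of_le this)
  refine ⟨?_⟩
  have h := key Finset.univ
  rwa [Finset.coe_univ, Set.image_univ, adjoin_gen, Algebra.top_toSubmodule] at h

/-- An even element of the Clifford algebra that commutes with all vectors is a scalar. -/
theorem exists_algebraMap_of_even_of_commute {n : ℕ} {z : Cl n} (hz : involute z = z)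
    (hc : ∀ i, gen i * z = z * gen i) : ∃ r : ℝ, z = algebraMap ℝ (Cl n) r := by
  have key : ∀ s : Finset (Fin n), z ∈ Algebra.adjoin ℝ (gen '' (s : Set (Fin n))) →
      ∃ r : ℝ, z = algebraMap ℝ (Cl n) r := by
    intro s
    induction s using Finset.induction_on with
    | empty =>
      rw [Finset.coe_empty, Set.image_empty, Algebra.adjoin_empty, Algebra.mem_bot]
      rintro ⟨r, hr⟩
      exact ⟨r, hr.symm⟩
    | insert k s hk ih =>
      intro h
      obtain ⟨a, ha, b, hb, h⟩ := exists_of_mem_adjoin_insert hk h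
      -- With `z = a + e_k b`, evenness gives one expression for `z` in terms of `involute a` and
      -- `involute b`, and commutation with `e_k` gives the same expression with the opposite sign
      -- in front of `e_k`. Their difference kills `b`, so the generator `e_k` does not occur in
      -- `z`.
      have hz' : involute a - gen k * involute b = a + gen k * b := by
        rw [h, map_add, map_mul, involute_gen, neg_mul, ← sub_eq_add_neg] at hz
        exact hz
      have h₁ : gen k * (a + gen k * b) = gen k * (involute a + gen k * involute b) := by
        rw [← h, hc k, h, add_mul, mul_gen_of_mem_adjoin hk ha, mul_assoc,
          mul_gen_of_mem_adjoin hk hb, mul_add]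
      have h₂ : ∀ w : Cl n, gen k * (gen k * w) = -w := fun w => by
        rw [← mul_assoc, gen_mul_self, neg_one_mul]
      have h₃ : a + gen k * b = involute a + gen k * involute b := by
        have := congrArg (gen k * ·) h₁
        simpa only [h₂, neg_inj] using this
      have h₄ : gen k * involute b = 0 := by
        have h₅ : (2 : ℝ) • (gen k * involute b) = 0 := by
          rw [two_smul]
          have := hz'.trans h₃
          rw [sub_eq_iff_eq_add, add_assoc] at this
          simpa using this
        exact (smul_eq_zero.1 h₅).resolve_left two_ne_zero
      have h₅ : b = 0 := by
        have : involute b = 0 := by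
          have := congrArg (gen k * ·) h₄
          simpa only [h₂, mul_zero, neg_eq_zero] using this
        rw [← involute_involute b, this, map_zero]
      rw [h₅, mul_zero, add_zero] at h
      exact ih (h ▸ ha)
  refine key Finset.univ ?_
  rw [Finset.coe_univ, Set.image_univ, adjoin_gen]
  exact Algebra.mem_top

/-- Real scalars are fixed by `star`. In `spin_gauge` this rules out a scalar discrepancy, which the
action on vectors cannot detect. -/
theorem eq_zero_of_even_of_commute_of_star {n : ℕ} {z : Cl n} (hz : involute z = z)
    (hc : ∀ i, gen i * z = z * gen i) (hs : star z = -z) : z = 0 := by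
  obtain ⟨r, rfl⟩ := exists_algebraMap_of_even_of_commute hz hc
  rw [CliffordAlgebra.star_algebraMap, eq_neg_iff_add_eq_zero, ← two_smul ℝ] at hs
  exact (smul_eq_zero.1 hs).resolve_left two_ne_zero

/-! ### Clifford algebra elements of forms -/

theorem sum_eq_factorial_smul_sum_strictMono {n k : ℕ} {V : Type*} [AddCommGroup V]
    (F : (Fin k → Fin n) → V) (hF : ∀ f (σ : Equiv.Perm (Fin k)), F (f ∘ σ) = F f)
    (h₀ : ∀ f, ¬ Function.Injective f → F f = 0)
    [DecidablePred fun f : Fin k → Fin n => StrictMono f] :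
    ∑ f, F f = k.factorial • ∑ f with StrictMono f, F f := by
  classical
  have h₁ : ∀ σ : Equiv.Perm (Fin k), ∑ f with StrictMono f, F f =
      ∑ f, if StrictMono (f ∘ σ) then F f else 0 := by
    intro σ
    rw [Finset.sum_filter]
    refine Fintype.sum_equiv (σ.arrowCongr (Equiv.refl (Fin n))) _ _ fun f => ?_
    have : (σ.arrowCongr (Equiv.refl (Fin n))) f ∘ σ = f := by
      funext i
      simp [Equiv.arrowCongr]
    rw [this, ← hF (σ.arrowCongr (Equiv.refl (Fin n)) f) σ, this]
  have h₂ : ∑ σ : Equiv.Perm (Fin k), ∑ f with StrictMono f, F f =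
      k.factorial • ∑ f with StrictMono f, F f := by
    rw [Finset.sum_const, Finset.card_univ, Fintype.card_perm, Fintype.card_fin]
  rw [← h₂, Finset.sum_congr rfl fun σ _ => h₁ σ, Finset.sum_comm]
  refine Finset.sum_congr rfl fun f _ => ?_
  by_cases hf : Function.Injective f
  · rw [Finset.sum_eq_single (Tuple.sort f), if_pos]
    · exact (Tuple.monotone_sort f).strictMono_of_injective (hf.comp (Tuple.sort f).injective)
    · intro σ _ hσ
      rw [if_neg]
      intro h
      refine hσ (Equiv.ext fun i => hf ?_)
      exact congrFun (Tuple.unique_monotone h.monotone (Tuple.monotone_sort f)) i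
    · simp
  · rw [h₀ f hf]
    simp

/-- Adjacent transpositions generate the symmetric group, so in the applications a single
anticommutation has to be checked at a time. -/
theorem perm_invariant_of_adjacent {n k : ℕ} {V : Type*} (F : (Fin (k + 1) → Fin n) → V)
    (hF : ∀ f (i : Fin k), F (f ∘ Equiv.swap i.castSucc i.succ) = F f) (f : Fin (k + 1) → Fin n)
    (σ : Equiv.Perm (Fin (k + 1))) : F (f ∘ σ) = F f := by
  have h : σ ∈ Submonoid.closure
      (Set.range fun i : Fin k => Equiv.swap i.castSucc i.succ) := by
    rw [Equiv.Perm.mclosure_swap_castSucc_succ]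
    trivial
  induction h using Submonoid.closure_induction generalizing f with
  | mem σ hσ =>
    obtain ⟨i, rfl⟩ := hσ
    exact hF f i
  | one => rfl
  | mul σ τ _ _ hσ hτ => rw [Equiv.Perm.coe_mul, ← Function.comp_assoc, hτ, hσ]

theorem sum_fin_succ_arrow {k : ℕ} {α V : Type*} [Fintype α] [AddCommMonoid V]
    (F : (Fin (k + 1) → α) → V) : ∑ f, F f = ∑ i, ∑ f : Fin k → α, F (Fin.cons i f) := by
  rw [← Fintype.sum_prod_type']
  exact (Fintype.sum_equiv (Fin.consEquiv fun _ => α) _ _ fun _ => rfl).symm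

/-- The sign of the coefficient cancels the sign of the Clifford product under a swap, so increasing
pairs may be traded for all pairs. Unrestricted sums are what the contractions below manipulate; the
versions for 3-forms and 4-forms follow the same pattern. -/
theorem two_smul_formCl {n : ℕ} (c : Fin n → Fin n → ℝ) (hc : ∀ i j, c j i = -c i j) :
    (2 : ℝ) • formCl (fun f : Fin 2 → Fin n => c (f 0) (f 1)) =
      ∑ i, ∑ j, c i j • (gen i * gen j) := by
  classical
  have hc₀ : ∀ i, c i i = 0 := fun i => by linarith [hc i i]
  have h₁ : ∀ (f : Fin 2 → Fin n) (a : Fin 1),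
      (fun f : Fin 2 → Fin n => c (f 0) (f 1) • (gen (f 0) * gen (f 1) : Cl n))
        (f ∘ Equiv.swap a.castSucc a.succ) =
      (fun f : Fin 2 → Fin n => c (f 0) (f 1) • (gen (f 0) * gen (f 1) : Cl n)) f := by
    intro f a
    obtain rfl : a = 0 := Subsingleton.elim _ _
    change c (f 1) (f 0) • (gen (f 1) * gen (f 0) : Cl n) = c (f 0) (f 1) • (gen (f 0) * gen (f 1))
    by_cases h : f 0 = f 1
    · rw [h]
    · rw [hc (f 0), gen_anticomm h, neg_smul, smul_neg]
  have h₂ : ∀ f : Fin 2 → Fin n, ¬ Function.Injective f →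
      c (f 0) (f 1) • (gen (f 0) * gen (f 1) : Cl n) = 0 := by
    intro f hf
    have : f 0 = f 1 := by
      by_contra h
      have h' := Ne.symm h
      exact hf fun i j hij => by fin_cases i <;> fin_cases j <;> first | rfl | contradiction
    rw [this, hc₀, zero_smul]
  have h := sum_eq_factorial_smul_sum_strictMono _ (perm_invariant_of_adjacent _ h₁) h₂
  simp only [sum_fin_succ_arrow, Fintype.sum_unique] at h
  refine Eq.trans ?_ h.symm
  rw [formCl, ← Nat.cast_smul_eq_nsmul ℝ]
  refine congrArg₂ (· • ·) rfl (Finset.sum_congr (by ext; simp) fun f _ => ?_)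
  simp [List.ofFn_succ]

theorem six_smul_formCl {n : ℕ} (c : Fin n → Fin n → Fin n → ℝ)
    (hc : ∀ i j k, c j i k = -c i j k) (hc' : ∀ i j k, c i k j = -c i j k) :
    (6 : ℝ) • formCl (fun f : Fin 3 → Fin n => c (f 0) (f 1) (f 2)) =
      ∑ i, ∑ j, ∑ k, c i j k • (gen i * (gen j * gen k)) := by
  classical
  have hc₀ : ∀ i j, c i i j = 0 := fun i j => by linarith [hc i i j]
  have hc₁ : ∀ i j, c i j j = 0 := fun i j => by linarith [hc' i j j]
  have hc₂ : ∀ i j, c i j i = 0 := fun i j => by linarith [hc' i i j, hc₀ i j]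
  have h₁ : ∀ (f : Fin 3 → Fin n) (a : Fin 2),
      (fun f : Fin 3 → Fin n => c (f 0) (f 1) (f 2) • (gen (f 0) * (gen (f 1) * gen (f 2)) : Cl n))
        (f ∘ Equiv.swap a.castSucc a.succ) =
      (fun f : Fin 3 → Fin n =>
        c (f 0) (f 1) (f 2) • (gen (f 0) * (gen (f 1) * gen (f 2)) : Cl n)) f := by
    intro f a
    obtain rfl | rfl : a = 0 ∨ a = 1 := by omega
    · change c (f 1) (f 0) (f 2) • (gen (f 1) * (gen (f 0) * gen (f 2)) : Cl n) =
        c (f 0) (f 1) (f 2) • (gen (f 0) * (gen (f 1) * gen (f 2)) : Cl n)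
      by_cases h : f 0 = f 1
      · rw [h]
      · rw [hc (f 0), ← mul_assoc, ← mul_assoc, gen_anticomm h, neg_smul, neg_mul, smul_neg]
    · change c (f 0) (f 2) (f 1) • (gen (f 0) * (gen (f 2) * gen (f 1)) : Cl n) =
        c (f 0) (f 1) (f 2) • (gen (f 0) * (gen (f 1) * gen (f 2)) : Cl n)
      by_cases h : f 1 = f 2
      · rw [h]
      · rw [hc' (f 0), gen_anticomm h, neg_smul, mul_neg, smul_neg]
  have h₂ : ∀ f : Fin 3 → Fin n, ¬ Function.Injective f →
      c (f 0) (f 1) (f 2) • (gen (f 0) * (gen (f 1) * gen (f 2)) : Cl n) = 0 := by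
    intro f hf
    have : c (f 0) (f 1) (f 2) = 0 := by
      by_contra h
      have h₀₁ : f 0 ≠ f 1 := fun e => h (by rw [e, hc₀])
      have h₁₂ : f 1 ≠ f 2 := fun e => h (by rw [e, hc₁])
      have h₀₂ : f 0 ≠ f 2 := fun e => h (by rw [e, hc₂])
      have h₁₀ := h₀₁.symm
      have h₂₁ := h₁₂.symm
      have h₂₀ := h₀₂.symm
      exact hf fun i j hij => by fin_cases i <;> fin_cases j <;> first | rfl | contradiction
    rw [this, zero_smul]
  have h := sum_eq_factorial_smul_sum_strictMono _ (perm_invariant_of_adjacent _ h₁) h₂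
  simp only [sum_fin_succ_arrow, Fintype.sum_unique] at h
  refine Eq.trans ?_ h.symm
  rw [formCl, ← Nat.cast_smul_eq_nsmul ℝ]
  refine congrArg₂ (· • ·) (by simp [Nat.factorial])
    (Finset.sum_congr (by ext; simp) fun f _ => ?_)
  simp [List.ofFn_succ]

theorem twentyfour_smul_formCl {n : ℕ} (c : Fin n → Fin n → Fin n → Fin n → ℝ)
    (hc : ∀ i j k l, c j i k l = -c i j k l) (hc' : ∀ i j k l, c i k j l = -c i j k l)
    (hc'' : ∀ i j k l, c i j l k = -c i j k l) :
    (24 : ℝ) • formCl (fun f : Fin 4 → Fin n => c (f 0) (f 1) (f 2) (f 3)) =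
      ∑ i, ∑ j, ∑ k, ∑ l, c i j k l • (gen i * (gen j * (gen k * gen l))) := by
  classical
  have hc₀ : ∀ i j k, c i i j k = 0 := fun i j k => by linarith [hc i i j k]
  have hc₁ : ∀ i j k, c i j j k = 0 := fun i j k => by linarith [hc' i j j k]
  have hc₂ : ∀ i j k, c i j k k = 0 := fun i j k => by linarith [hc'' i j k k]
  have hc₃ : ∀ i j k, c i j i k = 0 := fun i j k => by linarith [hc' i i j k, hc₀ i j k]
  have hc₄ : ∀ i j k, c i j k j = 0 := fun i j k => by linarith [hc'' i j j k, hc₁ i j k]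
  have hc₅ : ∀ i j k, c i j k i = 0 := fun i j k => by linarith [hc'' i j i k, hc₃ i j k]
  have h₁ : ∀ (f : Fin 4 → Fin n) (a : Fin 3),
      (fun f : Fin 4 → Fin n => c (f 0) (f 1) (f 2) (f 3) •
        (gen (f 0) * (gen (f 1) * (gen (f 2) * gen (f 3))) : Cl n))
        (f ∘ Equiv.swap a.castSucc a.succ) =
      (fun f : Fin 4 → Fin n => c (f 0) (f 1) (f 2) (f 3) •
        (gen (f 0) * (gen (f 1) * (gen (f 2) * gen (f 3))) : Cl n)) f := by
    intro f a
    obtain rfl | rfl | rfl : a = 0 ∨ a = 1 ∨ a = 2 := by omega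
    · change c (f 1) (f 0) (f 2) (f 3) •
        (gen (f 1) * (gen (f 0) * (gen (f 2) * gen (f 3))) : Cl n) =
        c (f 0) (f 1) (f 2) (f 3) • (gen (f 0) * (gen (f 1) * (gen (f 2) * gen (f 3))) : Cl n)
      by_cases h : f 0 = f 1
      · rw [h]
      · rw [hc (f 0), ← mul_assoc (gen (f 1)), ← mul_assoc (gen (f 0)), gen_anticomm h, neg_smul,
          neg_mul, smul_neg]
    · change c (f 0) (f 2) (f 1) (f 3) •
        (gen (f 0) * (gen (f 2) * (gen (f 1) * gen (f 3))) : Cl n) =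
        c (f 0) (f 1) (f 2) (f 3) • (gen (f 0) * (gen (f 1) * (gen (f 2) * gen (f 3))) : Cl n)
      by_cases h : f 1 = f 2
      · rw [h]
      · rw [hc' (f 0), ← mul_assoc (gen (f 2)), ← mul_assoc (gen (f 1)), gen_anticomm h, neg_smul,
          neg_mul, mul_neg, smul_neg]
    · change c (f 0) (f 1) (f 3) (f 2) •
        (gen (f 0) * (gen (f 1) * (gen (f 3) * gen (f 2))) : Cl n) =
        c (f 0) (f 1) (f 2) (f 3) • (gen (f 0) * (gen (f 1) * (gen (f 2) * gen (f 3))) : Cl n)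
      by_cases h : f 2 = f 3
      · rw [h]
      · rw [hc'' (f 0), gen_anticomm h, neg_smul, mul_neg, mul_neg, smul_neg]
  have h₂ : ∀ f : Fin 4 → Fin n, ¬ Function.Injective f →
      c (f 0) (f 1) (f 2) (f 3) •
        (gen (f 0) * (gen (f 1) * (gen (f 2) * gen (f 3))) : Cl n) = 0 := by
    intro f hf
    have : c (f 0) (f 1) (f 2) (f 3) = 0 := by
      by_contra h
      have h₀₁ : f 0 ≠ f 1 := fun e => h (by rw [e, hc₀])
      have h₁₂ : f 1 ≠ f 2 := fun e => h (by rw [e, hc₁])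
      have h₂₃ : f 2 ≠ f 3 := fun e => h (by rw [e, hc₂])
      have h₀₂ : f 0 ≠ f 2 := fun e => h (by rw [e, hc₃])
      have h₁₃ : f 1 ≠ f 3 := fun e => h (by rw [e, hc₄])
      have h₀₃ : f 0 ≠ f 3 := fun e => h (by rw [e, hc₅])
      have h₁₀ := h₀₁.symm
      have h₂₁ := h₁₂.symm
      have h₃₂ := h₂₃.symm
      have h₂₀ := h₀₂.symm
      have h₃₁ := h₁₃.symm
      have h₃₀ := h₀₃.symm
      exact hf fun i j hij => by fin_cases i <;> fin_cases j <;> first | rfl | contradiction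
    rw [this, zero_smul]
  have h := sum_eq_factorial_smul_sum_strictMono _ (perm_invariant_of_adjacent _ h₁) h₂
  simp only [sum_fin_succ_arrow, Fintype.sum_unique] at h
  refine Eq.trans ?_ h.symm
  rw [formCl, ← Nat.cast_smul_eq_nsmul ℝ]
  refine congrArg₂ (· • ·) (by simp [Nat.factorial])
    (Finset.sum_congr (by ext; simp) fun f _ => ?_)
  simp [List.ofFn_succ]

/-! ### Curvature identities at a point -/

/-- The values and first derivatives, at a point and in an orthonormal frame, of the Christoffel
symbols `⟨∇_{e_i} e_j, e_k⟩` of the Levi-Civita connection and of the components of a 3-form which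
is parallel for the connection `∇ + T/2`. -/
structure FrameJet (n : ℕ) where
  /-- Christoffel symbols -/
  chr : Fin n → Fin n → Fin n → ℝ
  /-- components of the torsion form -/
  tor : Fin n → Fin n → Fin n → ℝ
  /-- derivatives of the Christoffel symbols -/
  dchr : Fin n → Fin n → Fin n → Fin n → ℝ
  /-- derivatives of the components of the torsion form -/
  dtor : Fin n → Fin n → Fin n → Fin n → ℝ
  chr_antisymm : ∀ i j k, chr i k j = -chr i j k
  dchr_antisymm : ∀ i j k l, dchr i j l k = -dchr i j k l
  tor_swap_left : ∀ i j k, tor j i k = -tor i j k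
  tor_swap_right : ∀ i j k, tor i k j = -tor i j k
  parallel : ∀ i j k l, dtor i j k l =
    ∑ m, ((chr i j m + 1 / 2 * tor i j m) * tor m k l + (chr i k m + 1 / 2 * tor i k m) * tor j m l
      + (chr i l m + 1 / 2 * tor i l m) * tor j k m)
  bianchi : ∀ i j k l,
    (dchr i j k l - dchr j i k l + ∑ m, (chr j k m * chr i m l - chr i k m * chr j m l
      - (chr i j m - chr j i m) * chr m k l)) +
    (dchr j k i l - dchr k j i l + ∑ m, (chr k i m * chr j m l - chr j i m * chr k m l
      - (chr j k m - chr k j m) * chr m i l)) +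
    (dchr k i j l - dchr i k j l + ∑ m, (chr i j m * chr k m l - chr k j m * chr i m l
      - (chr k i m - chr i k m) * chr m j l)) = 0

namespace FrameJet

variable {n : ℕ} (J : FrameJet n)

/-- Connection coefficients of `∇ˢ`. -/
def cof (s : ℝ) (i j k : Fin n) : ℝ := J.chr i j k + 2 * s * J.tor i j k

/-- Derivatives of the connection coefficients of `∇ˢ`. -/
def dcof (s : ℝ) (i j k l : Fin n) : ℝ := J.dchr i j k l + 2 * s * J.dtor i j k l

/-- Structure functions of the frame. -/
def str (i j k : Fin n) : ℝ := J.chr i j k - J.chr j i k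

/-- Curvature components of `∇ˢ`. -/
def riem (s : ℝ) (i j k l : Fin n) : ℝ :=
  J.dcof s i j k l - J.dcof s j i k l + ∑ m, (J.cof s j k m * J.cof s i m l
    - J.cof s i k m * J.cof s j m l - J.str i j m * J.cof s m k l)

/-- Components of the 4-form `σ_T`. -/
def sig (i j k l : Fin n) : ℝ :=
  ∑ m, (J.tor m i j * J.tor m k l - J.tor m i k * J.tor m j l + J.tor m i l * J.tor m j k)

/-- Components of the exterior derivative of the torsion form. -/
def ext (i j k l : Fin n) : ℝ :=
  J.dtor i j k l - J.dtor j i k l + J.dtor k i j l - J.dtor l i j k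
  - ∑ m, (J.str i j m * J.tor m k l - J.str i k m * J.tor m j l + J.str i l m * J.tor m j k
    + J.str j k m * J.tor m i l - J.str j l m * J.tor m i k + J.str k l m * J.tor m i j)

/-- Components of the Ricci tensor of `∇ˢ`. -/
def ric (s : ℝ) (i k : Fin n) : ℝ := ∑ j, J.riem s i j j k

theorem tor_cycle (i j k : Fin n) : J.tor i j k = J.tor k i j := by
  rw [J.tor_swap_left i k j, J.tor_swap_right i j k, neg_neg]

theorem cof_antisymm (s : ℝ) (i j k : Fin n) : J.cof s i k j = -J.cof s i j k := by
  rw [cof, cof, J.chr_antisymm, J.tor_swap_right]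
  ring

/-- Parallelism turns the derivatives of `T` into connection terms. Their Christoffel part cancels
against the brackets, because the Levi-Civita connection is torsion free; the part from `T/2` leaves
the quadratic expression `2σ_T`. -/
theorem ext_eq (i j k l : Fin n) : J.ext i j k l = 2 * J.sig i j k l := by
  rw [ext, J.parallel, J.parallel, J.parallel, J.parallel, sig, Finset.mul_sum,
    ← Finset.sum_sub_distrib, ← Finset.sum_add_distrib, ← Finset.sum_sub_distrib,
    ← Finset.sum_sub_distrib]
  refine Finset.sum_congr rfl fun m _ => ?_
  have h₁ : ∀ x y, J.tor x y m = J.tor m x y := fun x y => J.tor_cycle x y m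
  have h₂ : ∀ x y, J.tor x m y = -J.tor m x y := fun x y => J.tor_swap_left m x y
  simp only [h₁, h₂, str, J.tor_swap_right m i j, J.tor_swap_right m i k, J.tor_swap_right m i l,
    J.tor_swap_right m j k, J.tor_swap_right m j l, J.tor_swap_right m k l]
  ring

/-- The curvature is quadratic in `s`. Its linear part is the antisymmetrized Levi-Civita derivative
of `T`, which parallelism makes quadratic in `T`; its `s²` part is the commutator of the
endomorphisms `T(e_i, ·)` and `T(e_j, ·)`. -/
theorem riem_eq (s : ℝ) (i j k l : Fin n) : J.riem s i j k l =
    J.riem 0 i j k l + 2 * s * J.sig i j k l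
      + 4 * s ^ 2 * (-J.sig i j k l + ∑ m, J.tor m k l * J.tor m i j) := by
  simp only [riem, dcof, cof, J.parallel, sig]
  simp only [mul_zero, zero_mul, add_zero, Finset.sum_const_zero, Finset.mul_sum,
    ← Finset.sum_neg_distrib,
    ← Finset.sum_add_distrib]
  have h : ∀ a b c : ℝ, ∀ f g h k : Fin n → ℝ, (∀ m, f m - g m + h m = k m) →
      a + ∑ m, f m - (b + ∑ m, g m) + ∑ m, h m = a - b + ∑ m, k m := by
    intro a b c f g h k hm
    rw [← Finset.sum_congr rfl fun m _ => hm m, Finset.sum_add_distrib, Finset.sum_sub_distrib]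
    ring
  have h' : ∀ a : ℝ, ∀ f g h : Fin n → ℝ,
      a + ∑ m, f m + ∑ m, g m + ∑ m, h m = a + ∑ m, (f m + g m + h m) := by
    intro a f g h
    rw [Finset.sum_add_distrib, Finset.sum_add_distrib]
    ring
  rw [h']
  -- Both sides now are sums over the same contracted index, and the identity holds summand by
  -- summand.
  refine h _ _ 0 _ _ _ _ fun m => ?_
  have h₁ : ∀ x y, J.tor x y m = J.tor m x y := fun x y => J.tor_cycle x y m
  have h₂ : ∀ x y, J.tor x m y = -J.tor m x y := fun x y => J.tor_swap_left m x y
  have h₃ : ∀ x y, J.chr x m y = -J.chr x y m := fun x y => J.chr_antisymm x y m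
  simp only [h₁, h₂, h₃, str, J.tor_swap_right m i j]
  ring

/-- This is metricity of `∇ˢ`: its connection coefficients and their derivatives are skew in the
last two indices. -/
theorem riem_antisymm (s : ℝ) (i j k l : Fin n) : J.riem s i j l k = -J.riem s i j k l := by
  simp only [riem, dcof, J.parallel]
  rw [J.dchr_antisymm, J.dchr_antisymm j]
  have e : ∀ a b s : ℝ, ∀ f g h f' g' h' : Fin n → ℝ,
      (∀ m, 2 * s * f m - 2 * s * g m + h m = -(2 * s * f' m - 2 * s * g' m + h' m)) →
      (-a + 2 * s * ∑ m, f m) - (-b + 2 * s * ∑ m, g m) + ∑ m, h m =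
        -(a + 2 * s * ∑ m, f' m - (b + 2 * s * ∑ m, g' m) + ∑ m, h' m) := by
    intro a b s f g h f' g' h' hm
    have := Finset.sum_congr (rfl : (Finset.univ : Finset (Fin n)) = _) fun m _ => hm m
    simp only [Finset.sum_add_distrib, Finset.sum_sub_distrib, Finset.sum_neg_distrib,
      ← Finset.mul_sum] at this
    linarith
  refine e _ _ s _ _ _ _ _ _ fun m => ?_
  have h₁ : ∀ x y, J.tor x y m = J.tor m x y := fun x y => J.tor_cycle x y m
  have h₂ : ∀ x y, J.tor x m y = -J.tor m x y := fun x y => J.tor_swap_left m x y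
  have h₃ : ∀ x y, J.cof s x m y = -J.cof s x y m := fun x y => J.cof_antisymm s x y m
  simp only [h₁, h₂, h₃, str, J.tor_swap_right m k l, J.cof_antisymm s m k l]
  ring

theorem riem_zero (i j k l : Fin n) : J.riem 0 i j k l =
    J.dchr i j k l - J.dchr j i k l + ∑ m, (J.chr j k m * J.chr i m l - J.chr i k m * J.chr j m l
      - (J.chr i j m - J.chr j i m) * J.chr m k l) := by
  simp [riem, dcof, cof, str]

theorem riem_swap_left (i j k l : Fin n) : J.riem 0 j i k l = -J.riem 0 i j k l := by
  rw [riem_zero, riem_zero, neg_add, ← Finset.sum_neg_distrib]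
  congr 1
  · ring
  · exact Finset.sum_congr rfl fun m _ => by ring

theorem riem_bianchi (i j k l : Fin n) :
    J.riem 0 i j k l + J.riem 0 j k i l + J.riem 0 k i j l = 0 := by
  simp only [riem_zero]
  exact J.bianchi i j k l

/-- The classical octahedron argument: a linear combination of instances of the two antisymmetries
and of the Bianchi identity. It is made for `s = 0` only, where the cyclic sum vanishes. -/
theorem riem_pair (i j k l : Fin n) : J.riem 0 i j k l = J.riem 0 k l i j := by
  have a := J.riem_antisymm 0
  have b := J.riem_swap_left
  have c := J.riem_bianchi
  linarith [a i j k l, a j k i l, a k i j l, a j l k i, a l k j i, a k j l i, a k l i j, a l i k j,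
    a i k l j, a l i j k, a i j l k, a j l i k, b i j k l, b i j l k, b j k i l, b j k l i,
    b k l i j, b k l j i, b k i j l, b k i l j, b l i j k, b l i k j, b j l k i, b j l i k,
    c i j k l, c j l k i, c k l i j, c l i j k, c j k l i, c i k j l, c i l j k]

theorem sig_swap_left (i j k l : Fin n) : J.sig j i k l = -J.sig i j k l := by
  rw [sig, sig, ← Finset.sum_neg_distrib]
  refine Finset.sum_congr rfl fun m _ => ?_
  rw [J.tor_swap_right m i j]
  ring

theorem sig_swap_mid (i j k l : Fin n) : J.sig i k j l = -J.sig i j k l := by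
  rw [sig, sig, ← Finset.sum_neg_distrib]
  refine Finset.sum_congr rfl fun m _ => ?_
  rw [J.tor_swap_right m j k]
  ring

theorem sig_swap_right (i j k l : Fin n) : J.sig i j l k = -J.sig i j k l := by
  rw [sig, sig, ← Finset.sum_neg_distrib]
  refine Finset.sum_congr rfl fun m _ => ?_
  rw [J.tor_swap_right m k l]
  ring

/-- The first Bianchi identity with torsion. In `riem_eq` the Levi-Civita part has cyclic sum zero,
`σ_T` is invariant under the cycle and contributes `3(2s - 4s²)σ_T`, and the products `T(e_m, e_k,
e_l) T(e_m, e_i, e_j)` sum to `σ_T` and contribute `4s²σ_T`. -/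
theorem riem_cycle (s : ℝ) (i j k l : Fin n) :
    J.riem s i j k l + J.riem s i k l j + J.riem s i l j k =
      (6 * s - 8 * s ^ 2) * J.sig i j k l := by
  have h₀ : J.riem 0 i j k l + J.riem 0 i k l j + J.riem 0 i l j k = 0 := by
    rw [J.riem_pair i j, J.riem_pair i k, J.riem_pair i l]
    linarith [J.riem_bianchi j k l i, J.riem_antisymm 0 k l i j, J.riem_antisymm 0 l j i k,
      J.riem_antisymm 0 j k i l]
  have h₁ : J.sig i k l j = J.sig i j k l := by
    rw [J.sig_swap_right i k j l, J.sig_swap_mid i j k l, neg_neg]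
  have h₂ : J.sig i l j k = J.sig i j k l := by
    rw [J.sig_swap_mid i j l k, J.sig_swap_right i j k l, neg_neg]
  have h₃ : ∑ m, J.tor m k l * J.tor m i j + ∑ m, J.tor m l j * J.tor m i k +
      ∑ m, J.tor m j k * J.tor m i l = J.sig i j k l := by
    rw [sig, ← Finset.sum_add_distrib, ← Finset.sum_add_distrib]
    refine Finset.sum_congr rfl fun m _ => ?_
    rw [J.tor_swap_right m j l]
    ring
  rw [J.riem_eq s i j, J.riem_eq s i k, J.riem_eq s i l, h₁, h₂]
  linear_combination h₀ + 4 * s ^ 2 * h₃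

/-- The only part of `riem_eq` that could break the symmetry is the one with `σ_T`, and it vanishes
on a repeated index. -/
theorem ric_symm (s : ℝ) (i k : Fin n) : J.ric s k i = J.ric s i k := by
  refine Finset.sum_congr rfl fun j _ => ?_
  have h₁ : J.riem 0 k j j i = J.riem 0 i j j k := by
    rw [J.riem_pair, J.riem_swap_left, J.riem_antisymm, neg_neg]
  have h₂ : ∀ i k, J.sig i j j k = 0 := fun i k => by linarith [J.sig_swap_mid i j j k]
  have h₃ : ∑ m, J.tor m j i * J.tor m k j = ∑ m, J.tor m j k * J.tor m i j :=
    Finset.sum_congr rfl fun m _ => by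
      rw [J.tor_swap_right m i j, J.tor_swap_right m j k]
      ring
  rw [J.riem_eq s k, J.riem_eq s i, h₁, h₂, h₂, h₃]

end FrameJet

/-! ### Curvature in the Clifford algebra -/

/-- The Clifford algebra element `¼ ∑ A_kl e_k e_l`, corresponding to the skew endomorphism
`e_k ↦ ∑ A_kl e_l`. -/
def bivCl {n : ℕ} (A : Fin n → Fin n → ℝ) : Cl n :=
  (1 / 4 : ℝ) • ∑ k, ∑ l, A k l • (gen k * gen l)

section

variable {n : ℕ}

theorem bivCl_add (A B : Fin n → Fin n → ℝ) :
    bivCl (fun k l => A k l + B k l) = bivCl A + bivCl B := by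
  simp only [bivCl, add_smul, Finset.sum_add_distrib, smul_add]

theorem bivCl_smul (c : ℝ) (A : Fin n → Fin n → ℝ) :
    bivCl (fun k l => c * A k l) = c • bivCl A := by
  simp only [bivCl, mul_smul, ← Finset.smul_sum]
  rw [smul_comm]

theorem bivCl_sub (A B : Fin n → Fin n → ℝ) :
    bivCl (fun k l => A k l - B k l) = bivCl A - bivCl B := by
  simp only [bivCl, sub_smul, Finset.sum_sub_distrib, smul_sub]

theorem bivCl_sum {ι : Type*} (s : Finset ι) (A : ι → Fin n → Fin n → ℝ) :
    bivCl (fun k l => ∑ m ∈ s, A m k l) = ∑ m ∈ s, bivCl (A m) := by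
  simp only [bivCl, Finset.sum_smul, ← Finset.smul_sum]
  congr 1
  exact (Finset.sum_congr rfl fun k _ => Finset.sum_comm).trans Finset.sum_comm

theorem gen_mul_gen_mul_gen (i j k : Fin n) : (gen i * (gen j * gen k) : Cl n) =
    gen j * (gen k * gen i) + (if i = k then (2 : ℝ) else 0) • gen j
      - (if i = j then (2 : ℝ) else 0) • gen k := by
  rw [← mul_assoc, gen_mul_gen i j, sub_mul, neg_mul, mul_assoc, gen_mul_gen i k, mul_sub, mul_neg]
  simp only [smul_mul_assoc, mul_smul_comm, one_mul, mul_one]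
  abel

/-- This explains the factor `¼`: each of the two generators in a summand can meet `e_j`, each
meeting costs a factor `2`, and skewness makes the two contributions equal. The commutator with a
vector is then exactly the skew endomorphism. -/
theorem bivCl_mul_gen {A : Fin n → Fin n → ℝ} (hA : ∀ i j, A j i = -A i j) (j : Fin n) :
    bivCl A * gen j = gen j * bivCl A + ∑ l, A j l • gen l := by
  have h : ∀ k l, A k l • (gen k * gen l : Cl n) * gen j = gen j * A k l • (gen k * gen l) +
      ((A k l * if j = k then 2 else 0) • gen l - (A k l * if j = l then 2 else 0) • gen k) := by
    intro k l
    rw [mul_smul_comm, gen_mul_gen_mul_gen j k l, smul_mul_assoc, mul_assoc, mul_smul, mul_smul]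
    module
  simp only [bivCl, smul_mul_assoc, Finset.sum_mul, mul_smul_comm, Finset.mul_sum] at h ⊢
  simp only [h, Finset.sum_add_distrib, Finset.sum_sub_distrib, smul_add]
  congr 1
  simp only [mul_ite, mul_zero, ite_smul, zero_smul, Finset.sum_ite_eq, Finset.mem_univ, if_true]
  rw [Finset.sum_comm]
  simp only [Finset.sum_ite_eq, Finset.mem_univ, if_true]
  rw [← Finset.sum_sub_distrib, Finset.smul_sum]
  refine Finset.sum_congr rfl fun l _ => ?_
  rw [hA j l]
  module

/-- The commutator with `bivCl A` is a derivation, so it acts on `e_k e_l` through its action on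
each factor. The matrix products appear in reversed order because row `k` stores the image of `e_k`;
for the endomorphisms themselves this is a Lie algebra homomorphism. -/
theorem bivCl_commutator {A B : Fin n → Fin n → ℝ} (hA : ∀ i j, A j i = -A i j) :
    bivCl A * bivCl B - bivCl B * bivCl A =
      bivCl fun k l => ∑ m, (B k m * A m l - A k m * B m l) := by
  have h : ∀ k l, bivCl A * (gen k * gen l) - gen k * gen l * bivCl A =
      ∑ m, A k m • (gen m * gen l) + ∑ m, A l m • (gen k * gen m) := by
    intro k l
    rw [← mul_assoc, bivCl_mul_gen hA, add_mul, mul_assoc, bivCl_mul_gen hA, mul_add, mul_assoc]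
    simp only [Finset.sum_mul, Finset.mul_sum, smul_mul_assoc, mul_smul_comm]
    abel
  have h' : bivCl A * bivCl B - bivCl B * bivCl A = (1 / 4 : ℝ) • ∑ k, ∑ l, B k l •
      (∑ m, A k m • (gen m * gen l) + ∑ m, A l m • (gen k * gen m)) := by
    simp only [← h]
    rw [bivCl.eq_def B]
    simp only [smul_mul_assoc, mul_smul_comm, Finset.sum_mul, Finset.mul_sum, smul_sub,
      Finset.sum_sub_distrib]
  rw [h', bivCl]
  congr 1
  simp only [Finset.sum_sub_distrib, sub_smul, smul_add, Finset.sum_add_distrib, Finset.smul_sum,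
    Finset.sum_smul, smul_smul]
  have h₁ : ∑ k, ∑ l, ∑ m, (B k l * A k m) • (gen m * gen l : Cl n) =
      -∑ k, ∑ l, ∑ m, (A k m * B m l) • (gen k * gen l) := by
    refine ((Finset.sum_congr rfl fun k _ => Finset.sum_comm).trans (Finset.sum_comm.trans
      (Finset.sum_congr rfl fun k _ => Finset.sum_comm))).trans ?_
    rw [← Finset.sum_neg_distrib]
    refine Finset.sum_congr rfl fun k _ => ?_
    rw [← Finset.sum_neg_distrib]
    refine Finset.sum_congr rfl fun l _ => ?_
    rw [← Finset.sum_neg_distrib]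
    refine Finset.sum_congr rfl fun m _ => ?_
    rw [hA m k]
    module
  have h₂ : ∑ k, ∑ l, ∑ m, (B k l * A l m) • (gen k * gen m : Cl n) =
      ∑ k, ∑ l, ∑ m, (B k m * A m l) • (gen k * gen l) :=
    Finset.sum_congr rfl fun k _ => Finset.sum_comm
  rw [h₁, h₂]
  abel

/-- Rotating the three generators cyclically in `A = ∑ r_ijk e_i e_j e_k` changes the sum only by
multiples of the trace term `ρ`. Adding the three rotations gives `∑ C_ijk e_i e_j e_k = 3A + 6ρ`,
and the left hand side is `A/4`. -/
theorem sum_gen_mul_bivCl {r C : Fin n → Fin n → Fin n → ℝ} (hr : ∀ i j k, r i k j = -r i j k)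
    (hC : ∀ i j k, r i j k + r j k i + r k i j = C i j k) :
    ∑ j, gen j * bivCl (r j) =
      (1 / 12 : ℝ) • ∑ i, ∑ j, ∑ k, C i j k • (gen i * (gen j * gen k))
        - (1 / 2 : ℝ) • ∑ l, (∑ j, r j j l) • gen l := by
  set ρ : Cl n := ∑ l, (∑ j, r j j l) • gen l with hρ
  set A : Cl n := ∑ i, ∑ j, ∑ k, r i j k • (gen i * (gen j * gen k)) with hA
  have h₁ : A = ∑ i, ∑ j, ∑ k, r k i j • (gen i * (gen j * gen k)) - (4 : ℝ) • ρ := by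
    have e : ∀ i j k, r i j k • (gen i * (gen j * gen k) : Cl n) =
        r i j k • (gen j * (gen k * gen i)) - ((r i k j * if i = k then 2 else 0) • gen j +
        (r i j k * if i = j then 2 else 0) • gen k) := by
      intro i j k
      rw [gen_mul_gen_mul_gen i j k, hr, mul_smul, mul_smul]
      module
    have e₁ : ∑ i, ∑ j, ∑ k, r i j k • (gen j * (gen k * gen i) : Cl n) =
        ∑ i, ∑ j, ∑ k, r k i j • (gen i * (gen j * gen k)) := by
      rw [Finset.sum_comm]
      exact Finset.sum_congr rfl fun j _ => Finset.sum_comm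
    have e₂ : ∑ i, ∑ j, ∑ k, (r i k j * if i = k then (2 : ℝ) else 0) • (gen j : Cl n) =
        (2 : ℝ) • ρ := by
      simp only [mul_ite, mul_zero, ite_smul, zero_smul, Finset.sum_ite_eq, Finset.mem_univ,
        if_true]
      rw [Finset.sum_comm, hρ, Finset.smul_sum]
      refine Finset.sum_congr rfl fun l _ => ?_
      rw [smul_smul, ← Finset.sum_smul, ← Finset.sum_mul, mul_comm]
    have e₃ : ∑ i, ∑ j, ∑ k, (r i j k * if i = j then (2 : ℝ) else 0) • (gen k : Cl n) =
        (2 : ℝ) • ρ := by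
      rw [← e₂]
      exact Finset.sum_congr rfl fun i _ => Finset.sum_comm
    rw [hA]
    simp only [e, Finset.sum_sub_distrib, Finset.sum_add_distrib]
    rw [e₁, e₂, e₃]
    module
  have h₂ : A = ∑ i, ∑ j, ∑ k, r j k i • (gen i * (gen j * gen k)) - (2 : ℝ) • ρ := by
    have e : ∀ i j k, r i j k • (gen i * (gen j * gen k) : Cl n) =
        r i j k • (gen k * (gen i * gen j)) - ((r i j k * if k = j then 2 else 0) • gen i +
        (r i j k * if k = i then -2 else 0) • gen j) := by
      intro i j k
      rw [gen_mul_gen_mul_gen k i j, mul_smul, mul_smul]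
      split_ifs <;> module
    have e₁ : ∑ i, ∑ j, ∑ k, r i j k • (gen k * (gen i * gen j) : Cl n) =
        ∑ i, ∑ j, ∑ k, r j k i • (gen i * (gen j * gen k)) := by
      rw [Finset.sum_congr rfl fun i _ => Finset.sum_comm]
      exact Finset.sum_comm
    have e₂ : ∑ i, ∑ j, ∑ k, (r i j k * if k = j then (2 : ℝ) else 0) • (gen i : Cl n) = 0 := by
      refine Finset.sum_eq_zero fun i _ => Finset.sum_eq_zero fun j _ => ?_
      have : r i j j = 0 := by linarith [hr i j j]
      simp [this]
    have e₃ : ∑ i, ∑ j, ∑ k, (r i j k * if k = i then (-2 : ℝ) else 0) • (gen j : Cl n) =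
        (2 : ℝ) • ρ := by
      simp only [mul_ite, mul_zero, ite_smul, zero_smul, Finset.sum_ite_eq', Finset.mem_univ,
        if_true]
      rw [Finset.sum_comm, hρ, Finset.smul_sum]
      refine Finset.sum_congr rfl fun l _ => ?_
      rw [smul_smul, ← Finset.sum_smul, Finset.mul_sum]
      refine congrArg (· • _) (Finset.sum_congr rfl fun i _ => ?_)
      rw [hr i i l]
      ring
    rw [hA]
    simp only [e, Finset.sum_sub_distrib, Finset.sum_add_distrib]
    rw [e₁, e₂, e₃, zero_add]
  have h₃ : ∑ i, ∑ j, ∑ k, C i j k • (gen i * (gen j * gen k) : Cl n) =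
      (3 : ℝ) • A + (6 : ℝ) • ρ := by
    simp only [← hC, add_smul, Finset.sum_add_distrib]
    rw [sub_eq_iff_eq_add.1 h₁.symm, sub_eq_iff_eq_add.1 h₂.symm, ← hA]
    module
  have h₄ : ∑ j, gen j * bivCl (r j) = (1 / 4 : ℝ) • A := by
    simp only [hA, bivCl, mul_smul_comm, Finset.mul_sum, Finset.smul_sum]
  rw [h₄, h₃]
  module

end

/-! ### Clifford contractions of the curvature -/

namespace FrameJet

variable {n : ℕ} (J : FrameJet n)

/-- The Clifford algebra element of `e_i ⌟ T`. -/
def contrTor (i : Fin n) : Cl n := (1 / 2 : ℝ) • ∑ j, ∑ k, J.tor i j k • (gen j * gen k)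

/-- The Clifford algebra element of `T`. -/
def torForm : Cl n := (1 / 6 : ℝ) • ∑ i, ∑ j, ∑ k, J.tor i j k • (gen i * (gen j * gen k))

/-- The Clifford algebra element of `e_i ⌟ σ_T`. -/
def contrSig (i : Fin n) : Cl n :=
  (1 / 6 : ℝ) • ∑ j, ∑ k, ∑ l, J.sig i j k l • (gen j * (gen k * gen l))

/-- The Clifford algebra element of `dT`. -/
def extForm : Cl n :=
  (1 / 24 : ℝ) • ∑ i, ∑ j, ∑ k, ∑ l, J.ext i j k l • (gen i * (gen j * (gen k * gen l)))

/-- The Schouten endomorphism in the Clifford algebra. -/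
def schouten (s : ℝ) (i : Fin n) : Cl n := (1 / ((n : ℝ) - 2)) •
  (-∑ k, J.ric s i k • gen k + ((∑ j, J.ric s j j) / (2 * ((n : ℝ) - 1))) • gen i)

theorem sum_gen_mul_contrTor : ∑ i, gen i * J.contrTor i = (3 : ℝ) • J.torForm := by
  simp only [contrTor, torForm, mul_smul_comm, Finset.mul_sum, ← Finset.smul_sum, smul_smul]
  norm_num

/-- Contracting a 4-form and multiplying back yields four times the form, and `4σ_T = 2dT`. -/
theorem sum_gen_mul_contrSig : ∑ i, gen i * J.contrSig i = (2 : ℝ) • J.extForm := by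
  have h : J.extForm = (1 / 24 : ℝ) • (2 : ℝ) •
      ∑ i, ∑ j, ∑ k, ∑ l, J.sig i j k l • (gen i * (gen j * (gen k * gen l))) := by
    simp only [extForm, ext_eq, Finset.smul_sum, smul_smul]
  rw [h]
  simp only [contrSig, mul_smul_comm, Finset.mul_sum, ← Finset.smul_sum, smul_smul]
  norm_num

theorem sum_gen_mul_self : ∑ i : Fin n, gen i * gen i = -(n : ℝ) • (1 : Cl n) := by
  simp [gen_mul_self, Nat.cast_smul_eq_nsmul]

/-- This is the structure equation `dω + [ω, ω]` for the spinor connection form `ω_i = bivCl (cof s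
i)` in a non-holonomic frame. It identifies the spinor curvature with the Clifford element of the
curvature tensor. -/
theorem bivCl_riem (s : ℝ) (i j : Fin n) : bivCl (J.riem s i j) =
    bivCl (J.dcof s i j) - bivCl (J.dcof s j i)
      + (bivCl (J.cof s i) * bivCl (J.cof s j) - bivCl (J.cof s j) * bivCl (J.cof s i))
      - ∑ m, J.str i j m • bivCl (J.cof s m) := by
  rw [bivCl_commutator fun k l => J.cof_antisymm s i k l]
  have h : ∑ m, J.str i j m • bivCl (J.cof s m) =
      bivCl fun k l => ∑ m, J.str i j m * J.cof s m k l := by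
    rw [bivCl_sum]
    exact Finset.sum_congr rfl fun m _ => (bivCl_smul _ _).symm
  rw [h, ← bivCl_sub, ← bivCl_add, ← bivCl_sub]
  refine congrArg bivCl (funext fun k => funext fun l => ?_)
  rw [riem, Finset.sum_sub_distrib]
  ring

/-- The coefficient is `(6s - 8s²) · 6 / 12`: the cyclic sum from `riem_cycle`, with the `6` coming
from the normalization of a 3-form. -/
theorem sum_gen_mul_bivCl_riem (s : ℝ) (i : Fin n) : ∑ j, gen j * bivCl (J.riem s i j) =
    (s * (3 - 4 * s)) • J.contrSig i - (1 / 2 : ℝ) • ∑ l, J.ric s i l • gen l := by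
  rw [sum_gen_mul_bivCl (r := J.riem s i) (fun j k l => J.riem_antisymm s i j k l)
    (fun j k l => J.riem_cycle s i j k l)]
  simp only [mul_smul, ← Finset.smul_sum, contrSig, ric]
  congr 1
  module

/-- By symmetry of Ricci only the anticommutators `e_i e_l + e_l e_i` matter, and they see just the
trace. -/
theorem sum_ric_smul (s : ℝ) : ∑ i, ∑ l, J.ric s i l • (gen i * gen l : Cl n) =
    -(∑ i, J.ric s i i) • (1 : Cl n) := by
  have h₁ : ∑ i, ∑ l, J.ric s i l • (gen i * gen l : Cl n) =
      ∑ i, ∑ l, J.ric s i l • (gen l * gen i : Cl n) := by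
    rw [Finset.sum_comm]
    exact Finset.sum_congr rfl fun i _ => Finset.sum_congr rfl fun l _ => by rw [J.ric_symm]
  have h₂ : ∑ i, ∑ l, J.ric s i l • (gen i * gen l : Cl n) =
      -∑ i, ∑ l, J.ric s i l • (gen l * gen i : Cl n) - (2 * ∑ i, J.ric s i i) • (1 : Cl n) := by
    have e : ∀ i l, J.ric s i l • (gen i * gen l : Cl n) =
        -(J.ric s i l • (gen l * gen i)) - (J.ric s i l * if i = l then 2 else 0) • (1 : Cl n) := by
      intro i l
      rw [gen_mul_gen i l, mul_smul]
      module
    simp only [e, Finset.sum_sub_distrib, Finset.sum_neg_distrib, mul_ite, mul_zero, ite_smul,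
      zero_smul, Finset.sum_ite_eq, Finset.mem_univ, if_true, ← Finset.sum_smul, ← Finset.sum_mul]
    rw [mul_comm]
  rw [← h₁] at h₂
  have h₃ : (2 : ℝ) • ∑ i, ∑ l, J.ric s i l • (gen i * gen l : Cl n) =
      (2 : ℝ) • (-(∑ i, J.ric s i i) • (1 : Cl n)) := by
    conv_lhs => rw [two_smul]
    nth_rewrite 1 [h₂]
    module
  exact smul_right_injective _ (two_ne_zero' ℝ) h₃

theorem sum_gen_mul_sum_gen_mul_bivCl_riem (s : ℝ) :
    ∑ i, gen i * ∑ j, gen j * bivCl (J.riem s i j) =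
      (2 * (s * (3 - 4 * s))) • J.extForm + (1 / 2 * ∑ i, J.ric s i i) • (1 : Cl n) := by
  simp only [sum_gen_mul_bivCl_riem, mul_sub, mul_smul_comm, Finset.sum_sub_distrib,
    ← Finset.smul_sum, sum_gen_mul_contrSig]
  have h : ∑ i, gen i * ∑ l, J.ric s i l • (gen l : Cl n) = -(∑ i, J.ric s i i) • (1 : Cl n) := by
    rw [← sum_ric_smul]
    simp only [Finset.mul_sum, mul_smul_comm]
  rw [h]
  module

/-! ### The algebraic prolongation of the twistor equation -/

variable {N : Type*} [AddCommGroup N] [Module ℝ N] (A : Cl n →ₐ[ℝ] Module.End ℝ N)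

/-- The integrability condition of the twistor equation: if `D_j u = -Ω_j u - (1/n) e_j v` in a
neighbourhood of the point, then `R(e_i, e_j) u = -(4s/n) T(e_i, e_j) v - (1/n)(e_j V_i - e_i V_j)`,
where `V_i = ∇_{e_i} v`. -/
theorem bivCl_riem_apply (s : ℝ) {u v : N} {U v' : Fin n → N} {DD : Fin n → Fin n → N}
    (hU : ∀ j, U j = -A (bivCl (J.cof s j)) u - (1 / (n : ℝ)) • A (gen j) v)
    (hDD : ∀ i j, DD i j = -A (bivCl (J.dcof s i j)) u - A (bivCl (J.cof s j)) (U i)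
      - (1 / (n : ℝ)) • A (gen j) (v' i))
    (hcomm : ∀ i j, DD i j - DD j i = ∑ m, J.str i j m • U m) (i j : Fin n) :
    A (bivCl (J.riem s i j)) u = -(4 * s / n) • ∑ m, J.tor i j m • A (gen m) v
      - (1 / (n : ℝ)) • (A (gen j) (v' i + A (bivCl (J.cof s i)) v)
        - A (gen i) (v' j + A (bivCl (J.cof s j)) v)) := by
  -- Moving the connection form past a vector completes the plain derivative of `v` to a covariant
  -- one; the price is the covariant derivative of the frame vector.
  have key : ∀ i j, A (bivCl (J.cof s j)) (A (gen i) v) = A (gen i) (A (bivCl (J.cof s j)) v) +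
      ∑ m, J.cof s j i m • A (gen m) v := by
    intro i j
    rw [← Module.End.mul_apply, ← map_mul, bivCl_mul_gen fun k l => J.cof_antisymm s j k l]
    simp only [map_add, map_sum, map_smul, map_mul, LinearMap.add_apply, LinearMap.sum_apply,
      LinearMap.smul_apply, Module.End.mul_apply]
  have h := hcomm i j
  rw [hDD, hDD] at h
  simp only [hU, map_sub, map_neg, map_smul, key, smul_sub, smul_add, smul_neg] at h
  simp only [Finset.sum_sub_distrib, Finset.sum_neg_distrib] at h
  rw [bivCl_riem]
  simp only [map_add, map_sub, map_sum, map_smul, map_mul, LinearMap.add_apply,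
    LinearMap.sub_apply, LinearMap.sum_apply, LinearMap.smul_apply, Module.End.mul_apply]
  -- The derivatives of the frame vectors, antisymmetrized and corrected by the bracket, form the
  -- torsion of `∇ˢ`, which is `4sT`.
  have h₄ : (4 * s) • ∑ m, J.tor i j m • A (gen m) v = ∑ m, J.cof s i j m • A (gen m) v
      - ∑ m, J.cof s j i m • A (gen m) v - ∑ m, J.str i j m • A (gen m) v := by
    rw [Finset.smul_sum, ← Finset.sum_sub_distrib, ← Finset.sum_sub_distrib]
    refine Finset.sum_congr rfl fun m _ => ?_
    rw [cof, cof, str, J.tor_swap_left i j]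
    module
  have h₅ : ∑ m, J.str i j m • (1 / (n : ℝ)) • A (gen m) v =
      (1 / (n : ℝ)) • ∑ m, J.str i j m • A (gen m) v := by
    rw [Finset.smul_sum]
    exact Finset.sum_congr rfl fun m _ => smul_comm _ _ _
  have h₆ : -(4 * s / n) • ∑ m, J.tor i j m • A (gen m) v =
      -(1 / (n : ℝ)) • (4 * s) • ∑ m, J.tor i j m • A (gen m) v := by
    rw [smul_smul]
    congr 1
    ring
  rw [h₅] at h
  rw [h₆, h₄]
  rw [← sub_eq_zero] at h ⊢
  rw [← neg_eq_zero] at h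
  rw [← h]
  module

/-- Solving the integrability condition for `V_i` takes two contractions. The first, `hQ`, contains
`V_i` with coefficient `1 - 2/n`, together with `DV = ∑ e_j · V_j`; the second, `hD`, contains only
`DV`, with coefficient `2 - 2/n`. Inverting these gives the factors `n/(n-2)` and `n/(2(n-1))`,
whose combination forms the Schouten endomorphism and the torsion terms. -/
theorem twistor_prolongation (hn : 3 ≤ n) (s : ℝ) {u v : N} {U v' : Fin n → N}
    {DD : Fin n → Fin n → N}
    (hU : ∀ j, U j = -A (bivCl (J.cof s j)) u - (1 / (n : ℝ)) • A (gen j) v)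
    (hDD : ∀ i j, DD i j = -A (bivCl (J.dcof s i j)) u - A (bivCl (J.cof s j)) (U i)
      - (1 / (n : ℝ)) • A (gen j) (v' i))
    (hcomm : ∀ i j, DD i j - DD j i = ∑ m, J.str i j m • U m) (i : Fin n) :
    v' i + A (bivCl (J.cof s i)) v = ((n : ℝ) / 2) • A (J.schouten s i) u
      + (s * n * (3 - 4 * s) / (((n : ℝ) - 1) * ((n : ℝ) - 2))) •
        A (gen i * J.extForm + ((n : ℝ) - 1) • J.contrSig i) u
      + (s * n / (((n : ℝ) - 1) * ((n : ℝ) - 2))) •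
        A ((8 * ((n : ℝ) - 1) / n) • J.contrTor i + (12 / (n : ℝ)) • (gen i * J.torForm)) v := by
  have hn₃ : (3 : ℝ) ≤ n := by exact_mod_cast hn
  have hn' : (n : ℝ) ≠ 0 := by linarith
  have h₁ : (n : ℝ) - 1 ≠ 0 := by linarith
  have h₂ : (n : ℝ) - 2 ≠ 0 := by linarith
  have hR := J.bivCl_riem_apply A s hU hDD hcomm
  -- From here on only the covariant derivatives `V_i` enter, as independent unknowns of a linear
  -- system.
  generalize hV : (fun i => v' i + A (bivCl (J.cof s i)) v) = V at hR
  have hV' : ∀ i, v' i + A (bivCl (J.cof s i)) v = V i := fun i => congrFun hV i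
  simp only [hV'] at hR ⊢
  obtain ⟨DV, hDV⟩ : ∃ DV, DV = ∑ j, A (gen j) (V j) := ⟨_, rfl⟩
  -- The single index `j = i` at which `e_j` and `e_i` fail to anticommute is what isolates `V_i`.
  have hanti : ∀ i, ∑ j, A (gen j) (A (gen i) (V j)) = -A (gen i) DV - (2 : ℝ) • V i := by
    intro i
    have e : ∀ j, A (gen j) (A (gen i) (V j)) =
        -A (gen i) (A (gen j) (V j)) - (if j = i then (2 : ℝ) else 0) • V j := by
      intro j
      rw [← Module.End.mul_apply, ← map_mul, gen_mul_gen j i]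
      simp only [map_sub, map_neg, map_mul, map_smul, map_one, LinearMap.sub_apply,
        LinearMap.neg_apply, LinearMap.smul_apply, Module.End.mul_apply, Module.End.one_apply]
    simp only [e, Finset.sum_sub_distrib, Finset.sum_neg_distrib, hDV, map_sum, ite_smul,
      zero_smul, Finset.sum_ite_eq', Finset.mem_univ, if_true]
  have hsq : ∀ w : N, ∑ j : Fin n, A (gen j) (A (gen j) w) = -(n : ℝ) • w := by
    intro w
    simp only [← Module.End.mul_apply, ← map_mul]
    rw [← LinearMap.sum_apply, ← map_sum, sum_gen_mul_self, map_smul, map_one,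
      LinearMap.smul_apply, Module.End.one_apply]
  have hQ : ∀ i, A (∑ j, gen j * bivCl (J.riem s i j)) u =
      -(8 * s / n) • A (J.contrTor i) v + (1 - 2 / (n : ℝ)) • V i
        - (1 / (n : ℝ)) • A (gen i) DV := by
    intro i
    have e₁ : ∑ j, A (gen j) (∑ m, J.tor i j m • A (gen m) v) =
        (2 : ℝ) • A (J.contrTor i) v := by
      rw [contrTor, map_smul, LinearMap.smul_apply, smul_smul]
      norm_num
    simp only [map_sum, LinearMap.sum_apply, map_mul, Module.End.mul_apply, hR]
    simp only [map_sub, map_smul, Finset.sum_sub_distrib, ← Finset.smul_sum]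
    rw [e₁, hsq, hanti]
    match_scalars <;> field_simp <;> ring
  have hD : (2 * (s * (3 - 4 * s))) • A J.extForm u + (1 / 2 * ∑ i, J.ric s i i) • u =
      -(24 * s / n) • A J.torForm v + (2 - 2 / (n : ℝ)) • DV := by
    have e₀ : A (∑ i, gen i * ∑ j, gen j * bivCl (J.riem s i j)) u =
        (2 * (s * (3 - 4 * s))) • A J.extForm u + (1 / 2 * ∑ i, J.ric s i i) • u := by
      rw [sum_gen_mul_sum_gen_mul_bivCl_riem, map_add, map_smul, map_smul, map_one]
      rfl
    have e : ∑ i, A (gen i) (A (J.contrTor i) v) = (3 : ℝ) • A J.torForm v := by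
      simp only [← Module.End.mul_apply, ← map_mul]
      rw [← LinearMap.sum_apply, ← map_sum, sum_gen_mul_contrTor, map_smul, LinearMap.smul_apply]
    rw [← e₀, map_sum, LinearMap.sum_apply]
    have e' : ∀ i, A (gen i * ∑ j, gen j * bivCl (J.riem s i j)) u =
        -(8 * s / n) • A (gen i) (A (J.contrTor i) v) + (1 - 2 / (n : ℝ)) • A (gen i) (V i)
          - (1 / (n : ℝ)) • A (gen i) (A (gen i) DV) := by
      intro i
      rw [map_mul, Module.End.mul_apply, hQ, map_sub, map_add, map_smul, map_smul, map_smul]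
    simp only [e', Finset.sum_sub_distrib, Finset.sum_add_distrib, ← Finset.smul_sum, hsq, ← hDV, e]
    match_scalars <;> field_simp <;> ring
  have hDV' : DV = ((n : ℝ) / (2 * ((n : ℝ) - 1))) •
      (((2 * (s * (3 - 4 * s))) • A J.extForm u + (1 / 2 * ∑ i, J.ric s i i) • u)
        + (24 * s / n) • A J.torForm v) := by
    rw [hD]
    match_scalars <;> field_simp
    ring
  have hVi : V i = ((n : ℝ) / ((n : ℝ) - 2)) • (A (∑ j, gen j * bivCl (J.riem s i j)) u
      + (8 * s / n) • A (J.contrTor i) v + (1 / (n : ℝ)) • A (gen i) DV) := by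
    rw [hQ i]
    match_scalars <;> field_simp <;> ring
  rw [hVi, sum_gen_mul_bivCl_riem, hDV', schouten]
  generalize ∑ j, J.ric s j j = κ
  generalize ∑ l, J.ric s i l • (gen l : Cl n) = r
  simp only [map_add, map_sub, map_neg, map_smul, map_mul, LinearMap.add_apply,
    LinearMap.sub_apply, LinearMap.neg_apply, LinearMap.smul_apply, Module.End.mul_apply]
  match_scalars <;> field_simp
  ring

end FrameJet

/-! ### Commuting derivatives along vector fields -/

section Calculus

variable {n : ℕ} {M : Type*} [TopologicalSpace M] [ChartedSpace (EuclideanSpace ℝ (Fin n)) M]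
  [IsManifold (𝓡 n) ∞ M] {F : Type*} [NormedAddCommGroup F] [NormedSpace ℝ F]

theorem mdifferentiableAt_comp_extChartAt_symm {f : M → F} {x y : M}
    (hy : y ∈ (extChartAt (𝓡 n) x).source) (hf : MDifferentiableAt (𝓡 n) 𝓘(ℝ, F) f y) :
    DifferentiableAt ℝ (f ∘ (extChartAt (𝓡 n) x).symm) (extChartAt (𝓡 n) x y) := by
  have : IsManifold (𝓡 n) 1 M := IsManifold.of_le (n := ∞) (by decide)
  have h := mdifferentiableWithinAt_extChartAt_symm (I := 𝓡 n) ((extChartAt (𝓡 n) x).map_source hy)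
  rw [ModelWithCorners.range_eq_univ, mdifferentiableWithinAt_univ] at h
  rw [← mdifferentiableAt_iff_differentiableAt]
  refine MDifferentiableAt.comp _ ?_ h
  rwa [(extChartAt (𝓡 n) x).left_inv hy]

theorem mvfderiv_eq_fderiv_comp_extChartAt_symm {f : M → F} {x y : M}
    (hy : y ∈ (extChartAt (𝓡 n) x).source) (hf : MDifferentiableAt (𝓡 n) 𝓘(ℝ, F) f y)
    (v : TangentSpace (𝓡 n) y) :
    mvfderiv (𝓡 n) f y v = fderiv ℝ (f ∘ (extChartAt (𝓡 n) x).symm) (extChartAt (𝓡 n) x y)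
      (mfderiv (𝓡 n) 𝓘(ℝ, EuclideanSpace ℝ (Fin n)) (extChartAt (𝓡 n) x) y v) := by
  have : IsManifold (𝓡 n) 1 M := IsManifold.of_le (n := ∞) (by decide)
  have h₁ := mdifferentiableAt_comp_extChartAt_symm hy hf
  have h₂ : MDifferentiableAt (𝓡 n) 𝓘(ℝ, EuclideanSpace ℝ (Fin n)) (extChartAt (𝓡 n) x) y :=
    mdifferentiableAt_extChartAt (by rwa [extChartAt_source] at hy)
  have h₃ : f =ᶠ[𝓝 y] (f ∘ (extChartAt (𝓡 n) x).symm) ∘ extChartAt (𝓡 n) x := by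
    filter_upwards [(isOpen_extChartAt_source (I := 𝓡 n) x).mem_nhds hy] with z hz
    simp only [Function.comp_apply]
    rw [(extChartAt (𝓡 n) x).left_inv hz]
  have h₄ : HasMFDerivAt (𝓡 n) 𝓘(ℝ, F) ((f ∘ (extChartAt (𝓡 n) x).symm) ∘ extChartAt (𝓡 n) x) y
      _ := HasMFDerivAt.comp y h₁.hasFDerivAt.hasMFDerivAt h₂.hasMFDerivAt
  have h₅ := (h₄.congr_of_eventuallyEq h₃).mfderiv
  exact congrArg (fun L => L v) h₅

/-- The tangent space at `x` is the model space, identified through this very chart. -/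
theorem mfderiv_extChartAt_self_apply (x : M) (v : TangentSpace (𝓡 n) x) :
    mfderiv (𝓡 n) 𝓘(ℝ, EuclideanSpace ℝ (Fin n)) (extChartAt (𝓡 n) x) x v = v := by
  rw [mfderiv_extChartAt_self]
  rfl

/-- A vector field in the chart around `x`. -/
def chartField (x : M) (X : Π y : M, TangentSpace (𝓡 n) y) :
    EuclideanSpace ℝ (Fin n) → EuclideanSpace ℝ (Fin n) :=
  VectorField.mpullbackWithin 𝓘(ℝ, EuclideanSpace ℝ (Fin n)) (𝓡 n) (extChartAt (𝓡 n) x).symm X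
    (Set.range (𝓡 n))

theorem chartField_apply {x y : M} (hy : y ∈ (extChartAt (𝓡 n) x).source)
    (X : Π y : M, TangentSpace (𝓡 n) y) : chartField x X (extChartAt (𝓡 n) x y) =
      mfderiv (𝓡 n) 𝓘(ℝ, EuclideanSpace ℝ (Fin n)) (extChartAt (𝓡 n) x) y (X y) := by
  have : IsManifold (𝓡 n) 1 M := IsManifold.of_le (n := ∞) (by decide)
  have hy' := (extChartAt (𝓡 n) x).map_source hy
  have h₁ := mfderivWithin_extChartAt_symm_comp_mfderiv_extChartAt' (I := 𝓡 n) hy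
  have h₂ := isInvertible_mfderivWithin_extChartAt_symm (I := 𝓡 n) hy'
  rw [chartField, VectorField.mpullbackWithin_apply]
  have h₃ : X ((extChartAt (𝓡 n) x).symm (extChartAt (𝓡 n) x y)) =
      mfderivWithin 𝓘(ℝ, EuclideanSpace ℝ (Fin n)) (𝓡 n) (extChartAt (𝓡 n) x).symm
        (Set.range (𝓡 n)) (extChartAt (𝓡 n) x y)
        (mfderiv (𝓡 n) 𝓘(ℝ, EuclideanSpace ℝ (Fin n)) (extChartAt (𝓡 n) x) y (X y)) := by
    have e := (extChartAt (𝓡 n) x).left_inv hy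
    have h₄ := congrArg (fun L => L (X y)) h₁
    refine Eq.trans ?_ h₄.symm
    change _ = X y
    exact eq_of_heq (by rw [e])
  rw [h₃]
  exact ContinuousLinearMap.IsInvertible.inverse_apply_eq h₂ |>.2 rfl

theorem differentiableAt_chartField {x : M} {X : Π y : M, TangentSpace (𝓡 n) y}
    (hX : MDifferentiableAt (𝓡 n) ((𝓡 n).prod 𝓘(ℝ, EuclideanSpace ℝ (Fin n)))
      (fun y => TotalSpace.mk' (EuclideanSpace ℝ (Fin n)) y (X y)) x) :
    DifferentiableAt ℝ (chartField x X) (extChartAt (𝓡 n) x x) := by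
  have : IsManifold (𝓡 n) 2 M := IsManifold.of_le (n := ∞) (by decide)
  have h := MDifferentiableWithinAt.differentiableWithinAt_mpullbackWithin_vectorField
    (I := 𝓡 n) hX.mdifferentiableWithinAt (s := Set.univ)
  have e : (extChartAt (𝓡 n) x).symm ⁻¹' Set.univ ∩ Set.range (𝓡 n) = Set.univ := by simp
  rw [e] at h
  exact differentiableWithinAt_univ.1 h

theorem mlieBracket_eq_lieBracket_chartField (x : M) (X Y : Π y : M, TangentSpace (𝓡 n) y) :
    VectorField.mlieBracket (𝓡 n) X Y x = VectorField.lieBracket ℝ (chartField x X) (chartField x Y)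
      (extChartAt (𝓡 n) x x) := by
  have : IsManifold (𝓡 n) 1 M := IsManifold.of_le (n := ∞) (by decide)
  have e : (extChartAt (𝓡 n) x).symm ⁻¹' Set.univ ∩ Set.range (𝓡 n) = Set.univ := by simp
  have h : ∀ w, (mfderiv (𝓡 n) 𝓘(ℝ, EuclideanSpace ℝ (Fin n)) (extChartAt (𝓡 n) x) x).inverse w =
      w := by
    intro w
    refine (ContinuousLinearMap.IsInvertible.inverse_apply_eq
      (isInvertible_mfderiv_extChartAt (mem_extChartAt_source x))).2 ?_
    exact (mfderiv_extChartAt_self_apply x w).symm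
  rw [← VectorField.mlieBracketWithin_univ, VectorField.mlieBracketWithin_apply, e,
    ← VectorField.lieBracketWithin_univ]
  exact h _

/-- In the chart at `x`, each iterated derivative is a Hessian term plus the derivative of the
coefficients of the inner field. The Hessian is symmetric, so the difference leaves the bracket of
the coefficient fields, and the chart has identity differential at `x`. -/
theorem mvfderiv_mlieBracket {f : M → F} {x : M} {X Y : Π y : M, TangentSpace (𝓡 n) y}
    (hf : ContMDiffAt (𝓡 n) 𝓘(ℝ, F) ∞ f x)
    (hX : MDifferentiableAt (𝓡 n) ((𝓡 n).prod 𝓘(ℝ, EuclideanSpace ℝ (Fin n)))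
      (fun y => TotalSpace.mk' (EuclideanSpace ℝ (Fin n)) y (X y)) x)
    (hY : MDifferentiableAt (𝓡 n) ((𝓡 n).prod 𝓘(ℝ, EuclideanSpace ℝ (Fin n)))
      (fun y => TotalSpace.mk' (EuclideanSpace ℝ (Fin n)) y (Y y)) x) :
    mvfderiv (𝓡 n) (fun y => mvfderiv (𝓡 n) f y (Y y)) x (X x)
      - mvfderiv (𝓡 n) (fun y => mvfderiv (𝓡 n) f y (X y)) x (Y x) =
      mvfderiv (𝓡 n) f x (VectorField.mlieBracket (𝓡 n) X Y x) := by
  have hM : IsManifold (𝓡 n) 1 M := IsManifold.of_le (n := ∞) (by decide)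
  have hx := mem_extChartAt_source (I := 𝓡 n) x
  set g := f ∘ (extChartAt (𝓡 n) x).symm with hg
  set z := extChartAt (𝓡 n) x x with hz
  have hgz : ContDiffAt ℝ 2 g z := by
    have h := (contMDiffAt_iff.1 hf).2
    rw [ModelWithCorners.range_eq_univ, contDiffWithinAt_univ] at h
    exact h.of_le (by exact WithTop.coe_le_coe.2 le_top)
  have hg' : DifferentiableAt ℝ (fderiv ℝ g) z :=
    (hgz.fderiv_right (m := 1) le_rfl).differentiableAt (by simp)
  have hid := mfderiv_extChartAt_self_apply (n := n) x
  have hev : ∀ᶠ y in 𝓝 x, MDifferentiableAt (𝓡 n) 𝓘(ℝ, F) f y := by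
    have h := (contMDiffAt_iff_contMDiffAt_nhds (n := 1) (by simp)).1
      (hf.of_le (by exact WithTop.coe_le_coe.2 le_top))
    filter_upwards [h] with y hy using hy.mdifferentiableAt (by simp)
  have key : ∀ {X Y : Π y : M, TangentSpace (𝓡 n) y},
      MDifferentiableAt (𝓡 n) ((𝓡 n).prod 𝓘(ℝ, EuclideanSpace ℝ (Fin n)))
        (fun y => TotalSpace.mk' (EuclideanSpace ℝ (Fin n)) y (Y y)) x →
      mvfderiv (𝓡 n) (fun y => mvfderiv (𝓡 n) f y (Y y)) x (X x) =
        fderiv ℝ (fderiv ℝ g) z (chartField x X z) (chartField x Y z)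
          + fderiv ℝ g z (fderiv ℝ (chartField x Y) z (chartField x X z)) := by
    intro X Y hY
    have h₁ : HasFDerivAt (fun w => fderiv ℝ g w (chartField x Y w)) _ z :=
      hg'.hasFDerivAt.clm_apply (differentiableAt_chartField hY).hasFDerivAt
    have h₂ : (fun y => mvfderiv (𝓡 n) f y (Y y)) =ᶠ[𝓝 x]
        (fun w => fderiv ℝ g w (chartField x Y w)) ∘ extChartAt (𝓡 n) x := by
      filter_upwards [hev, (isOpen_extChartAt_source (I := 𝓡 n) x).mem_nhds hx] with y hy hys
      rw [mvfderiv_eq_fderiv_comp_extChartAt_symm hys hy, Function.comp_apply,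
        chartField_apply hys]
    have h₃ : HasMFDerivAt (𝓡 n) 𝓘(ℝ, F)
        ((fun w => fderiv ℝ g w (chartField x Y w)) ∘ extChartAt (𝓡 n) x) x _ :=
      HasMFDerivAt.comp x h₁.hasMFDerivAt
        (mdifferentiableAt_extChartAt (I := 𝓡 n) (mem_chart_source _ x)).hasMFDerivAt
    have h₄ := congrArg (fun L => L (X x)) (h₃.congr_of_eventuallyEq h₂).mfderiv
    refine Eq.trans h₄ ?_
    have h₅ : chartField x X z = X x := by rw [hz, chartField_apply hx, hid]
    change fderiv ℝ g z (fderiv ℝ (chartField x Y) z (mfderiv (𝓡 n) 𝓘(ℝ, EuclideanSpace ℝ (Fin n))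
      (extChartAt (𝓡 n) x) x (X x))) + fderiv ℝ (fderiv ℝ g) z (mfderiv (𝓡 n)
      𝓘(ℝ, EuclideanSpace ℝ (Fin n)) (extChartAt (𝓡 n) x) x (X x)) (chartField x Y z) = _
    rw [hid, h₅, add_comm]
  have hsymm := hgz.isSymmSndFDerivAt (by simp)
  rw [key hY, key hX, mvfderiv_eq_fderiv_comp_extChartAt_symm hx hev.self_of_nhds, hid,
    mlieBracket_eq_lieBracket_chartField, VectorField.lieBracket, map_sub,
    hsymm.eq (chartField x X z)]
  abel

end Calculus

/-! ### Orthonormal frames -/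

theorem SmoothFieldOn.contMDiffAt {n : ℕ} {M : Type*} [TopologicalSpace M]
    [ChartedSpace (EuclideanSpace ℝ (Fin n)) M] [IsManifold (𝓡 n) ∞ M] {X : VField n M} {U : Set M}
    (h : SmoothFieldOn X U) (hU : IsOpen U) {x : M} (hx : x ∈ U) :
    ContMDiffAt (𝓡 n) ((𝓡 n).prod 𝓘(ℝ, EuclideanSpace ℝ (Fin n))) ∞
      (fun y => TotalSpace.mk' (EuclideanSpace ℝ (Fin n)) y (X y)) x :=
  ContMDiffOn.contMDiffAt h (hU.mem_nhds hx)

section VectorFields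

variable {n : ℕ} {M : Type*} [TopologicalSpace M] [ChartedSpace (EuclideanSpace ℝ (Fin n)) M]
  [IsManifold (𝓡 n) ∞ M]

/-- Differentiability of a vector field at a point. -/
abbrev MDiffFieldAt (X : VField n M) (x : M) : Prop :=
  MDifferentiableAt (𝓡 n) ((𝓡 n).prod 𝓘(ℝ, EuclideanSpace ℝ (Fin n)))
    (fun y => TotalSpace.mk' (EuclideanSpace ℝ (Fin n)) y (X y)) x

/-- The Leibniz rule for finite combinations of vector fields. -/
theorem leibniz_sum {x : M} {L : VField n M → TangentSpace (𝓡 n) x}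
    {v : TangentSpace (𝓡 n) x}
    (hadd : ∀ X Y, MDiffFieldAt X x → MDiffFieldAt Y x → L (X + Y) = L X + L Y)
    (hsmul : ∀ (f : M → ℝ) X, MDifferentiableAt (𝓡 n) 𝓘(ℝ) f x → MDiffFieldAt X x →
      L (f • X) = mvfderiv (𝓡 n) f x v • X x + f x • L X)
    {κ : Type*} (s : Finset κ) {f : κ → M → ℝ} {E : κ → VField n M}
    (hf : ∀ m ∈ s, MDifferentiableAt (𝓡 n) 𝓘(ℝ) (f m) x) (hE : ∀ m ∈ s, MDiffFieldAt (E m) x) :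
    MDiffFieldAt (∑ m ∈ s, f m • E m) x ∧ L (∑ m ∈ s, f m • E m) =
      ∑ m ∈ s, (mvfderiv (𝓡 n) (f m) x v • E m x + f m x • L (E m)) := by
  classical
  have h₀ : MDiffFieldAt (0 : VField n M) x := mdifferentiableAt_zeroSection ..
  induction s using Finset.induction_on with
  | empty =>
    refine ⟨by simpa using h₀, ?_⟩
    have h := hadd 0 0 h₀ h₀
    rw [add_zero] at h
    simpa using left_eq_add.1 h
  | insert a s ha ih =>
    obtain ⟨h₁, h₂⟩ := ih (fun m hm => hf m (Finset.mem_insert_of_mem hm))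
      fun m hm => hE m (Finset.mem_insert_of_mem hm)
    have hfa := hf a (Finset.mem_insert_self a s)
    have hEa := hE a (Finset.mem_insert_self a s)
    have h₃ : MDiffFieldAt (f a • E a) x := hfa.smul_section hEa
    rw [Finset.sum_insert ha, Finset.sum_insert ha]
    refine ⟨mdifferentiableAt_add_section h₃ h₁, ?_⟩
    rw [hadd _ _ h₃ h₁, hsmul _ _ hfa hEa, h₂]

theorem mdiffFieldAt_congr {x : M} {Y Z : VField n M} (hZ : MDiffFieldAt Z x)
    (h : ∀ᶠ y in 𝓝 x, Y y = Z y) : MDiffFieldAt Y x :=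
  MDifferentiableAt.congr_of_eventuallyEq hZ (by filter_upwards [h] with y hy using by rw [hy])

end VectorFields

section Frames

variable {n : ℕ} {M : Type*} [TopologicalSpace M] [ChartedSpace (EuclideanSpace ℝ (Fin n)) M]
  [RiemannianBundle (fun x : M => TangentSpace (𝓡 n) x)]

/-- A basis expansion with respect to an orthonormal family of `n` tangent vectors. -/
theorem sum_inner_smul_of_orthonormal {x : M} {b : Fin n → TangentSpace (𝓡 n) x}
    (hb : Orthonormal ℝ b) (v : TangentSpace (𝓡 n) x) : ∑ k, inner ℝ (b k) v • b k = v := by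
  have hc : Fintype.card (Fin n) = Module.finrank ℝ (TangentSpace (𝓡 n) x) := by
    rw [Fintype.card_fin]
    exact (finrank_euclideanSpace_fin (𝕜 := ℝ) (n := n)).symm
  have h : ⊤ ≤ Submodule.span ℝ (Set.range b) := by
    rw [hb.linearIndependent.span_eq_top_of_card_eq_finrank' hc]
  have := (OrthonormalBasis.mk hb h).sum_repr' v
  simpa using this

theorem sum_inner_mul_inner_of_orthonormal {x : M} {b : Fin n → TangentSpace (𝓡 n) x}
    (hb : Orthonormal ℝ b) (u v : TangentSpace (𝓡 n) x) :
    ∑ k, inner ℝ u (b k) * inner ℝ v (b k) = inner ℝ u v := by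
  conv_rhs => rw [← sum_inner_smul_of_orthonormal hb v, inner_sum]
  exact Finset.sum_congr rfl fun k _ => by
    rw [inner_smul_right, mul_comm, real_inner_comm (b k) v]

theorem eq_of_inner_orthonormal {x : M} {b : Fin n → TangentSpace (𝓡 n) x}
    (hb : Orthonormal ℝ b) {u v : TangentSpace (𝓡 n) x}
    (h : ∀ k, inner ℝ u (b k) = inner ℝ v (b k)) : u = v := by
  rw [← sum_inner_smul_of_orthonormal hb u, ← sum_inner_smul_of_orthonormal hb v]
  exact Finset.sum_congr rfl fun k _ => by rw [real_inner_comm u, real_inner_comm v, h]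

theorem Form3.swap_left {V : Type*} [AddCommGroup V] [Module ℝ V] (T : V [⋀^Fin 3]→ₗ[ℝ] ℝ)
    (u v w : V) : T ![v, u, w] = -T ![u, v, w] := by
  have h := T.map_swap ![u, v, w] (i := 0) (j := 1) (by decide)
  rw [← h]
  congr 1
  ext i
  fin_cases i <;> rfl

theorem Form3.swap_right {V : Type*} [AddCommGroup V] [Module ℝ V] (T : V [⋀^Fin 3]→ₗ[ℝ] ℝ)
    (u v w : V) : T ![u, w, v] = -T ![u, v, w] := by
  have h := T.map_swap ![u, v, w] (i := 1) (j := 2) (by decide)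
  rw [← h]
  congr 1
  ext i
  fin_cases i <;> rfl

/-- A 3-form as a linear function of its first argument. -/
def Form3.first {V : Type*} [AddCommGroup V] [Module ℝ V] (T : V [⋀^Fin 3]→ₗ[ℝ] ℝ) (a b : V) :
    V →ₗ[ℝ] ℝ where
  toFun v := T ![v, a, b]
  map_add' u v := Form3.cons_add T u v a b
  map_smul' c v := Form3.cons_smul T c v a b

theorem Form3.expand {x : M} (T : TangentSpace (𝓡 n) x [⋀^Fin 3]→ₗ[ℝ] ℝ)
    {b : Fin n → TangentSpace (𝓡 n) x} (hb : Orthonormal ℝ b) (v w z : TangentSpace (𝓡 n) x) :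
    T ![v, w, z] = ∑ k, inner ℝ v (b k) * T ![b k, w, z] := by
  have h : Form3.first T w z (∑ k, inner ℝ (b k) v • b k) =
      ∑ k, inner ℝ v (b k) * Form3.first T w z (b k) := by
    rw [map_sum]
    exact Finset.sum_congr rfl fun k _ => by rw [map_smul, smul_eq_mul, real_inner_comm]
  rw [sum_inner_smul_of_orthonormal hb] at h
  exact h

theorem Form3.expand₂ {x : M} (T : TangentSpace (𝓡 n) x [⋀^Fin 3]→ₗ[ℝ] ℝ)
    {b : Fin n → TangentSpace (𝓡 n) x} (hb : Orthonormal ℝ b) (v w z : TangentSpace (𝓡 n) x) :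
    T ![w, v, z] = ∑ k, inner ℝ v (b k) * T ![w, b k, z] := by
  rw [Form3.swap_left, Form3.expand T hb, ← Finset.sum_neg_distrib]
  exact Finset.sum_congr rfl fun k _ => by rw [Form3.swap_left T w]; ring

theorem Form3.expand₃ {x : M} (T : TangentSpace (𝓡 n) x [⋀^Fin 3]→ₗ[ℝ] ℝ)
    {b : Fin n → TangentSpace (𝓡 n) x} (hb : Orthonormal ℝ b) (v w z : TangentSpace (𝓡 n) x) :
    T ![w, z, v] = ∑ k, inner ℝ v (b k) * T ![w, z, b k] := by
  rw [Form3.swap_right, Form3.expand₂ T hb, ← Finset.sum_neg_distrib]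
  exact Finset.sum_congr rfl fun k _ => by rw [Form3.swap_right T w (b k)]; ring

variable [IsManifold (𝓡 n) ∞ M]

/-- A smooth orthonormal frame over an open set. -/
structure IsFrameOn (E : Fin n → VField n M) (U : Set M) : Prop where
  isOpen : IsOpen U
  smooth : ∀ i, SmoothFieldOn (E i) U
  orthonormal : ∀ x ∈ U, Orthonormal ℝ fun i => E i x

namespace IsFrameOn

variable {E : Fin n → VField n M} {U : Set M} {x : M}

theorem mdiff (hE : IsFrameOn E U) (hx : x ∈ U) (i : Fin n) : MDiffFieldAt (E i) x :=
  ((hE.smooth i).contMDiffAt hE.isOpen hx).mdifferentiableAt (by simp)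

theorem inner_eq (hE : IsFrameOn E U) (hx : x ∈ U) (i j : Fin n) :
    inner ℝ (E i x) (E j x) = if i = j then (1 : ℝ) else 0 :=
  orthonormal_iff_ite.1 (hE.orthonormal x hx) i j

theorem inner_sum_smul (hE : IsFrameOn E U) (hx : x ∈ U) (c : Fin n → ℝ) (l : Fin n) :
    inner ℝ (∑ m, c m • E m x) (E l x) = c l := by
  rw [sum_inner]
  simp [inner_smul_left, hE.inner_eq hx]

end IsFrameOn

end Frames

/-! ### The connections in an orthonormal frame -/

section FrameDerivative

variable {n : ℕ} {M : Type*} [TopologicalSpace M] [ChartedSpace (EuclideanSpace ℝ (Fin n)) M]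
  {E : Fin n → VField n M} {x : M}

/-- The derivative of a function along a member of a frame. -/
def frameDeriv (E : Fin n → VField n M) (x : M) (i : Fin n) (f : M → ℝ) : ℝ :=
  mvfderiv (𝓡 n) f x (E i x)

theorem frameDeriv_sub {i : Fin n} {f g : M → ℝ} (hf : MDifferentiableAt (𝓡 n) 𝓘(ℝ) f x)
    (hg : MDifferentiableAt (𝓡 n) 𝓘(ℝ) g x) :
    frameDeriv E x i (fun y => f y - g y) = frameDeriv E x i f - frameDeriv E x i g := by
  rw [frameDeriv, mvfderiv_fun_sub hf hg]
  rfl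

end FrameDerivative

section FrameConnection

variable {n : ℕ} {M : Type*} [TopologicalSpace M] [ChartedSpace (EuclideanSpace ℝ (Fin n)) M]
  [RiemannianBundle (fun x : M => TangentSpace (𝓡 n) x)] [IsManifold (𝓡 n) ∞ M]
  {E : Fin n → VField n M} {U : Set M} {x : M} {nab : TangentConn n M}

/-- The Christoffel symbols `⟨∇_{E_i} E_j, E_k⟩`. -/
def chrFun (nab : TangentConn n M) (E : Fin n → VField n M) (i j k : Fin n) (y : M) : ℝ :=
  inner ℝ (nab (E j) y (E i y)) (E k y)

/-- The components of a 3-form. -/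
def torFun (T : Form3 n M) (E : Fin n → VField n M) (i j k : Fin n) (y : M) : ℝ :=
  T y ![E i y, E j y, E k y]

theorem contMDiffAt_torFun {T : Form3 n M} (hT : IsSmooth3 T) (hE : IsFrameOn E U) (hx : x ∈ U)
    (i j k : Fin n) : ContMDiffAt (𝓡 n) 𝓘(ℝ) ∞ (torFun T E i j k) x :=
  (hT U (E i) (E j) (E k) hE.isOpen (hE.smooth i) (hE.smooth j) (hE.smooth k)).contMDiffAt
    (hE.isOpen.mem_nhds hx)

variable [IsContMDiffRiemannianBundle (𝓡 n) ∞ (EuclideanSpace ℝ (Fin n))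
  (fun x : M => TangentSpace (𝓡 n) x)]

theorem mvfderiv_inner (hnab : IsLeviCivita nab) {X Y : VField n M} (hX : MDiffFieldAt X x)
    (hY : MDiffFieldAt Y x) (v : TangentSpace (𝓡 n) x) :
    mvfderiv (𝓡 n) (fun y => inner ℝ (X y) (Y y)) x v =
      inner ℝ (nab X x v) (Y x) + inner ℝ (X x) (nab Y x v) := by
  have : IsManifold (𝓡 n) 1 M := IsManifold.of_le (n := ∞) (by decide)
  classical
  -- The direction of differentiation enters only through its value at `x`, so an arbitrary
  -- extension, even a discontinuous one, will do.
  let Z : VField n M := Function.update (fun _ => 0) x v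
  have hZ : Z x = v := Function.update_self ..
  have h := hnab.metric.mvfderiv_inner_eq Z hX hY
  rw [hZ] at h
  refine h.trans ?_
  rw [← hZ]

/-- The inner products of frame vectors are locally constant, so their derivative, computed by
metricity, vanishes. -/
theorem inner_nab_antisymm (hnab : IsLeviCivita nab) (hE : IsFrameOn E U) (hx : x ∈ U)
    (v : TangentSpace (𝓡 n) x) (j k : Fin n) :
    inner ℝ (nab (E k) x v) (E j x) = -inner ℝ (nab (E j) x v) (E k x) := by
  have h := mvfderiv_inner hnab (hE.mdiff hx k) (hE.mdiff hx j) v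
  have h₀ : (fun y => inner ℝ (E k y) (E j y)) =ᶠ[𝓝 x] fun _ => if k = j then (1 : ℝ) else 0 := by
    filter_upwards [hE.isOpen.mem_nhds hx] with y hy using hE.inner_eq hy k j
  have h₁ : mvfderiv (𝓡 n) (fun y => inner ℝ (E k y) (E j y)) x = 0 := by
    have : HasMFDerivAt (𝓡 n) 𝓘(ℝ) (fun _ : M => if k = j then (1 : ℝ) else 0) x 0 :=
      hasMFDerivAt_const ..
    exact (this.congr_of_eventuallyEq h₀).mfderiv
  rw [h₁, real_inner_comm (nab (E j) x v), zero_apply] at h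
  linarith

theorem chrFun_antisymm (hnab : IsLeviCivita nab) (hE : IsFrameOn E U) (hx : x ∈ U)
    (i j k : Fin n) : chrFun nab E i k j x = -chrFun nab E i j k x :=
  inner_nab_antisymm hnab hE hx _ _ _

theorem inner_mlieBracket (hnab : IsLeviCivita nab) (hE : IsFrameOn E U) (hx : x ∈ U)
    (i j k : Fin n) : inner ℝ (VectorField.mlieBracket (𝓡 n) (E i) (E j) x) (E k x) =
      chrFun nab E i j k x - chrFun nab E j i k x := by
  have : IsManifold (𝓡 n) 2 M := IsManifold.of_le (n := ∞) (by decide)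
  rw [← nab.torsion_eq_zero_iff.1 hnab.torsion_free (hE.mdiff hx i) (hE.mdiff hx j),
    inner_sub_left]
  rfl

theorem mlieBracket_eq_sum (hnab : IsLeviCivita nab) (hE : IsFrameOn E U) (hx : x ∈ U)
    (i j : Fin n) : VectorField.mlieBracket (𝓡 n) (E i) (E j) x =
      ∑ m, (chrFun nab E i j m x - chrFun nab E j i m x) • E m x := by
  rw [← sum_inner_smul_of_orthonormal (hE.orthonormal x hx)
    (VectorField.mlieBracket (𝓡 n) (E i) (E j) x)]
  exact Finset.sum_congr rfl fun m _ => by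
    rw [real_inner_comm, inner_mlieBracket hnab hE hx]

/-- The Koszul formula in an orthonormal frame. It yields smoothness of the Christoffel symbols,
since brackets of smooth fields are smooth; regularity of the connection need not be assumed. -/
theorem chrFun_eq (hnab : IsLeviCivita nab) (hE : IsFrameOn E U) (hx : x ∈ U) (i j k : Fin n) :
    chrFun nab E i j k x = (1 / 2) *
      (inner ℝ (VectorField.mlieBracket (𝓡 n) (E i) (E j) x) (E k x)
      - inner ℝ (VectorField.mlieBracket (𝓡 n) (E j) (E k) x) (E i x)
      + inner ℝ (VectorField.mlieBracket (𝓡 n) (E k) (E i) x) (E j x)) := by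
  simp only [inner_mlieBracket hnab hE hx]
  rw [chrFun_antisymm hnab hE hx j i k, chrFun_antisymm hnab hE hx k i j,
    chrFun_antisymm hnab hE hx i j k]
  ring

theorem contMDiffAt_chrFun (hnab : IsLeviCivita nab) (hE : IsFrameOn E U) (hx : x ∈ U)
    (i j k : Fin n) : ContMDiffAt (𝓡 n) 𝓘(ℝ) ∞ (chrFun nab E i j k) x := by
  have : IsManifold (𝓡 n) ((⊤ : ℕ∞) + 1) M := IsManifold.of_le (n := ∞) (by decide)
  have : IsManifold (𝓡 n) (minSmoothness ℝ 2) M :=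
    IsManifold.of_le (n := ∞) (by rw [minSmoothness_of_isRCLikeNormedField]; decide)
  have hs : ∀ i, ContMDiffAt (𝓡 n) ((𝓡 n).prod 𝓘(ℝ, EuclideanSpace ℝ (Fin n))) ∞
      (fun y => TotalSpace.mk' (EuclideanSpace ℝ (Fin n)) y (E i y)) x :=
    fun i => (hE.smooth i).contMDiffAt hE.isOpen hx
  have h : ∀ i j k, ContMDiffAt (𝓡 n) 𝓘(ℝ) ∞
      (fun y => inner ℝ (VectorField.mlieBracket (𝓡 n) (E i) (E j) y) (E k y)) x := fun i j k =>
    ContMDiffAt.inner_bundle ((hs i).mlieBracket_vectorField (m := ⊤) (n := ⊤) (hs j)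
      (by simp)) (hs k)
  have h' : chrFun nab E i j k =ᶠ[𝓝 x] fun y => (1 / 2) *
      (inner ℝ (VectorField.mlieBracket (𝓡 n) (E i) (E j) y) (E k y)
      - inner ℝ (VectorField.mlieBracket (𝓡 n) (E j) (E k) y) (E i y)
      + inner ℝ (VectorField.mlieBracket (𝓡 n) (E k) (E i) y) (E j y)) := by
    filter_upwards [hE.isOpen.mem_nhds hx] with y hy using chrFun_eq hnab hE hy i j k
  exact (contMDiffAt_const.mul (((h i j k).sub (h j k i)).add (h k i j))).congr_of_eventuallyEq h'

theorem mdiff_chrFun (hnab : IsLeviCivita nab) (hE : IsFrameOn E U) (hx : x ∈ U)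
    (i j k : Fin n) : MDifferentiableAt (𝓡 n) 𝓘(ℝ) (chrFun nab E i j k) x :=
  (contMDiffAt_chrFun hnab hE hx i j k).mdifferentiableAt (by simp)

end FrameConnection

/-! ### Curvature in an orthonormal frame -/

section FrameCurvature

variable {n : ℕ} {M : Type*} [TopologicalSpace M] [ChartedSpace (EuclideanSpace ℝ (Fin n)) M]
  [RiemannianBundle (fun x : M => TangentSpace (𝓡 n) x)] [IsManifold (𝓡 n) ∞ M]
  {ι : Type*} (S : SpinStructure n M ι)
  {E : Fin n → VField n M} {U : Set M} {x : M} {nab : TangentConn n M} {T : Form3 n M}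

theorem SpinStructure.isFrameOn (a : ι) : IsFrameOn (S.frame a) (S.baseSet a) :=
  ⟨S.isOpen_baseSet a, S.smooth_frame a, S.orthonormal_frame a⟩

theorem SpinStructure.orthonormal_e (x : M) : Orthonormal ℝ fun i => S.e x i :=
  S.orthonormal_frame _ x (S.mem_baseSet_at x)

theorem SpinStructure.inner_torVec (x : M) (u v w : TangentSpace (𝓡 n) x) :
    inner ℝ (S.torVec T x u v) w = T x ![u, v, w] := by
  rw [torVec, sum_inner, Form3.expand₃ (T x) (S.orthonormal_e x) w]
  exact Finset.sum_congr rfl fun k _ => by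
    rw [inner_smul_left, conj_trivial, mul_comm, real_inner_comm]

theorem SpinStructure.inner_conn (s : ℝ) (Y : VField n M) (v w : TangentSpace (𝓡 n) x) :
    inner ℝ (S.conn nab T s Y x v) w = inner ℝ (nab Y x v) w + 2 * s * T x ![v, Y x, w] := by
  rw [conn, inner_add_left, inner_smul_left, conj_trivial, inner_torVec]

/-- The connection coefficients of `∇ˢ`. -/
def cofFun (nab : TangentConn n M) (T : Form3 n M) (E : Fin n → VField n M) (s : ℝ)
    (i j k : Fin n) (y : M) : ℝ :=
  chrFun nab E i j k y + 2 * s * torFun T E i j k y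

theorem SpinStructure.conn_frame (hE : IsFrameOn E U) (hx : x ∈ U) (s : ℝ) (i j : Fin n) :
    S.conn nab T s (E j) x (E i x) = ∑ m, cofFun nab T E s i j m x • E m x := by
  refine eq_of_inner_orthonormal (hE.orthonormal x hx) fun k => ?_
  rw [hE.inner_sum_smul hx, S.inner_conn]
  rfl

theorem SpinStructure.inner_conn_frame (hE : IsFrameOn E U) (hx : x ∈ U) (s : ℝ)
    (v : TangentSpace (𝓡 n) x) (k l : Fin n) : inner ℝ (S.conn nab T s (E k) x v) (E l x) =
      ∑ m, inner ℝ v (E m x) * cofFun nab T E s m k l x := by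
  rw [S.inner_conn, Form3.expand (T x) (hE.orthonormal x hx) v]
  have h : nab (E k) x v = ∑ m, inner ℝ v (E m x) • nab (E k) x (E m x) := by
    conv_lhs => rw [← sum_inner_smul_of_orthonormal (hE.orthonormal x hx) v, map_sum]
    exact Finset.sum_congr rfl fun m _ => by rw [map_smul, real_inner_comm]
  rw [h, sum_inner, Finset.mul_sum, ← Finset.sum_add_distrib]
  refine Finset.sum_congr rfl fun m _ => ?_
  rw [inner_smul_left, conj_trivial, cofFun, chrFun, torFun]
  ring

theorem SpinStructure.torVec_add (x : M) (u v w : TangentSpace (𝓡 n) x) :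
    S.torVec T x u (v + w) = S.torVec T x u v + S.torVec T x u w :=
  eq_of_inner_orthonormal (S.orthonormal_e x) fun k => by
    rw [inner_add_left, inner_torVec, inner_torVec, inner_torVec, Form3.cons_add₂]

theorem SpinStructure.torVec_smul (x : M) (u v : TangentSpace (𝓡 n) x) (c : ℝ) :
    S.torVec T x u (c • v) = c • S.torVec T x u v :=
  eq_of_inner_orthonormal (S.orthonormal_e x) fun k => by
    rw [inner_smul_left, conj_trivial, inner_torVec, inner_torVec, Form3.cons_smul₂]

theorem SpinStructure.conn_sum (s : ℝ) (v : TangentSpace (𝓡 n) x) {f : Fin n → M → ℝ}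
    (hE : IsFrameOn E U) (hx : x ∈ U) (hf : ∀ m, MDifferentiableAt (𝓡 n) 𝓘(ℝ) (f m) x) :
    MDiffFieldAt (∑ m, f m • E m) x ∧ S.conn nab T s (∑ m, f m • E m) x v =
      ∑ m, (mvfderiv (𝓡 n) (f m) x v • E m x + f m x • S.conn nab T s (E m) x v) := by
  refine leibniz_sum (L := fun Z => S.conn nab T s Z x v) (fun X Y hX hY => ?_)
    (fun f X hf hX => ?_) Finset.univ (fun m _ => hf m) fun m _ => hE.mdiff hx m
  · have h := nab.isCovariantDerivativeOnUniv.add hX hY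
    simp only [conn]
    rw [h, Pi.add_apply, torVec_add, add_apply, smul_add]
    abel
  · have h := nab.isCovariantDerivativeOnUniv.leibniz hX hf
    simp only [conn]
    rw [h, Pi.smul_apply', torVec_smul, add_apply, smul_apply,
      ContinuousLinearMap.smulRight_apply]
    module

theorem SpinStructure.conn_congr (s : ℝ) (v : TangentSpace (𝓡 n) x) {Y Z : VField n M}
    (hY : MDiffFieldAt Y x) (hZ : MDiffFieldAt Z x) (h : ∀ᶠ y in 𝓝 x, Y y = Z y) :
    S.conn nab T s Y x v = S.conn nab T s Z x v := by
  rw [conn, conn, nab.isCovariantDerivativeOnUniv.congr_of_eventuallyEq hY hZ univ_mem h,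
    h.self_of_nhds]

theorem mdiff_torFun (hT : IsSmooth3 T) (hE : IsFrameOn E U) (hx : x ∈ U)
    (i j k : Fin n) : MDifferentiableAt (𝓡 n) 𝓘(ℝ) (torFun T E i j k) x :=
  (contMDiffAt_torFun hT hE hx i j k).mdifferentiableAt (by simp)

/-- Expanding each covariant derivative in the frame turns `∇ᶜT = 0` into the relation among jets
that `FrameJet.parallel` records. -/
theorem frameDeriv_torFun (hpar : S.ParallelTorsion nab T) (hE : IsFrameOn E U)
    (hx : x ∈ U) (i j k l : Fin n) : frameDeriv E x i (torFun T E j k l) =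
      ∑ m, ((chrFun nab E i j m x + 1 / 2 * torFun T E i j m x) * torFun T E m k l x
        + (chrFun nab E i k m x + 1 / 2 * torFun T E i k m x) * torFun T E j m l x
        + (chrFun nab E i l m x + 1 / 2 * torFun T E i l m x) * torFun T E j k m x) := by
  have h := hpar x (E i x) (E j) (E k) (E l) (hE.mdiff hx j) (hE.mdiff hx k) (hE.mdiff hx l)
  have hc : ∀ j m, inner ℝ (S.conn nab T (1 / 4) (E j) x (E i x)) (E m x) =
      chrFun nab E i j m x + 1 / 2 * torFun T E i j m x := by
    intro j m
    rw [S.inner_conn, chrFun, torFun]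
    norm_num
  rw [Form3.expand (T x) (hE.orthonormal x hx) (S.conn nab T (1 / 4) (E j) x (E i x)),
    Form3.expand₂ (T x) (hE.orthonormal x hx) (S.conn nab T (1 / 4) (E k) x (E i x)),
    Form3.expand₃ (T x) (hE.orthonormal x hx) (S.conn nab T (1 / 4) (E l) x (E i x))] at h
  simp only [hc] at h
  rw [Finset.sum_add_distrib, Finset.sum_add_distrib]
  change frameDeriv E x i (torFun T E j k l) - _ - _ - _ = 0 at h
  simp only [torFun] at h ⊢
  linarith

variable [IsContMDiffRiemannianBundle (𝓡 n) ∞ (EuclideanSpace ℝ (Fin n))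
  (fun x : M => TangentSpace (𝓡 n) x)]

theorem contMDiffAt_cofFun (hnab : IsLeviCivita nab) (hT : IsSmooth3 T) (hE : IsFrameOn E U)
    (hx : x ∈ U) (s : ℝ) (i j k : Fin n) :
    ContMDiffAt (𝓡 n) 𝓘(ℝ) ∞ (cofFun nab T E s i j k) x :=
  (contMDiffAt_chrFun hnab hE hx i j k).add
    (contMDiffAt_const.mul (contMDiffAt_torFun hT hE hx i j k))

theorem mdiff_cofFun (hnab : IsLeviCivita nab) (hT : IsSmooth3 T) (hE : IsFrameOn E U)
    (hx : x ∈ U) (s : ℝ) (i j k : Fin n) :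
    MDifferentiableAt (𝓡 n) 𝓘(ℝ) (cofFun nab T E s i j k) x :=
  (contMDiffAt_cofFun hnab hT hE hx s i j k).mdifferentiableAt (by simp)

theorem frameDeriv_cofFun (hnab : IsLeviCivita nab) (hT : IsSmooth3 T) (hE : IsFrameOn E U)
    (hx : x ∈ U) (s : ℝ) (i j k l : Fin n) : frameDeriv E x i (cofFun nab T E s j k l) =
      frameDeriv E x i (chrFun nab E j k l) + 2 * s * frameDeriv E x i (torFun T E j k l) := by
  have h : cofFun nab T E s j k l =
      chrFun nab E j k l + (fun _ : M => 2 * s) • torFun T E j k l := rfl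
  rw [frameDeriv, h, mvfderiv_add (mdiff_chrFun hnab hE hx j k l)
    (mdifferentiableAt_const.smul (mdiff_torFun hT hE hx j k l)),
    mvfderiv_smul mdifferentiableAt_const (mdiff_torFun hT hE hx j k l), mvfderiv_const]
  simp [frameDeriv]

/-- Near `x` the inner derivative is a combination of frame vectors with smooth coefficients, so the
Leibniz rule applies. -/
theorem SpinStructure.conn_conn_frame (hnab : IsLeviCivita nab) (hT : IsSmooth3 T)
    (hE : IsFrameOn E U) (hx : x ∈ U) (s : ℝ) (i j k l : Fin n) :
    inner ℝ (S.conn nab T s (fun y => S.conn nab T s (E k) y (E j y)) x (E i x)) (E l x) =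
      frameDeriv E x i (cofFun nab T E s j k l)
        + ∑ m, cofFun nab T E s j k m x * cofFun nab T E s i m l x := by
  obtain ⟨h₁, h₂⟩ := S.conn_sum (nab := nab) (T := T) s (E i x)
    (f := fun m => cofFun nab T E s j k m) hE hx fun m => mdiff_cofFun hnab hT hE hx s j k m
  have h₃ : ∀ᶠ y in 𝓝 x, S.conn nab T s (E k) y (E j y) =
      (∑ m, cofFun nab T E s j k m • E m) y := by
    filter_upwards [hE.isOpen.mem_nhds hx] with y hy
    rw [S.conn_frame hE hy, Finset.sum_apply]
    rfl
  rw [S.conn_congr s _ (mdiffFieldAt_congr h₁ h₃) h₁ h₃, h₂, Finset.sum_add_distrib,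
    inner_add_left, hE.inner_sum_smul hx, sum_inner]
  refine congrArg₂ _ rfl (Finset.sum_congr rfl fun m _ => ?_)
  rw [inner_smul_left, conj_trivial, S.conn_frame hE hx, hE.inner_sum_smul hx]

theorem SpinStructure.inner_curv (hnab : IsLeviCivita nab) (hT : IsSmooth3 T)
    (hE : IsFrameOn E U) (hx : x ∈ U) (s : ℝ) (i j k l : Fin n) :
    inner ℝ (S.curv nab T s (E i) (E j) (E k) x) (E l x) =
      frameDeriv E x i (cofFun nab T E s j k l) - frameDeriv E x j (cofFun nab T E s i k l)
        + ∑ m, (cofFun nab T E s j k m x * cofFun nab T E s i m l x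
          - cofFun nab T E s i k m x * cofFun nab T E s j m l x
          - (chrFun nab E i j m x - chrFun nab E j i m x) * cofFun nab T E s m k l x) := by
  rw [curv, inner_sub_left, inner_sub_left, S.conn_conn_frame hnab hT hE hx,
    S.conn_conn_frame hnab hT hE hx, S.inner_conn_frame hE hx, Finset.sum_sub_distrib,
    Finset.sum_sub_distrib]
  simp only [inner_mlieBracket hnab hE hx]
  ring

theorem inner_mlieBracket_mlieBracket (hnab : IsLeviCivita nab) (hE : IsFrameOn E U)
    (hx : x ∈ U) (i j k l : Fin n) :
    inner ℝ (VectorField.mlieBracket (𝓡 n) (E i) (VectorField.mlieBracket (𝓡 n) (E j) (E k)) x)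
      (E l x) =
      frameDeriv E x i (chrFun nab E j k l) - frameDeriv E x i (chrFun nab E k j l)
        + ∑ m, (chrFun nab E j k m x - chrFun nab E k j m x) *
          (chrFun nab E i m l x - chrFun nab E m i l x) := by
  have : IsManifold (𝓡 n) 2 M := IsManifold.of_le (n := ∞) (by decide)
  have h₁ := leibniz_sum (x := x) (L := fun Z => VectorField.mlieBracket (𝓡 n) (E i) Z x)
    (v := E i x) (fun X Y hX hY => VectorField.mlieBracket_add_right hX hY)
    (fun f X hf hX => VectorField.mlieBracket_smul_right hf hX) Finset.univ
    (f := fun m y => chrFun nab E j k m y - chrFun nab E k j m y) (E := E)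
    (fun m _ => (mdiff_chrFun hnab hE hx j k m).sub (mdiff_chrFun hnab hE hx k j m))
    (fun m _ => hE.mdiff hx m)
  have h₂ : ∀ᶠ y in 𝓝 x, VectorField.mlieBracket (𝓡 n) (E j) (E k) y =
      (∑ m, (fun y => chrFun nab E j k m y - chrFun nab E k j m y) • E m : VField n M) y := by
    filter_upwards [hE.isOpen.mem_nhds hx] with y hy
    rw [mlieBracket_eq_sum hnab hE hy, Finset.sum_apply]
    rfl
  have h₃ : VectorField.mlieBracket (𝓡 n) (E i) (VectorField.mlieBracket (𝓡 n) (E j) (E k)) x = _ :=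
    Filter.EventuallyEq.mlieBracket_vectorField_eq (EventuallyEq.refl _ (E i)) h₂
  rw [h₃, h₁.2,
    Finset.sum_add_distrib, inner_add_left, hE.inner_sum_smul hx, sum_inner]
  refine congrArg₂ _ (frameDeriv_sub (mdiff_chrFun hnab hE hx j k l)
    (mdiff_chrFun hnab hE hx k j l)) (Finset.sum_congr rfl fun m _ => ?_)
  rw [inner_smul_left, conj_trivial, inner_mlieBracket hnab hE hx]

/-- For a torsion free connection the first Bianchi identity is the Jacobi identity of the frame
fields, with the structure functions written as antisymmetrized Christoffel symbols. -/
theorem chrFun_bianchi (hnab : IsLeviCivita nab) (hE : IsFrameOn E U) (hx : x ∈ U)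
    (i j k l : Fin n) :
    (frameDeriv E x i (chrFun nab E j k l) - frameDeriv E x j (chrFun nab E i k l)
      + ∑ m, (chrFun nab E j k m x * chrFun nab E i m l x
        - chrFun nab E i k m x * chrFun nab E j m l x
        - (chrFun nab E i j m x - chrFun nab E j i m x) * chrFun nab E m k l x)) +
    (frameDeriv E x j (chrFun nab E k i l) - frameDeriv E x k (chrFun nab E j i l)
      + ∑ m, (chrFun nab E k i m x * chrFun nab E j m l x
        - chrFun nab E j i m x * chrFun nab E k m l x
        - (chrFun nab E j k m x - chrFun nab E k j m x) * chrFun nab E m i l x)) +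
    (frameDeriv E x k (chrFun nab E i j l) - frameDeriv E x i (chrFun nab E k j l)
      + ∑ m, (chrFun nab E i j m x * chrFun nab E k m l x
        - chrFun nab E k j m x * chrFun nab E i m l x
        - (chrFun nab E k i m x - chrFun nab E i k m x) * chrFun nab E m j l x)) = 0 := by
  have hM : IsManifold (𝓡 n) (minSmoothness ℝ 3) M :=
    IsManifold.of_le (n := ∞) (by rw [minSmoothness_of_isRCLikeNormedField]; decide)
  have hs : ∀ i, ContMDiffAt (𝓡 n) ((𝓡 n).prod 𝓘(ℝ, EuclideanSpace ℝ (Fin n)))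
      (minSmoothness ℝ 2) (fun y => TotalSpace.mk' (EuclideanSpace ℝ (Fin n)) y (E i y)) x :=
    fun i => ((hE.smooth i).contMDiffAt hE.isOpen hx).of_le
      (by rw [minSmoothness_of_isRCLikeNormedField]; exact WithTop.coe_le_coe.2 le_top)
  have h := VectorField.leibniz_identity_mlieBracket_apply (hs i) (hs j) (hs k)
  -- After this swap every double bracket has a frame field as its outer left entry, the form
  -- computed in `inner_mlieBracket_mlieBracket`.
  rw [VectorField.mlieBracket_swap_apply (V := VectorField.mlieBracket (𝓡 n) (E i) (E j))] at h
  have h' := congrArg (fun w => inner ℝ w (E l x)) h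
  simp only [inner_add_left, inner_neg_left, inner_mlieBracket_mlieBracket hnab hE hx] at h'
  have e : ∀ (a b c d a' b' c' : ℝ) (f g h f' g' h' : Fin n → ℝ),
      a' + ∑ m, f' m = -(b' + ∑ m, g' m) + (c' + ∑ m, h' m) →
      a + b + c = a' + b' - c' → (∀ m, f m + g m + h m = f' m + g' m - h' m) →
      (a + ∑ m, f m) + (b + ∑ m, g m) + (c + ∑ m, h m) = 0 := by
    intro a b c d a' b' c' f g h f' g' h' h₁ h₂ h₃
    have := Finset.sum_congr (rfl : (Finset.univ : Finset (Fin n)) = _) fun m _ => h₃ m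
    simp only [Finset.sum_add_distrib, Finset.sum_sub_distrib] at this
    linarith
  refine e _ _ _ 0 _ _ _ _ _ _ _ _ _ h' ?_ fun m => ?_ <;> ring

/-- The 1-jet at `x` of the connection coefficients and of the torsion form. -/
def frameJet (hnab : IsLeviCivita nab) (hpar : S.ParallelTorsion nab T) (hE : IsFrameOn E U)
    (hx : x ∈ U) : FrameJet n where
  chr i j k := chrFun nab E i j k x
  tor i j k := torFun T E i j k x
  dchr i j k l := frameDeriv E x i (chrFun nab E j k l)
  dtor i j k l := frameDeriv E x i (torFun T E j k l)
  chr_antisymm := chrFun_antisymm hnab hE hx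
  dchr_antisymm i j k l := by
    have h : chrFun nab E j l k =ᶠ[𝓝 x] -chrFun nab E j k l := by
      filter_upwards [hE.isOpen.mem_nhds hx] with y hy using chrFun_antisymm hnab hE hy j k l
    have h' : mvfderiv (𝓡 n) (chrFun nab E j l k) x = mvfderiv (𝓡 n) (-chrFun nab E j k l) x :=
      h.mfderiv_eq
    rw [frameDeriv, h', mvfderiv_neg]
    rfl
  tor_swap_left i j k := Form3.swap_left _ _ _ _
  tor_swap_right i j k := Form3.swap_right _ _ _ _
  parallel := frameDeriv_torFun S hpar hE hx
  bianchi := chrFun_bianchi hnab hE hx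

theorem frameJet_dcof (hnab : IsLeviCivita nab) (hT : IsSmooth3 T)
    (hpar : S.ParallelTorsion nab T) (hE : IsFrameOn E U) (hx : x ∈ U) (s : ℝ) (i j k l : Fin n) :
    (frameJet S hnab hpar hE hx).dcof s i j k l = frameDeriv E x i (cofFun nab T E s j k l) :=
  (frameDeriv_cofFun hnab hT hE hx s i j k l).symm

theorem inner_curv_eq_riem (hnab : IsLeviCivita nab) (hT : IsSmooth3 T)
    (hpar : S.ParallelTorsion nab T) (hE : IsFrameOn E U) (hx : x ∈ U) (s : ℝ) (i j k l : Fin n) :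
    inner ℝ (S.curv nab T s (E i) (E j) (E k) x) (E l x) =
      (frameJet S hnab hpar hE hx).riem s i j k l := by
  rw [S.inner_curv hnab hT hE hx, FrameJet.riem, frameJet_dcof S hnab hT,
    frameJet_dcof S hnab hT]
  rfl

theorem extD_eq_ext (hnab : IsLeviCivita nab) (hpar : S.ParallelTorsion nab T)
    (hE : IsFrameOn E U) (hx : x ∈ U) (i j k l : Fin n) :
    extD T (E i) (E j) (E k) (E l) x = (frameJet S hnab hpar hE hx).ext i j k l := by
  have h : ∀ i j k l, T x ![VectorField.mlieBracket (𝓡 n) (E i) (E j) x, E k x, E l x] =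
      ∑ m, (frameJet S hnab hpar hE hx).str i j m * (frameJet S hnab hpar hE hx).tor m k l := by
    intro i j k l
    rw [Form3.expand (T x) (hE.orthonormal x hx)]
    exact Finset.sum_congr rfl fun m _ => by rw [inner_mlieBracket hnab hE hx]; rfl
  rw [extD]
  simp only [h]
  rw [FrameJet.ext]
  simp only [Finset.sum_add_distrib, Finset.sum_sub_distrib]
  have e : ∀ a b c d p q r t u w a' b' c' d' p' q' r' t' u' w' : ℝ, a = a' → b = b' → c = c' →
      d = d' → p = p' → q = q' → r = r' → t = t' → u = u' → w = w' →
      a - b + c - d - p + q - r - t + u - w =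
        a' - b' + c' - d' - (p' - q' + r' + t' - u' + w') := by
    intros
    subst_vars
    ring
  exact e _ _ _ _ _ _ _ _ _ _ _ _ _ _ _ _ _ _ _ _ rfl rfl rfl rfl rfl rfl rfl rfl rfl rfl

end FrameCurvature

/-! ### Change of the local trivialization -/

theorem involute_bivCl {n : ℕ} (A : Fin n → Fin n → ℝ) : involute (bivCl A) = bivCl A := by
  simp [bivCl, map_sum, involute_gen]

theorem star_bivCl {n : ℕ} {A : Fin n → Fin n → ℝ} (hA : ∀ i j, A j i = -A i j) :
    star (bivCl A) = -bivCl A := by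
  have h : ∀ c : ℝ, star (algebraMap ℝ (Cl n) c) = algebraMap ℝ (Cl n) c := fun c => by
    rw [CliffordAlgebra.star_algebraMap]
  have h' : ∀ (c : ℝ) (z : Cl n), star (c • z) = c • star z := fun c z => by
    rw [Algebra.smul_def, star_mul, h, Algebra.smul_def, Algebra.commutes]
  rw [bivCl, h', star_sum, ← smul_neg, Finset.sum_comm, ← Finset.sum_neg_distrib]
  refine congrArg _ (Finset.sum_congr rfl fun k _ => ?_)
  rw [star_sum, ← Finset.sum_neg_distrib]
  refine Finset.sum_congr rfl fun l _ => ?_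
  rw [h', star_mul, star_gen, star_gen, neg_mul_neg, hA k l, neg_smul, neg_neg]

/-- The transformation rule of connection forms under a change of frame, determined by the
derivative of the action on vectors. -/
theorem spin_gauge {n : ℕ} {g dg : Cl n} (hg : g ∈ spinGroup (negQ n))
    (h₁ : dg * star g + g * star dg = 0) (hi : involute dg = dg)
    {a b r dr : Fin n → Fin n → ℝ} (ha : ∀ i j, a j i = -a i j) (hb : ∀ i j, b j i = -b i j)
    (hr : ∀ j, g * gen j * star g = ∑ i, r i j • gen i)
    (hdr : ∀ j, dg * gen j * star g + g * gen j * star dg = ∑ i, dr i j • gen i)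
    (h : ∀ i j, dr i j + ∑ m, r m j * a m i - ∑ m, b j m * r i m = 0) :
    dg + bivCl a * g = g * bivCl b := by
  have hgs : star g * g = 1 := spinGroup.star_mul_self_of_mem hg
  have hsg : g * star g = 1 := spinGroup.mul_star_self_of_mem hg
  have hig : involute g = g := spinGroup.involute_eq hg
  have his : involute (star g) = star g := spinGroup.involute_eq (spinGroup.star_mem hg)
  -- The derivative of the inverse: `star g` inverts `g` in the spin group, and `h₁` is the
  -- differentiated relation.
  have hds : star dg = -(star g * dg * star g) := by
    have h₂ : g * star dg = -(dg * star g) := eq_neg_of_add_eq_zero_right h₁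
    calc star dg = star g * g * star dg := by rw [hgs, one_mul]
      _ = star g * (g * star dg) := mul_assoc _ _ _
      _ = _ := by rw [h₂, mul_neg, mul_assoc]
  have hga : ∀ j, g * (bivCl b * gen j) * star g = g * (gen j * bivCl b) * star g
      + ∑ i, (∑ m, b j m * r i m) • gen i := by
    intro j
    rw [bivCl_mul_gen hb, mul_add, add_mul, Finset.mul_sum, Finset.sum_mul]
    congr 1
    simp only [Finset.sum_smul]
    rw [Finset.sum_comm]
    refine Finset.sum_congr rfl fun m _ => ?_
    rw [mul_smul_comm, smul_mul_assoc, hr, Finset.smul_sum]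
    simp only [smul_smul]
  have haV : ∀ j, bivCl a * ∑ i, r i j • gen i = (∑ i, r i j • gen i) * bivCl a
      + ∑ i, (∑ m, r m j * a m i) • gen i := by
    intro j
    simp only [Finset.sum_smul]
    rw [Finset.mul_sum, Finset.sum_mul, Finset.sum_comm, ← Finset.sum_add_distrib]
    refine Finset.sum_congr rfl fun m _ => ?_
    rw [mul_smul_comm, bivCl_mul_gen ha, smul_mul_assoc, smul_add, Finset.smul_sum]
    simp only [smul_smul]
  -- `z` is the discrepancy of the two connection forms, seen in the second frame. Agreement of the
  -- actions on vectors makes it commute with every `e_j`; it is even, and `star z = -z`, hence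
  -- zero.
  set z := star g * dg + star g * bivCl a * g - bivCl b with hz
  have hgz : g * z = dg + bivCl a * g - g * bivCl b := by
    rw [hz, mul_sub, mul_add, ← mul_assoc, hsg, one_mul, ← mul_assoc, ← mul_assoc, hsg, one_mul]
  have hcomm : ∀ j, gen j * z = z * gen j := by
    intro j
    have e₁ : g * (z * gen j) * star g = dg * gen j * star g
        + bivCl a * (g * gen j * star g) - g * (bivCl b * gen j) * star g := by
      rw [← mul_assoc, hgz]
      noncomm_ring
    have e₂ : g * (gen j * z) * star g = -(g * gen j * star dg)
        + g * gen j * star g * bivCl a - g * (gen j * bivCl b) * star g := by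
      rw [hz, hds, mul_neg, neg_neg]
      calc _ = g * gen j * (star g * dg * star g)
            + g * gen j * (star g * bivCl a * (g * star g)) - g * (gen j * bivCl b) * star g := by
              noncomm_ring
        _ = _ := by rw [hsg, mul_one, mul_assoc (g * gen j) (star g) (bivCl a)]
    have e₃ : g * (z * gen j) * star g = g * (gen j * z) * star g := by
      rw [e₁, e₂, hga, hr, haV]
      have e₄ := hdr j
      have e₅ : ∑ i, dr i j • gen i + ∑ i, (∑ m, r m j * a m i) • gen i
          - ∑ i, (∑ m, b j m * r i m) • gen i = (0 : Cl n) := by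
        rw [← Finset.sum_add_distrib, ← Finset.sum_sub_distrib]
        exact Finset.sum_eq_zero fun i _ => by rw [← add_smul, ← sub_smul, h, zero_smul]
      rw [← e₄] at e₅
      rw [← sub_eq_zero, ← e₅]
      abel
    have e₆ : ∀ w : Cl n, star g * (g * w * star g) * g = w := by
      intro w
      calc _ = star g * g * w * (star g * g) := by noncomm_ring
        _ = w := by rw [hgs, one_mul, mul_one]
    rw [← e₆ (gen j * z), ← e₃, e₆]
  have hzi : involute z = z := by
    rw [hz, map_sub, map_add, map_mul, map_mul, map_mul, involute_bivCl, involute_bivCl, hi,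
      his, hig]
  have hzs : star z = -z := by
    rw [hz, star_sub, star_add, star_mul, star_mul, star_mul, star_bivCl ha, star_bivCl hb,
      star_star, hds]
    have e : -(star g * dg * star g) * g = -(star g * dg) := by
      rw [neg_mul, mul_assoc, hgs, mul_one]
    rw [e]
    noncomm_ring
  have hz0 := eq_zero_of_even_of_commute_of_star hzi hcomm hzs
  rw [hz0, mul_zero] at hgz
  exact (sub_eq_zero.1 hgz.symm)

section CliffordDerivative

variable {n : ℕ} {M : Type*} [TopologicalSpace M] [ChartedSpace (EuclideanSpace ℝ (Fin n)) M]
  {x : M} {v : TangentSpace (𝓡 n) x}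

theorem mvfderiv_sum_apply {F : Type*} [NormedAddCommGroup F] [NormedSpace ℝ F] {κ : Type*}
    {s : Finset κ} {f : κ → M → F} (hf : ∀ k ∈ s, MDifferentiableAt (𝓡 n) 𝓘(ℝ, F) (f k) x) :
    MDifferentiableAt (𝓡 n) 𝓘(ℝ, F) (fun y => ∑ k ∈ s, f k y) x ∧
      mvfderiv (𝓡 n) (fun y => ∑ k ∈ s, f k y) x v = ∑ k ∈ s, mvfderiv (𝓡 n) (f k) x v := by
  classical
  induction s using Finset.induction_on with
  | empty =>
    refine ⟨by simpa using! mdifferentiableAt_const, ?_⟩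
    simp only [Finset.sum_empty, mvfderiv_const]
    rfl
  | insert a s ha ih =>
    obtain ⟨h₁, h₂⟩ := ih fun k hk => hf k (Finset.mem_insert_of_mem hk)
    have h₃ := hf a (Finset.mem_insert_self a s)
    simp only [Finset.sum_insert ha]
    exact ⟨h₃.add h₁, by rw [mvfderiv_fun_add h₃ h₁, add_apply, h₂]⟩

/-- The Clifford algebra valued function `G` has the derivative `D` at `x` in the direction `v`,
tested with linear functionals. -/
def HasClDerivAt (G : M → Cl n) (v : TangentSpace (𝓡 n) x) (D : Cl n) : Prop :=
  ∀ l : Cl n →ₗ[ℝ] ℝ, MDifferentiableAt (𝓡 n) 𝓘(ℝ) (fun y => l (G y)) x ∧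
    mvfderiv (𝓡 n) (fun y => l (G y)) x v = l D

namespace HasClDerivAt

variable {G H : M → Cl n} {D D' : Cl n}

/-- The coordinate functionals of a finite basis already determine the derivative. Through this
lemma, algebraic identities satisfied by `lift` become identities for its derivative. -/
theorem unique (h : HasClDerivAt G v D) (h' : HasClDerivAt G v D') : D = D' := by
  let b := Module.finBasis ℝ (Cl n)
  exact b.ext_elem fun k => ((h (b.coord k)).2.symm.trans (h' (b.coord k)).2)

theorem linear (h : HasClDerivAt G v D) (L : Cl n →ₗ[ℝ] Cl n) :
    HasClDerivAt (fun y => L (G y)) v (L D) :=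
  fun l => h (l ∘ₗ L)

theorem congr (h : HasClDerivAt G v D) (hGH : H =ᶠ[𝓝 x] G) : HasClDerivAt H v D := by
  intro l
  have e : (fun y => l (H y)) =ᶠ[𝓝 x] fun y => l (G y) := hGH.fun_comp l
  refine ⟨(h l).1.congr_of_eventuallyEq e, ?_⟩
  have h' : mvfderiv (𝓡 n) (fun y => l (H y)) x = mvfderiv (𝓡 n) (fun y => l (G y)) x :=
    e.mfderiv_eq
  rw [h', (h l).2]

/-- The derivative of a finite sum of products with the coordinates of a Clifford algebra valued
function. -/
theorem sum_coord_smul {F : Type*} [NormedAddCommGroup F] [NormedSpace ℝ F]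
    (h : HasClDerivAt G v D) {w : Fin (Module.finrank ℝ (Cl n)) → M → F}
    (hw : ∀ k, MDifferentiableAt (𝓡 n) 𝓘(ℝ, F) (w k) x) :
    MDifferentiableAt (𝓡 n) 𝓘(ℝ, F)
      (fun y => ∑ k, (Module.finBasis ℝ (Cl n)).coord k (G y) • w k y) x ∧
    mvfderiv (𝓡 n) (fun y => ∑ k, (Module.finBasis ℝ (Cl n)).coord k (G y) • w k y) x v =
      ∑ k, (Module.finBasis ℝ (Cl n)).coord k D • w k x
        + ∑ k, (Module.finBasis ℝ (Cl n)).coord k (G x) • mvfderiv (𝓡 n) (w k) x v := by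
  have h₁ := fun k => h ((Module.finBasis ℝ (Cl n)).coord k)
  obtain ⟨h₂, h₃⟩ := mvfderiv_sum_apply (v := v) (s := Finset.univ)
    (f := fun k y => (Module.finBasis ℝ (Cl n)).coord k (G y) • w k y)
    fun k _ => (h₁ k).1.smul (hw k)
  refine ⟨h₂, h₃.trans ?_⟩
  rw [← Finset.sum_add_distrib]
  refine Finset.sum_congr rfl fun k _ => ?_
  have h₄ := congrArg (fun L => L v) (mvfderiv_smul (h₁ k).1 (hw k))
  refine Eq.trans h₄ ?_
  rw [add_apply, smul_apply, ContinuousLinearMap.smulRight_apply, (h₁ k).2, add_comm]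

theorem sum_coord {F : Type*} [AddCommGroup F] [Module ℝ F] (L : Cl n →ₗ[ℝ] F) (z : Cl n) :
    L z = ∑ k, (Module.finBasis ℝ (Cl n)).coord k z • L (Module.finBasis ℝ (Cl n) k) := by
  conv_lhs => rw [← (Module.finBasis ℝ (Cl n)).sum_repr z, map_sum]
  exact Finset.sum_congr rfl fun k _ => by rw [map_smul]; rfl

/-- Expanding the first factor in a fixed basis leaves real coefficients times a linear image of the
second factor, so the scalar Leibniz rule suffices. The same device gives the rule for the action on
spinors. -/
theorem mul (h : HasClDerivAt G v D) (h' : HasClDerivAt H v D') :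
    HasClDerivAt (fun y => G y * H y) v (D * H x + G x * D') := by
  intro l
  obtain ⟨h₁, h₂⟩ := h.sum_coord_smul
    (w := fun k y => l (Module.finBasis ℝ (Cl n) k * H y))
    fun k => (h' (l ∘ₗ LinearMap.mulLeft ℝ (Module.finBasis ℝ (Cl n) k))).1
  have e : ∀ z w : Cl n, ∑ k, (Module.finBasis ℝ (Cl n)).coord k z •
      l (Module.finBasis ℝ (Cl n) k * w) = l (z * w) := fun z w =>
    (sum_coord (l ∘ₗ LinearMap.mulRight ℝ w) z).symm
  have e' : ∀ k, mvfderiv (𝓡 n) (fun y => l (Module.finBasis ℝ (Cl n) k * H y)) x v =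
      l (Module.finBasis ℝ (Cl n) k * D') := fun k =>
    (h' (l ∘ₗ LinearMap.mulLeft ℝ (Module.finBasis ℝ (Cl n) k))).2
  simp only [e', e] at h₁ h₂
  exact ⟨h₁, by rw [h₂, map_add]⟩

theorem rep (h : HasClDerivAt G v D) (ρ : SpinRep n) {u : M → SpinorSpace n}
    (hu : MDifferentiableAt (𝓡 n) 𝓘(ℝ, SpinorSpace n) u x) :
    mvfderiv (𝓡 n) (fun y => repCLM ρ (G y) (u y)) x v =
      repCLM ρ D (u x) + repCLM ρ (G x) (mvfderiv (𝓡 n) u x v) := by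
  have e : ∀ z w, ∑ k, (Module.finBasis ℝ (Cl n)).coord k z •
      repCLM ρ (Module.finBasis ℝ (Cl n) k) w = repCLM ρ z w := fun z w =>
    (sum_coord (((ContinuousLinearMap.apply ℝ (SpinorSpace n) w).toLinearMap) ∘ₗ repLin ρ) z).symm
  have hk : ∀ k, HasMFDerivAt (𝓡 n) 𝓘(ℝ, SpinorSpace n)
      (fun y => repCLM ρ (Module.finBasis ℝ (Cl n) k) (u y)) x
      ((repCLM ρ (Module.finBasis ℝ (Cl n) k)).comp (mfderiv (𝓡 n) 𝓘(ℝ, SpinorSpace n) u x)) :=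
    fun k => (repCLM ρ _).hasMFDerivAt.comp x hu.hasMFDerivAt
  have e' : ∀ k, mvfderiv (𝓡 n) (fun y => repCLM ρ (Module.finBasis ℝ (Cl n) k) (u y)) x v =
      repCLM ρ (Module.finBasis ℝ (Cl n) k) (mvfderiv (𝓡 n) u x v) := fun k =>
    congrArg (fun L => L v) (hk k).mfderiv
  obtain ⟨-, h₂⟩ := h.sum_coord_smul
    (w := fun k y => repCLM ρ (Module.finBasis ℝ (Cl n) k) (u y))
    fun k => (hk k).mdifferentiableAt
  simp only [e', e] at h₂
  exact h₂

theorem const (D : Cl n) : HasClDerivAt (fun _ : M => D) v 0 := fun l =>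
  ⟨mdifferentiableAt_const, by rw [mvfderiv_const, map_zero]; rfl⟩

theorem sum_smul {κ : Type*} [Fintype κ] (c : κ → Cl n) {f : κ → M → ℝ}
     (hf : ∀ i, MDifferentiableAt (𝓡 n) 𝓘(ℝ) (f i) x) :
    HasClDerivAt (fun y => ∑ i, f i y • c i) v (∑ i, mvfderiv (𝓡 n) (f i) x v • c i) := by
  intro l
  have h := fun i => (hf i).mul (mdifferentiableAt_const (I := 𝓡 n) (c := l (c i)) (x := x))
  have h' := mvfderiv_sum_apply (v := v) (s := Finset.univ) (f := fun i y => f i y * l (c i))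
    fun i _ => h i
  have e : ∀ y, l (∑ i, f i y • c i) = ∑ i, f i y * l (c i) := by
    intro y
    simp
  simp only [e]
  refine ⟨h'.1, h'.2.trans ?_⟩
  rw [map_sum]
  refine Finset.sum_congr rfl fun i _ => ?_
  have h₁ := congrArg (fun L => L v) (mvfderiv_mul (hf i)
    (mdifferentiableAt_const (I := 𝓡 n) (c := l (c i)) (x := x)))
  refine Eq.trans h₁ ?_
  rw [mvfderiv_const, map_smul]
  simp [mul_comm]

theorem exists_of_mdifferentiableAt
    (hG : ∀ l : Cl n →ₗ[ℝ] ℝ, MDifferentiableAt (𝓡 n) 𝓘(ℝ) (fun y => l (G y)) x) :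
    ∃ D, HasClDerivAt G v D := by
  let b := Module.finBasis ℝ (Cl n)
  refine ⟨∑ k, mvfderiv (𝓡 n) (fun y => b.coord k (G y)) x v • b k, fun l => ⟨hG l, ?_⟩⟩
  have h := fun k => (hG (b.coord k)).mul
    (mdifferentiableAt_const (I := 𝓡 n) (c := l (b k)) (x := x))
  have h' := mvfderiv_sum_apply (v := v) (s := Finset.univ)
    (f := fun k y => b.coord k (G y) * l (b k)) fun k _ => h k
  have e : (fun y => l (G y)) = fun y => ∑ k, b.coord k (G y) * l (b k) :=
    funext fun y => sum_coord l (G y)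
  rw [e, h'.2, map_sum]
  refine Finset.sum_congr rfl fun i _ => ?_
  have h₁ := congrArg (fun L => L v) (mvfderiv_mul (hG (b.coord i))
    (mdifferentiableAt_const (I := 𝓡 n) (c := l (b i)) (x := x)))
  refine Eq.trans h₁ ?_
  rw [mvfderiv_const, map_smul]
  simp [mul_comm]

end HasClDerivAt

end CliffordDerivative

/-! ### The spinor connection in an arbitrary local trivialization -/

theorem repCLM_mul_apply {n : ℕ} (ρ : SpinRep n) (a b : Cl n) (ψ : SpinorSpace n) :
    repCLM ρ (a * b) ψ = repCLM ρ a (repCLM ρ b ψ) := by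
  simp [repCLM_apply]

theorem repCLM_add_apply {n : ℕ} (ρ : SpinRep n) (a b : Cl n) (ψ : SpinorSpace n) :
    repCLM ρ (a + b) ψ = repCLM ρ a ψ + repCLM ρ b ψ :=
  congrArg (fun L => L ψ) ((repLin ρ).map_add a b)

namespace SpinStructure

variable {n : ℕ} {M : Type*} [TopologicalSpace M] [ChartedSpace (EuclideanSpace ℝ (Fin n)) M]
  [RiemannianBundle (fun x : M => TangentSpace (𝓡 n) x)] [IsManifold (𝓡 n) ∞ M]
  {ι : Type*} (S : SpinStructure n M ι) (ρ : SpinRep n)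
  {nab : TangentConn n M} {T : Form3 n M} {x : M}

/-- The connection form of `∇ˢ` in the `a`-th frame. -/
def connForm (nab : TangentConn n M) (T : Form3 n M) (s : ℝ) (a : ι) (x : M)
    (v : TangentSpace (𝓡 n) x) (j k : Fin n) : ℝ :=
  inner ℝ (S.conn nab T s (S.frame a j) x v) (S.frame a k x)

theorem localRep_eq_repCLM (a : ι) (φ : Π x, S.Spinor ρ x) (y : M) :
    S.localRep ρ a φ y = repCLM ρ (S.lift a (S.indexAt y) y) (φ y) := rfl

theorem localRep_change (a b : ι) (φ : Π x, S.Spinor ρ x) {y : M} (ha : y ∈ S.baseSet a)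
    (hb : y ∈ S.baseSet b) :
    S.localRep ρ a φ y = repCLM ρ (S.lift a b y) (S.localRep ρ b φ y) := by
  rw [localRep_eq_repCLM, localRep_eq_repCLM,
    ← S.lift_comp a b (S.indexAt y) y ⟨⟨ha, hb⟩, S.mem_baseSet_at y⟩]
  exact repCLM_mul_apply ρ _ _ (φ y)

variable [IsContMDiffRiemannianBundle (𝓡 n) ∞ (EuclideanSpace ℝ (Fin n))
  (fun x : M => TangentSpace (𝓡 n) x)]

theorem connForm_antisymm (hnab : IsLeviCivita nab) (s : ℝ) {a : ι} (hx : x ∈ S.baseSet a)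
    (v : TangentSpace (𝓡 n) x) (j k : Fin n) :
    S.connForm nab T s a x v k j = -S.connForm nab T s a x v j k := by
  rw [connForm, connForm, inner_conn, inner_conn,
    inner_nab_antisymm hnab (S.isFrameOn a) hx, Form3.swap_right]
  ring

theorem mvfderiv_inner_conn (hnab : IsLeviCivita nab) (s : ℝ) {X Y : VField n M}
    (hX : MDiffFieldAt X x) (hY : MDiffFieldAt Y x) (v : TangentSpace (𝓡 n) x) :
    mvfderiv (𝓡 n) (fun y => inner ℝ (X y) (Y y)) x v =
      inner ℝ (S.conn nab T s X x v) (Y x) + inner ℝ (S.conn nab T s Y x v) (X x) := by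
  rw [mvfderiv_inner hnab hX hY, inner_conn, inner_conn, Form3.swap_right (T x) v (Y x),
    real_inner_comm (nab Y x v)]
  ring

/-- The hypotheses of `spin_gauge` are derivatives of the identities satisfied by the lift: `g ·
star g = 1`, evenness, and its action on vectors. The matrix of that action consists of inner
products of the two frames, which the metric connection `∇ˢ` differentiates through its two
connection forms. -/
theorem exists_hasClDerivAt_lift (hnab : IsLeviCivita nab) (T : Form3 n M) (s : ℝ) {a b : ι}
    (ha : x ∈ S.baseSet a) (hb : x ∈ S.baseSet b) (v : TangentSpace (𝓡 n) x) :
    ∃ D, HasClDerivAt (fun y => (S.lift a b y : Cl n)) v D ∧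
      D + bivCl (S.connForm nab T s a x v) * (S.lift a b x : Cl n) =
        (S.lift a b x : Cl n) * bivCl (S.connForm nab T s b x v) := by
  have hU : S.baseSet a ∩ S.baseSet b ∈ 𝓝 x :=
    ((S.isOpen_baseSet a).inter (S.isOpen_baseSet b)).mem_nhds ⟨ha, hb⟩
  obtain ⟨D, hD⟩ := HasClDerivAt.exists_of_mdifferentiableAt (v := v)
    (G := fun y => (S.lift a b y : Cl n))
    fun l => ((S.smooth_lift a b l).contMDiffAt hU).mdifferentiableAt (by simp)
  have hst : ∀ z : Cl n, ((involute : Cl n →ₐ[ℝ] Cl n).toLinearMap ∘ₗ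
      (reverse : Cl n →ₗ[ℝ] Cl n)) z = star z := fun z => (star_def' z).symm
  have hDs := hD.linear ((involute : Cl n →ₐ[ℝ] Cl n).toLinearMap ∘ₗ (reverse : Cl n →ₗ[ℝ] Cl n))
  simp only [hst] at hDs
  have hEa := S.isFrameOn a
  have hEb := S.isFrameOn b
  refine ⟨D, hD, spin_gauge (S.lift a b x).2 ?_ ?_ (S.connForm_antisymm hnab s ha v)
    (S.connForm_antisymm hnab s hb v)
    (r := fun i j => inner ℝ (S.frame a i x) (S.frame b j x))
    (dr := fun i j => mvfderiv (𝓡 n) (fun y => inner ℝ (S.frame a i y) (S.frame b j y)) x v)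
    (S.lift_spec a b x ⟨ha, hb⟩) (fun j => ?_) fun i j => ?_⟩
  · refine (hD.mul hDs).unique ((HasClDerivAt.const 1).congr (Eventually.of_forall fun y => ?_))
    exact spinGroup.mul_star_self_of_mem (S.lift a b y).2
  · refine (hD.linear (involute : Cl n →ₐ[ℝ] Cl n).toLinearMap).unique
      (hD.congr (Eventually.of_forall fun y => ?_))
    exact spinGroup.involute_eq (S.lift a b y).2
  · have h := ((hD.mul (HasClDerivAt.const (gen j))).mul hDs)
    rw [mul_zero, add_zero] at h
    refine h.unique ((HasClDerivAt.sum_smul gen fun i => ?_).congr ?_)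
    · exact MDifferentiableAt.inner_bundle (hEa.mdiff ha i) (hEb.mdiff hb j)
    · filter_upwards [hU] with y hy using S.lift_spec a b y hy j
  · have h₁ : ∑ m, inner ℝ (S.frame a m x) (S.frame b j x) * S.connForm nab T s a x v m i =
        -inner ℝ (S.conn nab T s (S.frame a i) x v) (S.frame b j x) := by
      rw [← sum_inner_mul_inner_of_orthonormal (hEa.orthonormal x ha), ← Finset.sum_neg_distrib]
      refine Finset.sum_congr rfl fun m _ => ?_
      rw [S.connForm_antisymm hnab s ha v i m, connForm, real_inner_comm (S.frame b j x)]
      ring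
    have h₂ : ∑ m, S.connForm nab T s b x v j m * inner ℝ (S.frame a i x) (S.frame b m x) =
        inner ℝ (S.conn nab T s (S.frame b j) x v) (S.frame a i x) :=
      sum_inner_mul_inner_of_orthonormal (hEb.orthonormal x hb) _ _
    rw [h₁, h₂, S.mvfderiv_inner_conn (T := T) hnab s (hEa.mdiff ha i) (hEb.mdiff hb j)]
    ring

/-- By skewness `½ ∑_{i<j}` equals `¼ ∑_{i,j}`, and `s (v ⌟ T)` is `bivCl` of `2sT(v, ·, ·)`. This
matches the factor `s` on spinors with `2s` on vectors: both connections have the same form. -/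
theorem connCl_add_contrTorCl (hnab : IsLeviCivita nab) (s : ℝ) (v : TangentSpace (𝓡 n) x) :
    S.connCl nab x v + s • S.contrTorCl T x v =
      bivCl (S.connForm nab T s (S.indexAt x) x v) := by
  have hx := S.mem_baseSet_at x
  set w : Fin n → Fin n → ℝ := fun i j =>
    inner ℝ (nab (S.frame (S.indexAt x) i) x v) (S.e x j) with hw
  have hwa : ∀ i j, w j i = -w i j := fun i j =>
    inner_nab_antisymm hnab (S.isFrameOn (S.indexAt x)) hx v i j
  have h₁ : S.connCl nab x v = bivCl w := by
    have hs : ∀ i j, w i j • (gen i * gen j : Cl n) = w j i • (gen j * gen i) := by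
      intro i j
      rcases eq_or_ne i j with rfl | hij
      · rfl
      · rw [gen_anticomm hij.symm, hwa i j, smul_neg, neg_smul, neg_neg]
    have h0 : ∀ i, w i i • (gen i * gen i : Cl n) = 0 := by
      intro i
      have : w i i = 0 := by linarith [hwa i i]
      rw [this, zero_smul]
    have h2 : ∑ i, ∑ j, w i j • (gen i * gen j : Cl n) =
        ∑ i, ∑ j ∈ Finset.Ioi i, w i j • (gen i * gen j)
          + ∑ i, ∑ j ∈ Finset.Ioi i, w i j • (gen i * gen j) := by
      have h3 : ∑ i, ∑ j ∈ Finset.Ioi i, w i j • (gen i * gen j : Cl n) =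
          ∑ i, ∑ j ∈ Finset.Iio i, w i j • (gen i * gen j) := by
        rw [Finset.sum_comm' (t' := Finset.univ) (s' := fun j => Finset.Iio j)
          (by intro i j; simp)]
        exact Finset.sum_congr rfl fun i _ => Finset.sum_congr rfl fun j _ => hs j i
      nth_rewrite 2 [h3]
      rw [← Finset.sum_add_distrib]
      refine Finset.sum_congr rfl fun i _ => ?_
      have h4 : (Finset.univ : Finset (Fin n)) = (Finset.Ioi i ∪ Finset.Iio i) ∪ {i} := by
        ext j
        simp only [Finset.mem_univ, Finset.mem_union, Finset.mem_Ioi, Finset.mem_Iio,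
          Finset.mem_singleton, true_iff]
        rcases lt_trichotomy i j with h | h | h <;> simp [h]
      rw [h4, Finset.sum_union, Finset.sum_union, Finset.sum_singleton, h0, add_zero]
      · exact Finset.disjoint_left.2 fun j hj hj' =>
          lt_asymm (Finset.mem_Ioi.1 hj) (Finset.mem_Iio.1 hj')
      · simp
    change (1 / 2 : ℝ) • ∑ i, ∑ j ∈ Finset.Ioi i, w i j • (gen i * gen j : Cl n) = _
    rw [bivCl, h2]
    module
  have h₂ : S.contrTorCl T x v = bivCl fun i j => 2 * T x ![v, S.e x i, S.e x j] := by
    have h := two_smul_formCl (fun i j => T x ![v, S.e x i, S.e x j])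
      fun i j => Form3.swap_right _ _ _ _
    have h' : (2 : ℝ) • S.contrTorCl T x v =
      ∑ i, ∑ j, T x ![v, S.e x i, S.e x j] • (gen i * gen j) := h
    rw [bivCl]
    simp only [mul_smul, ← Finset.smul_sum]
    rw [← h']
    module
  rw [h₁, h₂, ← bivCl_smul, ← bivCl_add]
  refine congrArg bivCl (funext fun i => funext fun j => ?_)
  rw [connForm, inner_conn, hw]
  simp only [e]
  ring

theorem spinConn_eq (hnab : IsLeviCivita nab) (s : ℝ) (φ : Π x, S.Spinor ρ x)
    (v : TangentSpace (𝓡 n) x) : S.spinConn ρ nab T s φ x v =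
      mvfderiv (𝓡 n) (S.localRep ρ (S.indexAt x) φ) x v +
        repCLM ρ (bivCl (S.connForm nab T s (S.indexAt x) x v)) (φ x) := by
  rw [← S.connCl_add_contrTorCl hnab]
  have h := congrArg (fun L => L (φ x)) (((repLin ρ).map_add (S.connCl nab x v)
    (s • S.contrTorCl T x v)).trans (congrArg _ ((repLin ρ).map_smul s (S.contrTorCl T x v))))
  refine Eq.trans ?_ (congrArg _ h.symm)
  exact add_assoc (G := SpinorSpace n) _ _ _

/-- The spinor connection in an arbitrary trivialization. -/
theorem spinConn_localRep (hnab : IsLeviCivita nab) (s : ℝ) {φ : Π x, S.Spinor ρ x} {a : ι}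
    (hx : x ∈ S.baseSet a) (hφ : S.MDiffSpinorAt ρ φ x) (v : TangentSpace (𝓡 n) x) :
    repCLM ρ (S.lift a (S.indexAt x) x) (S.spinConn ρ nab T s φ x v) =
      mvfderiv (𝓡 n) (S.localRep ρ a φ) x v +
        repCLM ρ (bivCl (S.connForm nab T s a x v)) (S.localRep ρ a φ x) := by
  have hb := S.mem_baseSet_at x
  obtain ⟨D, hD, hg⟩ := S.exists_hasClDerivAt_lift hnab T s hx hb v
  have h := hD.rep ρ (hφ.localRep S ρ)
  have h₁ : S.localRep ρ a φ =ᶠ[𝓝 x]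
      fun y => repCLM ρ (S.lift a (S.indexAt x) y) (S.localRep ρ (S.indexAt x) φ y) := by
    filter_upwards [((S.isOpen_baseSet a).inter
      (S.isOpen_baseSet (S.indexAt x))).mem_nhds ⟨hx, hb⟩] with y hy
    exact S.localRep_change ρ a _ φ hy.1 hy.2
  have h₂ : mvfderiv (𝓡 n) (S.localRep ρ a φ) x = mvfderiv (𝓡 n)
      (fun y => repCLM ρ (S.lift a (S.indexAt x) y) (S.localRep ρ (S.indexAt x) φ y)) x :=
    h₁.mfderiv_eq
  have h₃ : S.localRep ρ (S.indexAt x) φ x = φ x := S.localRep_self ρ φ x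
  have h₄ : repCLM ρ (S.lift a (S.indexAt x) x) (S.spinConn ρ nab T s φ x v) =
      repCLM ρ (S.lift a (S.indexAt x) x)
        (mvfderiv (𝓡 n) (S.localRep ρ (S.indexAt x) φ) x v) +
      repCLM ρ (S.lift a (S.indexAt x) x)
        (repCLM ρ (bivCl (S.connForm nab T s (S.indexAt x) x v))
          (S.localRep ρ (S.indexAt x) φ x)) := by
    rw [S.spinConn_eq ρ hnab, h₃]
    exact map_add (repCLM ρ (S.lift a (S.indexAt x) x)) _ _
  rw [h₄, h₂, h, S.localRep_change ρ a (S.indexAt x) φ hx hb, ← repCLM_mul_apply, ← hg,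
    ← repCLM_mul_apply, repCLM_add_apply]
  abel

end SpinStructure

/-! ### The Dirac operator in a local trivialization -/

/-- The function is the fibre component of the tangent map of `f` composed with the section `X`. -/
theorem contMDiffAt_mvfderiv_apply {n : ℕ} {M : Type*} [TopologicalSpace M]
    [ChartedSpace (EuclideanSpace ℝ (Fin n)) M] [IsManifold (𝓡 n) ∞ M] {F : Type*}
    [NormedAddCommGroup F] [NormedSpace ℝ F] {f : M → F} {X : VField n M} {U : Set M}
    (hU : IsOpen U) (hf : ContMDiffOn (𝓡 n) 𝓘(ℝ, F) ∞ f U) (hX : SmoothFieldOn X U) {x : M}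
    (hx : x ∈ U) : ContMDiffAt (𝓡 n) 𝓘(ℝ, F) ∞ (fun y => mvfderiv (𝓡 n) f y (X y)) x := by
  have hM : IsManifold (𝓡 n) 1 M := IsManifold.of_le (n := ∞) (by decide)
  have h₁ := hf.contMDiffOn_tangentMapWithin (m := ∞) (by decide) hU.uniqueMDiffOn
  have h₂ := (h₁.comp hX (fun y hy => hy)).contMDiffAt (hU.mem_nhds hx)
  have h₃ := (contMDiff_snd_tangentBundle_modelSpace F 𝓘(ℝ, F)).contMDiffAt.comp x h₂
  refine h₃.congr_of_eventuallyEq ?_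
  filter_upwards [hU.mem_nhds hx] with y hy
  have h₄ : mfderivWithin (𝓡 n) 𝓘(ℝ, F) f U y = mfderiv (𝓡 n) 𝓘(ℝ, F) f y :=
    mfderivWithin_of_isOpen hU hy
  exact congrArg (fun L => L (X y)) h₄.symm

theorem repCLM_sum_smul {n : ℕ} (ρ : SpinRep n) {κ : Type*} (s : Finset κ) (c : κ → ℝ)
    (z : κ → Cl n) (ψ : SpinorSpace n) :
    repCLM ρ (∑ i ∈ s, c i • z i) ψ = ∑ i ∈ s, c i • repCLM ρ (z i) ψ := by
  have h : repLin ρ (∑ i ∈ s, c i • z i) = ∑ i ∈ s, c i • repLin ρ (z i) := by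
    rw [map_sum]
    exact Finset.sum_congr rfl fun i _ => map_smul _ _ _
  have h' := congrArg (fun L => L ψ) h
  refine Eq.trans h' ?_
  rw [sum_apply]
  rfl

theorem contMDiffAt_bivCl_apply {n : ℕ} {M : Type*} [TopologicalSpace M]
    [ChartedSpace (EuclideanSpace ℝ (Fin n)) M] (ρ : SpinRep n) {x : M} {f : Fin n → Fin n → M → ℝ}
    (hf : ∀ k l, ContMDiffAt (𝓡 n) 𝓘(ℝ) ∞ (f k l) x) {u : M → SpinorSpace n}
    (hu : ContMDiffAt (𝓡 n) 𝓘(ℝ, SpinorSpace n) ∞ u x) :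
    ContMDiffAt (𝓡 n) 𝓘(ℝ, SpinorSpace n) ∞
      (fun y => repCLM ρ (bivCl fun k l => f k l y) (u y)) x := by
  have e : ∀ y, repCLM ρ (bivCl fun k l => f k l y) (u y) =
      ∑ p : Fin n × Fin n, (1 / 4 * f p.1 p.2 y) • repCLM ρ (gen p.1 * gen p.2) (u y) := by
    intro y
    rw [← repCLM_sum_smul, Fintype.sum_prod_type, bivCl]
    simp only [mul_smul, ← Finset.smul_sum]
  simp only [e]
  refine contMDiffAt_finsetSum fun p _ => ?_
  exact (contMDiffAt_const.mul (hf _ _)).smul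
    ((repCLM ρ (gen p.1 * gen p.2)).contMDiff.contMDiffAt.comp x hu)

namespace SpinStructure

variable {n : ℕ} {M : Type*} [TopologicalSpace M] [ChartedSpace (EuclideanSpace ℝ (Fin n)) M]
  [RiemannianBundle (fun x : M => TangentSpace (𝓡 n) x)] [IsManifold (𝓡 n) ∞ M]
  {ι : Type*} (S : SpinStructure n M ι) (ρ : SpinRep n)
  {nab : TangentConn n M} {T : Form3 n M} {x : M}

theorem contMDiffOn_localRep {φ : Π x, S.Spinor ρ x} (h : S.IsSmoothSpinor ρ φ) (a : ι) :
    ContMDiffOn (𝓡 n) 𝓘(ℝ, SpinorSpace n) ∞ (S.localRep ρ a φ) (S.baseSet a) := by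
  intro x hx
  have hb := S.mem_baseSet_at x
  have hU := ((S.isOpen_baseSet a).inter (S.isOpen_baseSet (S.indexAt x))).mem_nhds ⟨hx, hb⟩
  have h₁ : ContMDiffAt (𝓡 n) 𝓘(ℝ, SpinorSpace n) ∞ (S.localRep ρ (S.indexAt x) φ) x :=
    (contMDiffAt_section x).1 (h x)
  have h₂ := ((S.smooth_repCLM ρ a (S.indexAt x)).contMDiffAt hU).clm_apply h₁
  refine (h₂.congr_of_eventuallyEq ?_).contMDiffWithinAt
  filter_upwards [hU] with y hy using S.localRep_change ρ a _ φ hy.1 hy.2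

theorem isSmoothSpinor_of_localRep {φ : Π x, S.Spinor ρ x}
    (h : ∀ x, ContMDiffAt (𝓡 n) 𝓘(ℝ, SpinorSpace n) ∞ (S.localRep ρ (S.indexAt x) φ) x) :
    S.IsSmoothSpinor ρ φ :=
  fun x => (contMDiffAt_section x).2 (h x)

/-- Clifford multiplication by a tangent vector is independent of the trivialization: the lift
conjugates the coordinates of `v` in one frame into those in the other. -/
theorem lift_mul_vecCl {a : ι} (hx : x ∈ S.baseSet a) (v : TangentSpace (𝓡 n) x) :
    (S.lift a (S.indexAt x) x : Cl n) * S.vecCl x v =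
      (∑ j, inner ℝ (S.frame a j x) v • gen j) * (S.lift a (S.indexAt x) x : Cl n) := by
  have hb := S.mem_baseSet_at x
  set g : Cl n := (S.lift a (S.indexAt x) x : Cl n) with hg
  have hgs : star g * g = 1 := spinGroup.star_mul_self_of_mem (S.lift a (S.indexAt x) x).2
  have h₁ : ∀ i, g * gen i = (∑ j, inner ℝ (S.frame a j x) (S.e x i) • gen j) * g := by
    intro i
    have h := congrArg (fun z => z * g) (S.lift_spec a (S.indexAt x) x ⟨hx, hb⟩ i)
    simp only [mul_assoc] at h
    rw [← hg, hgs, mul_one] at h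
    exact h
  have h₂ : S.vecCl x v = ∑ i, inner ℝ (S.e x i) v • gen i := rfl
  rw [h₂, Finset.mul_sum]
  simp only [mul_smul_comm, h₁, ← smul_mul_assoc]
  rw [← Finset.sum_mul]
  congr 1
  simp only [Finset.smul_sum, smul_smul]
  rw [Finset.sum_comm]
  refine Finset.sum_congr rfl fun j _ => ?_
  rw [← Finset.sum_smul, ← sum_inner_mul_inner_of_orthonormal (S.orthonormal_e x)]
  congr 1
  exact Finset.sum_congr rfl fun i _ => by rw [mul_comm, real_inner_comm v]

theorem vecCl_e (x : M) (i : Fin n) : S.vecCl x (S.e x i) = gen i := by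
  have h₂ : S.vecCl x (S.e x i) = ∑ j, inner ℝ (S.e x j) (S.e x i) • gen j := rfl
  have h := orthonormal_iff_ite.1 (S.orthonormal_e x)
  rw [h₂]
  simp [h]

theorem connForm_frame (s : ℝ) {a : ι} (i : Fin n) :
    S.connForm nab T s a x (S.frame a i x) = fun k l => cofFun nab T (S.frame a) s i k l x := by
  funext k l
  rw [connForm, inner_conn]
  rfl

variable [IsContMDiffRiemannianBundle (𝓡 n) ∞ (EuclideanSpace ℝ (Fin n))
  (fun x : M => TangentSpace (𝓡 n) x)]

/-- The Dirac operator in an arbitrary trivialization. -/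
theorem localRep_dirac (hnab : IsLeviCivita nab) (s : ℝ) {φ : Π x, S.Spinor ρ x} {a : ι}
    (hx : x ∈ S.baseSet a) (hφ : S.MDiffSpinorAt ρ φ x) :
    S.localRep ρ a (S.dirac ρ nab T s φ) x =
      ∑ i, repCLM ρ (gen i) (mvfderiv (𝓡 n) (S.localRep ρ a φ) x (S.frame a i x)
        + repCLM ρ (bivCl fun k l => cofFun nab T (S.frame a) s i k l x)
          (S.localRep ρ a φ x)) := by
  have hb := S.mem_baseSet_at x
  have hE := S.isFrameOn a
  set g : Cl n := (S.lift a (S.indexAt x) x : Cl n) with hg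
  have h₁ : S.localRep ρ a (S.dirac ρ nab T s φ) x =
      ∑ i, repCLM ρ g (repCLM ρ (gen i) (S.spinConn ρ nab T s φ x (S.e x i))) := by
    rw [localRep_eq_repCLM]
    exact map_sum (repCLM ρ g) _ _
  have h₂ : ∀ i, repCLM ρ g (repCLM ρ (gen i) (S.spinConn ρ nab T s φ x (S.e x i))) =
      ∑ j, inner ℝ (S.frame a j x) (S.e x i) •
        repCLM ρ (gen j) (repCLM ρ g (S.spinConn ρ nab T s φ x (S.e x i))) := by
    intro i
    have h := S.lift_mul_vecCl hx (S.e x i)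
    rw [vecCl_e, ← hg] at h
    have key : ∀ ψ : SpinorSpace n, repCLM ρ g (repCLM ρ (gen i) ψ) =
        ∑ j, inner ℝ (S.frame a j x) (S.e x i) • repCLM ρ (gen j) (repCLM ρ g ψ) := fun ψ => by
      rw [← repCLM_mul_apply, h, repCLM_mul_apply, repCLM_sum_smul]
    exact key _
  rw [h₁, Finset.sum_congr rfl fun i _ => h₂ i, Finset.sum_comm]
  refine Finset.sum_congr rfl fun j _ => ?_
  rw [← S.connForm_frame (x := x) s j, ← S.spinConn_localRep ρ hnab s hx hφ]
  -- The sum over the preferred frame reassembles the covariant derivative along the vectors of the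
  -- other frame: the Dirac operator does not depend on the orthonormal frame.
  have h₃ : S.frame a j x = ∑ i, inner ℝ (S.frame a j x) (S.e x i) • S.e x i := by
    conv_lhs => rw [← sum_inner_smul_of_orthonormal (S.orthonormal_e x) (S.frame a j x)]
    exact Finset.sum_congr rfl fun i _ => by rw [real_inner_comm]
  set L : TangentSpace (𝓡 n) x →L[ℝ] SpinorSpace n :=
    (repCLM ρ (gen j)).comp ((repCLM ρ g).comp (S.spinConn ρ nab T s φ x)) with hL
  have h₄ : L (S.frame a j x) = ∑ i, inner ℝ (S.frame a j x) (S.e x i) • L (S.e x i) := by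
    conv_lhs => rw [h₃, map_sum]
    exact Finset.sum_congr rfl fun i _ => map_smul _ _ _
  exact h₄.symm

/-- At points near `x` the preferred frame may be another one, so smoothness is read off from the
formula of `localRep_dirac` in one fixed frame. -/
theorem IsSmoothSpinor.dirac (hnab : IsLeviCivita nab) (hT : IsSmooth3 T) (s : ℝ)
    {φ : Π x, S.Spinor ρ x} (h : S.IsSmoothSpinor ρ φ) :
    S.IsSmoothSpinor ρ (S.dirac ρ nab T s φ) := by
  refine S.isSmoothSpinor_of_localRep ρ fun x => ?_
  set a := S.indexAt x with ha
  have hx : x ∈ S.baseSet a := S.mem_baseSet_at x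
  have hU := (S.isOpen_baseSet a).mem_nhds hx
  have hu := S.contMDiffOn_localRep ρ h a
  have h₁ : ContMDiffAt (𝓡 n) 𝓘(ℝ, SpinorSpace n) ∞ (fun y => ∑ i, repCLM ρ (gen i)
      (mvfderiv (𝓡 n) (S.localRep ρ a φ) y (S.frame a i y)
        + repCLM ρ (bivCl fun k l => cofFun nab T (S.frame a) s i k l y)
          (S.localRep ρ a φ y))) x := by
    refine contMDiffAt_finsetSum fun i _ => ?_
    refine (repCLM ρ (gen i)).contMDiff.contMDiffAt.comp x (ContMDiffAt.add ?_ ?_)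
    · exact contMDiffAt_mvfderiv_apply (S.isOpen_baseSet a) hu (S.smooth_frame a i) hx
    · exact contMDiffAt_bivCl_apply ρ
        (fun k l => contMDiffAt_cofFun hnab hT (S.isFrameOn a) hx s i k l) (hu.contMDiffAt hU)
  refine h₁.congr_of_eventuallyEq ?_
  filter_upwards [hU] with y hy using S.localRep_dirac ρ hnab s hy (h.mdiff S ρ y)

end SpinStructure

/-! ### Prolongation of the twistor equation -/

/-- A spin representation as a representation on the real vector space underlying the spinors. -/
def repAlg {n : ℕ} (ρ : SpinRep n) : Cl n →ₐ[ℝ] Module.End ℝ (SpinorSpace n) :=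
  AlgHom.ofLinearMap (ContinuousLinearMap.coeLM ℝ ∘ₗ repLin ρ)
    (LinearMap.ext fun ψ => by
      change repCLM ρ 1 ψ = ψ
      simp [repCLM_apply])
    fun a b => LinearMap.ext fun ψ => repCLM_mul_apply ρ a b ψ

theorem HasClDerivAt.bivCl {n : ℕ} {M : Type*} [TopologicalSpace M]
    [ChartedSpace (EuclideanSpace ℝ (Fin n)) M] {x : M} (v : TangentSpace (𝓡 n) x)
    {f : Fin n → Fin n → M → ℝ} (hf : ∀ k l, MDifferentiableAt (𝓡 n) 𝓘(ℝ) (f k l) x) :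
    HasClDerivAt (fun y => bivCl fun k l => f k l y) v
      (TwistorTorsion.bivCl fun k l => mvfderiv (𝓡 n) (f k l) x v) := by
  have e : ∀ A : Fin n → Fin n → ℝ, TwistorTorsion.bivCl A =
      (LinearMap.lsmul ℝ (Cl n) (1 / 4))
        (∑ p : Fin n × Fin n, A p.1 p.2 • (gen p.1 * gen p.2)) := by
    intro A
    rw [Fintype.sum_prod_type, TwistorTorsion.bivCl]
    rfl
  simp only [e]
  exact (HasClDerivAt.sum_smul (fun p : Fin n × Fin n => gen p.1 * gen p.2)
    fun p => hf p.1 p.2).linear _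

namespace SpinStructure

variable {n : ℕ} {M : Type*} [TopologicalSpace M] [ChartedSpace (EuclideanSpace ℝ (Fin n)) M]
  [RiemannianBundle (fun x : M => TangentSpace (𝓡 n) x)] [IsManifold (𝓡 n) ∞ M]
  {ι : Type*} (S : SpinStructure n M ι) (ρ : SpinRep n)
  {nab : TangentConn n M} {T : Form3 n M} {x : M}
  [IsContMDiffRiemannianBundle (𝓡 n) ∞ (EuclideanSpace ℝ (Fin n))
    (fun x : M => TangentSpace (𝓡 n) x)]

/-- The twistor equation in an arbitrary trivialization. -/
theorem mvfderiv_localRep_of_twistorOp (hnab : IsLeviCivita nab) (s : ℝ)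
    {φ : Π x, S.Spinor ρ x} {a : ι} (hx : x ∈ S.baseSet a) (hφ : S.MDiffSpinorAt ρ φ x)
    (hP : S.twistorOp ρ nab T s φ x = 0) (i : Fin n) :
    mvfderiv (𝓡 n) (S.localRep ρ a φ) x (S.frame a i x) =
      -repCLM ρ (bivCl fun k l => cofFun nab T (S.frame a) s i k l x) (S.localRep ρ a φ x)
        - (1 / (n : ℝ)) • repCLM ρ (gen i) (S.localRep ρ a (S.dirac ρ nab T s φ) x) := by
  set v := S.frame a i x with hv
  set g : Cl n := (S.lift a (S.indexAt x) x : Cl n) with hg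
  have h₁ := S.spinConn_localRep (T := T) ρ hnab s hx hφ v
  rw [hv, S.connForm_frame (x := x) s i, ← hv, ← hg] at h₁
  have h₂ : S.spinConn ρ nab T s φ x v =
      -((1 / (n : ℝ)) • S.act ρ x (S.vecCl x v) (S.dirac ρ nab T s φ x)) :=
    eq_neg_of_add_eq_zero_left (congrArg (fun L => L v) hP)
  have h₃ : ∀ ψ : SpinorSpace n, repCLM ρ g (-((1 / (n : ℝ)) • repCLM ρ (S.vecCl x v) ψ)) =
      -((1 / (n : ℝ)) • repCLM ρ (gen i) (repCLM ρ g ψ)) := by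
    intro ψ
    have h := S.lift_mul_vecCl hx v
    have h' : ∑ j, inner ℝ (S.frame a j x) v • (gen j : Cl n) = gen i := by
      simp [hv, (S.isFrameOn a).inner_eq hx]
    rw [h', ← hg] at h
    rw [map_neg, map_smul, ← repCLM_mul_apply, h, repCLM_mul_apply]
  have h₄ : repCLM ρ g (S.spinConn ρ nab T s φ x v) =
      -((1 / (n : ℝ)) • repCLM ρ (gen i) (S.localRep ρ a (S.dirac ρ nab T s φ) x)) := by
    rw [h₂]
    exact h₃ _
  rw [h₄] at h₁
  have h₅ : ∀ A B C : SpinorSpace n, -C = A + B → A = -B - C := by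
    intro A B C h
    rw [sub_eq_add_neg, h]
    abel
  exact h₅ _ _ _ h₁

/-! ### Tensors in frame components, and the derivative of the Dirac spinor -/

variable (hnab : IsLeviCivita nab) (hT : IsSmooth3 T) (hpar : S.ParallelTorsion nab T)

/-- The 1-jet at `x` of the preferred frame around `x`. -/
def jetAt (x : M) : FrameJet n :=
  frameJet S hnab hpar (S.isFrameOn (S.indexAt x)) (S.mem_baseSet_at x)

theorem contrTorCl_e (i : Fin n) :
    S.contrTorCl T x (S.e x i) = (S.jetAt hnab hpar x).contrTor i := by
  have h := two_smul_formCl (fun j k => (S.jetAt hnab hpar x).tor i j k)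
    fun j k => (S.jetAt hnab hpar x).tor_swap_right i j k
  rw [FrameJet.contrTor, ← h, smul_smul]
  norm_num
  rfl

theorem torCl_eq : S.torCl T x = (S.jetAt hnab hpar x).torForm := by
  have h := six_smul_formCl (S.jetAt hnab hpar x).tor (S.jetAt hnab hpar x).tor_swap_left
    (S.jetAt hnab hpar x).tor_swap_right
  rw [FrameJet.torForm, ← h, smul_smul]
  norm_num
  rfl

theorem sigma_e (i j k l : Fin n) : S.sigma T x (S.e x i) (S.e x j) (S.e x k) (S.e x l) =
    (S.jetAt hnab hpar x).sig i j k l := by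
  rw [sigma, FrameJet.sig, ← Finset.mul_sum, ← mul_assoc]
  norm_num
  rfl

theorem contrSigmaCl_e (i : Fin n) :
    S.contrSigmaCl T x (S.e x i) = (S.jetAt hnab hpar x).contrSig i := by
  have h := six_smul_formCl (fun j k l => (S.jetAt hnab hpar x).sig i j k l)
    (fun j k l => (S.jetAt hnab hpar x).sig_swap_mid i j k l)
    fun j k l => (S.jetAt hnab hpar x).sig_swap_right i j k l
  rw [FrameJet.contrSig, ← h, smul_smul]
  norm_num
  have e : S.contrSigmaCl T x (S.e x i) = formCl fun f : Fin 3 → Fin n =>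
    S.sigma T x (S.e x i) (S.e x (f 0)) (S.e x (f 1)) (S.e x (f 2)) := rfl
  rw [e]
  simp only [S.sigma_e hnab hpar]

theorem extDCl_eq : S.extDCl T x = (S.jetAt hnab hpar x).extForm := by
  set J := S.jetAt hnab hpar x with hJ
  -- The antisymmetry of the components of `dT` is inherited from `σ_T` through `dT = 2σ_T`.
  have h := twentyfour_smul_formCl J.ext
    (fun i j k l => by rw [J.ext_eq, J.ext_eq, J.sig_swap_left]; ring)
    (fun i j k l => by rw [J.ext_eq, J.ext_eq, J.sig_swap_mid]; ring)
    (fun i j k l => by rw [J.ext_eq, J.ext_eq, J.sig_swap_right]; ring)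
  rw [FrameJet.extForm, ← h, smul_smul, extDCl]
  simp only [extD_eq_ext S hnab hpar (S.isFrameOn (S.indexAt x)) (S.mem_baseSet_at x)]
  norm_num
  rfl

include hT in
theorem schoutenCl_e (s : ℝ) (i : Fin n) :
    S.schoutenCl nab T s x (S.e x i) = (S.jetAt hnab hpar x).schouten s i := by
  have hr : ∀ j k, S.ricComp nab T s x j k = (S.jetAt hnab hpar x).ric s j k := fun j k =>
    Finset.sum_congr rfl fun i _ =>
      inner_curv_eq_riem S hnab hT hpar (S.isFrameOn (S.indexAt x)) (S.mem_baseSet_at x) s j i i k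
  have hs : S.scal nab T s x = ∑ j, (S.jetAt hnab hpar x).ric s j j :=
    Finset.sum_congr rfl fun j _ => hr j j
  have hric : S.ricCl nab T s x (S.e x i) = ∑ k, (S.jetAt hnab hpar x).ric s i k • gen k := by
    have e : S.ricCl nab T s x (S.e x i) =
      ∑ k, (∑ j, inner ℝ (S.e x j) (S.e x i) * S.ricComp nab T s x j k) • gen k := rfl
    rw [e]
    simp [orthonormal_iff_ite.1 (S.orthonormal_e x), hr]
  rw [schoutenCl, FrameJet.schouten, LinearMap.smul_apply, LinearMap.add_apply,
    LinearMap.neg_apply, LinearMap.smul_apply, vecCl_e, hric, hs]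

include hT in
/-- The derivative of the Dirac operator of a twistor spinor with torsion, in an arbitrary
trivialization. -/
theorem mvfderiv_localRep_dirac (hn : 3 ≤ n) (s : ℝ) {φ : Π x, S.Spinor ρ x}
    (hφ : S.IsSmoothSpinor ρ φ) (hP : ∀ x, S.twistorOp ρ nab T s φ x = 0) {a : ι}
    (hx : x ∈ S.baseSet a) {J : FrameJet n} (hJ : J = frameJet S hnab hpar (S.isFrameOn a) hx)
    (i : Fin n) :
    mvfderiv (𝓡 n) (S.localRep ρ a (S.dirac ρ nab T s φ)) x (S.frame a i x)
        + repAlg ρ (bivCl (J.cof s i)) (S.localRep ρ a (S.dirac ρ nab T s φ) x) =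
      ((n : ℝ) / 2) • repAlg ρ (J.schouten s i) (S.localRep ρ a φ x)
      + (s * n * (3 - 4 * s) / (((n : ℝ) - 1) * ((n : ℝ) - 2))) •
        repAlg ρ (gen i * J.extForm + ((n : ℝ) - 1) • J.contrSig i) (S.localRep ρ a φ x)
      + (s * n / (((n : ℝ) - 1) * ((n : ℝ) - 2))) •
        repAlg ρ ((8 * ((n : ℝ) - 1) / n) • J.contrTor i + (12 / (n : ℝ)) • (gen i * J.torForm))
          (S.localRep ρ a (S.dirac ρ nab T s φ) x) := by
  subst hJ
  have hψ := IsSmoothSpinor.dirac S ρ hnab hT s hφ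
  have hE := S.isFrameOn a
  let J := frameJet S hnab hpar (S.isFrameOn a) hx
  have hU := (S.isOpen_baseSet a).mem_nhds hx
  have hu := (S.contMDiffOn_localRep ρ hφ a).contMDiffAt hU
  have hw := (S.contMDiffOn_localRep ρ hψ a).contMDiffAt hU
  set u := S.localRep ρ a φ with hud
  set w := S.localRep ρ a (S.dirac ρ nab T s φ) with hwd
  have htw : ∀ y ∈ S.baseSet a, ∀ j, mvfderiv (𝓡 n) u y (S.frame a j y) =
      -repCLM ρ (bivCl fun k l => cofFun nab T (S.frame a) s j k l y) (u y)
        - (1 / (n : ℝ)) • repCLM ρ (gen j) (w y) := fun y hy j =>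
    S.mvfderiv_localRep_of_twistorOp ρ hnab s hy (hφ.mdiff S ρ y) (hP y) j
  -- The twistor equation `htw` holds on a whole neighbourhood in the fixed frame, so both of its
  -- sides may be differentiated.
  have hDD : ∀ i j, mvfderiv (𝓡 n) (fun y => mvfderiv (𝓡 n) u y (S.frame a j y)) x
      (S.frame a i x) = -repAlg ρ (bivCl (J.dcof s i j)) (u x)
        - repAlg ρ (bivCl (J.cof s j)) (mvfderiv (𝓡 n) u x (S.frame a i x))
        - (1 / (n : ℝ)) • repAlg ρ (gen j) (mvfderiv (𝓡 n) w x (S.frame a i x)) := by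
    intro i j
    have h₁ : (fun y => mvfderiv (𝓡 n) u y (S.frame a j y)) =ᶠ[𝓝 x]
        fun y => -repCLM ρ (bivCl fun k l => cofFun nab T (S.frame a) s j k l y) (u y)
          - (1 / (n : ℝ)) • repCLM ρ (gen j) (w y) := by
      filter_upwards [hU] with y hy using htw y hy j
    have h₂ : mvfderiv (𝓡 n) (fun y => mvfderiv (𝓡 n) u y (S.frame a j y)) x = mvfderiv (𝓡 n)
        (fun y => -repCLM ρ (bivCl fun k l => cofFun nab T (S.frame a) s j k l y) (u y)
          - (1 / (n : ℝ)) • repCLM ρ (gen j) (w y)) x := h₁.mfderiv_eq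
    have hc := fun k l => contMDiffAt_cofFun hnab hT hE hx s j k l
    have h₃ := (HasClDerivAt.bivCl (S.frame a i x)
      fun k l => mdiff_cofFun hnab hT hE hx s j k l).rep ρ (hu.mdifferentiableAt (by simp))
    have h₄ := (contMDiffAt_bivCl_apply ρ hc hu).mdifferentiableAt (by simp)
    have h₅ : HasMFDerivAt (𝓡 n) 𝓘(ℝ, SpinorSpace n)
        (fun y => ((1 / (n : ℝ)) • repCLM ρ (gen j)) (w y)) x
        (((1 / (n : ℝ)) • repCLM ρ (gen j)).comp (mfderiv (𝓡 n) 𝓘(ℝ, SpinorSpace n) w x)) :=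
      ((1 / (n : ℝ)) • repCLM ρ (gen j)).hasMFDerivAt.comp x
        (hw.mdifferentiableAt (by simp)).hasMFDerivAt
    have h₆ := mvfderiv_fun_sub h₄.neg h₅.mdifferentiableAt
    have h₇ := congrArg (fun L => L (S.frame a i x)) (h₂.trans h₆)
    have h₈ : mvfderiv (𝓡 n) (fun y => ((1 / (n : ℝ)) • repCLM ρ (gen j)) (w y)) x (S.frame a i x) =
      (1 / (n : ℝ)) • repCLM ρ (gen j) (mvfderiv (𝓡 n) w x (S.frame a i x)) :=
      congrArg (fun L => L (S.frame a i x)) h₅.mfderiv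
    have h₉ : bivCl (J.dcof s i j) = bivCl fun k l =>
        mvfderiv (𝓡 n) (cofFun nab T (S.frame a) s j k l) x (S.frame a i x) := by
      congr 1
      funext k l
      exact frameJet_dcof S hnab hT hpar hE hx s i j k l
    refine h₇.trans ?_
    rw [sub_apply, h₈, h₉]
    congr 1
    have h₁₀ := congrArg (fun L => L (S.frame a i x)) (mvfderiv_fun_neg (I := 𝓡 n) (x := x)
      (g := fun y => repCLM ρ (bivCl fun k l => cofFun nab T (S.frame a) s j k l y) (u y)))
    refine h₁₀.trans ?_
    rw [neg_apply, h₃, neg_add']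
    rfl
  -- The frame fields do not commute; their bracket contributes the structure functions.
  have hcomm : ∀ i j, mvfderiv (𝓡 n) (fun y => mvfderiv (𝓡 n) u y (S.frame a j y)) x
      (S.frame a i x) - mvfderiv (𝓡 n) (fun y => mvfderiv (𝓡 n) u y (S.frame a i y)) x
      (S.frame a j x) = ∑ m, J.str i j m • mvfderiv (𝓡 n) u x (S.frame a m x) := by
    intro i j
    rw [mvfderiv_mlieBracket hu (hE.mdiff hx i) (hE.mdiff hx j), mlieBracket_eq_sum hnab hE hx,
      map_sum]
    exact Finset.sum_congr rfl fun m _ => map_smul _ _ _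
  exact J.twistor_prolongation (repAlg ρ) hn s (u := u x) (v := w x)
    (U := fun j => mvfderiv (𝓡 n) u x (S.frame a j x))
    (v' := fun i => mvfderiv (𝓡 n) w x (S.frame a i x)) (fun j => htw x hx j) hDD hcomm i

include hnab hT hpar in
/-- The derivative of the Dirac operator of a twistor spinor with torsion. -/
theorem spinConn_dirac_of_twistor (hn : 3 ≤ n) (s : ℝ) {φ : Π x, S.Spinor ρ x}
    (hφ : S.IsSmoothSpinor ρ φ) (hP : ∀ x, S.twistorOp ρ nab T s φ x = 0) (x : M) (i : Fin n) :
    S.spinConn ρ nab T s (S.dirac ρ nab T s φ) x (S.e x i) =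
      ((n : ℝ) / 2) • S.act ρ x (S.schoutenCl nab T s x (S.e x i)) (φ x)
      + (s * n * (3 - 4 * s) / (((n : ℝ) - 1) * ((n : ℝ) - 2))) •
        S.act ρ x (S.vecCl x (S.e x i) * S.extDCl T x
          + ((n : ℝ) - 1) • S.contrSigmaCl T x (S.e x i)) (φ x)
      + (s * n / (((n : ℝ) - 1) * ((n : ℝ) - 2))) •
        S.act ρ x ((8 * ((n : ℝ) - 1) / n) • S.contrTorCl T x (S.e x i)
          + (12 / (n : ℝ)) • (S.vecCl x (S.e x i) * S.torCl T x)) (S.dirac ρ nab T s φ x) := by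
  have hmain := S.mvfderiv_localRep_dirac ρ hnab hT hpar hn s hφ hP (S.mem_baseSet_at x)
    (J := S.jetAt hnab hpar x) rfl i
  rw [S.spinConn_eq ρ hnab s _ (S.e x i), vecCl_e, S.extDCl_eq hnab hpar, S.torCl_eq hnab hpar,
    S.contrSigmaCl_e hnab hpar, S.contrTorCl_e hnab hpar, S.schoutenCl_e hnab hT hpar]
  rw [S.localRep_self ρ φ x, S.localRep_self ρ (S.dirac ρ nab T s φ) x] at hmain
  have hcf : S.connForm nab T s (S.indexAt x) x (S.e x i) = (S.jetAt hnab hpar x).cof s i :=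
    S.connForm_frame (x := x) s i
  rw [hcf]
  exact hmain

end SpinStructure

/-! ### Twistor spinors and parallel sections of `Σ ⊕ Σ` -/

namespace SpinStructure

variable {n : ℕ} {M : Type*} [TopologicalSpace M] [ChartedSpace (EuclideanSpace ℝ (Fin n)) M]
  [RiemannianBundle (fun x : M => TangentSpace (𝓡 n) x)] [IsManifold (𝓡 n) ∞ M]
  {ι : Type*} (S : SpinStructure n M ι) (ρ : SpinRep n)
  {nab : TangentConn n M} {T : Form3 n M}

theorem sum_inner_e_smul (x : M) (v : TangentSpace (𝓡 n) x) :
    ∑ k, inner ℝ (S.e x k) v • S.e x k = v :=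
  sum_inner_smul_of_orthonormal (S.orthonormal_e x) v

theorem clm_ext_e {F : Type*} [TopologicalSpace F] [AddCommGroup F] [Module ℝ F] {x : M}
    {L L' : TangentSpace (𝓡 n) x →L[ℝ] F} (h : ∀ i, L (S.e x i) = L' (S.e x i)) : L = L' := by
  ext1 v
  rw [← S.sum_inner_e_smul x v, map_sum, map_sum]
  exact Finset.sum_congr rfl fun i _ => by rw [map_smul, map_smul, h]

theorem twistorConn_snd (s : ℝ) (φ ψ : Π x, S.Spinor ρ x) (x : M) (v : TangentSpace (𝓡 n) x) :
    (S.twistorConn ρ nab T s (fun x => (φ x, ψ x)) x v).2 =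
      S.spinConn ρ nab T s ψ x v + (-((n : ℝ) / 2) • S.act ρ x (S.schoutenCl nab T s x v) (φ x)
      - (s * n * (3 - 4 * s) / (((n : ℝ) - 1) * ((n : ℝ) - 2))) •
        S.act ρ x (S.vecCl x v * S.extDCl T x + ((n : ℝ) - 1) • S.contrSigmaCl T x v) (φ x)
      - (s * n / (((n : ℝ) - 1) * ((n : ℝ) - 2))) •
        S.act ρ x ((8 * ((n : ℝ) - 1) / n) • S.contrTorCl T x v
          + (12 / (n : ℝ)) • (S.vecCl x v * S.torCl T x)) (ψ x)) := rfl

/-- A twistor spinor `φ` yields the parallel section `φ ⊕ Dφ`. -/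
theorem twistorConn_eq_zero [IsContMDiffRiemannianBundle (𝓡 n) ∞ (EuclideanSpace ℝ (Fin n))
      (fun x : M => TangentSpace (𝓡 n) x)] (hnab : IsLeviCivita nab) (hT : IsSmooth3 T)
    (hpar : S.ParallelTorsion nab T) (hn : 3 ≤ n) (s : ℝ) {φ : Π x, S.Spinor ρ x}
    (hφ : S.IsSmoothSpinor ρ φ) (hP : ∀ x, S.twistorOp ρ nab T s φ x = 0) :
    S.twistorConn ρ nab T s (fun x => (φ x, S.dirac ρ nab T s φ x)) = 0 := by
  funext x
  refine S.clm_ext_e fun i => Prod.ext ?_ ?_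
  · exact congrArg (fun L => L (S.e x i)) (hP x)
  · refine (S.twistorConn_snd ρ s φ (S.dirac ρ nab T s φ) x (S.e x i)).trans ?_
    have key : ∀ A B C : S.Spinor ρ x, A + B + C + (-((n : ℝ) / 2) •
        S.act ρ x (S.schoutenCl nab T s x (S.e x i)) (φ x) - B - C) =
        A - ((n : ℝ) / 2) • S.act ρ x (S.schoutenCl nab T s x (S.e x i)) (φ x) := by
      intro A B C
      rw [neg_smul]
      abel
    rw [S.spinConn_dirac_of_twistor ρ hnab hT hpar hn s hφ hP x i]
    exact (key _ _ _).trans (sub_self _)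

/-- A parallel section `φ ⊕ ψ` consists of a twistor spinor `φ` and `ψ = Dφ`. -/
theorem twistorOp_eq_zero (hn : n ≠ 0) (s : ℝ) {φ ψ : Π x, S.Spinor ρ x}
    (h : S.twistorConn ρ nab T s (fun x => (φ x, ψ x)) = 0) :
    (∀ x, S.twistorOp ρ nab T s φ x = 0) ∧ S.dirac ρ nab T s φ = ψ := by
  have h₁ : ∀ x v, S.spinConn ρ nab T s φ x v
      + (1 / (n : ℝ)) • S.act ρ x (S.vecCl x v) (ψ x) = 0 := fun x v =>
    congrArg (fun L => Prod.fst (L v)) (congrFun h x)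
  have h₂ : S.dirac ρ nab T s φ = ψ := by
    funext x
    -- Since `e_i · e_i = -1`, each of the `n` summands of the Dirac operator equals `ψ/n`.
    have key : ∀ (i : Fin n) (χ : SpinorSpace n),
        repCLM ρ (gen i) (-((1 / (n : ℝ)) • repCLM ρ (gen i) χ)) = (1 / (n : ℝ)) • χ := by
      intro i χ
      rw [map_neg, map_smul, ← repCLM_mul_apply, gen_mul_self, ← smul_neg]
      congr 1
      simp [repCLM_apply, Matrix.neg_mulVec]
    have h₃ : ∀ i, S.act ρ x (gen i) (S.spinConn ρ nab T s φ x (S.e x i)) =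
        (1 / (n : ℝ)) • ψ x := by
      intro i
      rw [eq_neg_of_add_eq_zero_left (h₁ x (S.e x i)), vecCl_e]
      exact key i (ψ x)
    rw [dirac, Finset.sum_congr rfl fun i _ => h₃ i, Finset.sum_const, Finset.card_univ,
      Fintype.card_fin, ← Nat.cast_smul_eq_nsmul ℝ, smul_smul, mul_one_div_cancel (by simpa),
      one_smul]
  refine ⟨fun x => ?_, h₂⟩
  ext1 v
  have := h₁ x v
  rw [← h₂] at this
  exact this

end SpinStructure

/-! ### Unique continuation -/

section UniqueContinuation

variable {n : ℕ} {M : Type*} [TopologicalSpace M] [ChartedSpace (EuclideanSpace ℝ (Fin n)) M]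
  [RiemannianBundle (fun x : M => TangentSpace (𝓡 n) x)] [IsManifold (𝓡 n) ∞ M]
  [IsContMDiffRiemannianBundle (𝓡 n) ∞ (EuclideanSpace ℝ (Fin n))
    (fun x : M => TangentSpace (𝓡 n) x)]
  {F : Type*} [NormedAddCommGroup F] [NormedSpace ℝ F]

/-- The differential of the inverse of a chart, measured in a frame, is locally bounded. -/
theorem eventually_abs_inner_mfderivWithin_symm_le (x : M) :
    ∃ C : ℝ, ∀ᶠ z in 𝓝 (extChartAt (𝓡 n) x x), ∀ (ξ : EuclideanSpace ℝ (Fin n))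
      (w : TangentSpace (𝓡 n) ((extChartAt (𝓡 n) x).symm z)), ‖w‖ = 1 →
      |inner ℝ w (mfderivWithin 𝓘(ℝ, EuclideanSpace ℝ (Fin n)) (𝓡 n) (extChartAt (𝓡 n) x).symm
        (Set.range (𝓡 n)) z ξ)| ≤ C * ‖ξ‖ := by
  have : IsManifold (𝓡 n) 1 M := IsManifold.of_le (n := ∞) (by decide)
  have : IsContinuousRiemannianBundle (EuclideanSpace ℝ (Fin n))
      (fun x : M => TangentSpace (𝓡 n) x) := by
    obtain ⟨g, hg, h⟩ := IsContMDiffRiemannianBundle.exists_contMDiff (IB := 𝓡 n) (n := ∞)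
      (F := EuclideanSpace ℝ (Fin n)) (E := fun x : M => TangentSpace (𝓡 n) x)
    exact ⟨g, hg.continuous, h⟩
  obtain ⟨C, -, hC⟩ := eventually_norm_mfderivWithin_symm_extChartAt_lt (𝓡 n) x
  have hr : 𝓝[Set.range (𝓡 n)] (extChartAt (𝓡 n) x x) = 𝓝 (extChartAt (𝓡 n) x x) := by
    rw [ModelWithCorners.range_eq_univ, nhdsWithin_univ]
  rw [hr] at hC
  refine ⟨C, ?_⟩
  filter_upwards [hC] with z hz ξ w hw
  refine (abs_real_inner_le_norm _ _).trans ?_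
  rw [hw, one_mul]
  exact (ContinuousLinearMap.le_opNorm _ ξ).trans
    (mul_le_mul_of_nonneg_right hz.le (norm_nonneg ξ))

/-- A solution of a linear total differential equation which vanishes at a point near `x` vanishes
near `x`. -/
theorem exists_nhds_eq_zero {f : M → F} {E : Fin n → VField n M} {U : Set M} (hE : IsFrameOn E U)
    (hf : ∀ y ∈ U, MDifferentiableAt (𝓡 n) 𝓘(ℝ, F) f y) {x : M} (hx : x ∈ U)
    {L : Fin n → M → F →L[ℝ] F} (hL : ∀ i, ContinuousAt (L i) x)
    (hfL : ∀ y ∈ U, ∀ i, mvfderiv (𝓡 n) f y (E i y) = L i y (f y)) :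
    ∃ V ∈ 𝓝 x, V ⊆ U ∧ ∀ p ∈ V, f p = 0 → ∀ q ∈ V, f q = 0 := by
  have : IsManifold (𝓡 n) 1 M := IsManifold.of_le (n := ∞) (by decide)
  obtain ⟨C, hC⟩ := eventually_abs_inner_mfderivWithin_symm_le (n := n) x
  set χ := extChartAt (𝓡 n) x with hχ
  have hcont : ContinuousAt χ.symm (χ x) := continuousAt_extChartAt_symm x
  have hinv : χ.symm (χ x) = x := extChartAt_to_inv x
  have hbd : ∀ i, ∀ᶠ y in 𝓝 x, ‖L i y‖ < ‖L i x‖ + 1 := fun i =>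
    (hL i).norm.eventually (gt_mem_nhds (lt_add_one _))
  have hnear : ∀ᶠ y in 𝓝 x, y ∈ U ∧ ∀ i, ‖L i y‖ < ‖L i x‖ + 1 :=
    (hE.isOpen.eventually_mem hx).and (eventually_all.2 hbd)
  rw [← hinv] at hnear
  have hgood := ((hcont.eventually hnear).and hC).and
    ((isOpen_extChartAt_target (I := 𝓡 n) x).mem_nhds (mem_extChartAt_target x))
  rw [hinv] at hgood
  obtain ⟨r, hr, hball⟩ := Metric.eventually_nhds_iff_ball.1 hgood
  refine ⟨χ.source ∩ χ ⁻¹' Metric.ball (χ x) r, inter_mem (extChartAt_source_mem_nhds x)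
    ((continuousAt_extChartAt x).preimage_mem_nhds (Metric.ball_mem_nhds _ hr)), ?_, ?_⟩
  · rintro y ⟨hys, hyb⟩
    have := (hball _ hyb).1.1.1
    rwa [χ.left_inv hys] at this
  rintro p ⟨hps, hpb⟩ hp q ⟨hqs, hqb⟩
  set η := χ q - χ p with hη
  -- The segment from `p` to `q` in the chart stays in the ball by convexity, so the frame, the
  -- equation and both bounds are available along it.
  set γ : ℝ → EuclideanSpace ℝ (Fin n) := fun t => χ p + t • η with hγ
  have hγb : ∀ t ∈ Set.Icc (0 : ℝ) 1, γ t ∈ Metric.ball (χ x) r := by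
    intro t ht
    have h := (convex_ball (χ x) r).add_smul_sub_mem hpb hqb ht
    exact h
  have hγ' : ∀ t, HasDerivAt γ η t := fun t =>
    (((hasDerivAt_id t).smul_const η).const_add (χ p)).congr_deriv (one_smul ℝ η)
  have hder : ∀ t ∈ Set.Icc (0 : ℝ) 1, HasDerivAt (fun t => f (χ.symm (γ t)))
      (mvfderiv (𝓡 n) f (χ.symm (γ t)) (mfderivWithin 𝓘(ℝ, EuclideanSpace ℝ (Fin n)) (𝓡 n) χ.symm
        (Set.range (𝓡 n)) (γ t) η)) t := by
    intro t ht
    obtain ⟨⟨⟨hU, -⟩, -⟩, htar⟩ := hball _ (hγb t ht)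
    have h₁ := (mdifferentiableWithinAt_extChartAt_symm (I := 𝓡 n) htar).hasMFDerivWithinAt
    have h₂ := ((hf _ hU).hasMFDerivAt.comp_hasMFDerivWithinAt (γ t) h₁).hasFDerivWithinAt
    have h₃ := h₂.hasFDerivAt (by rw [ModelWithCorners.range_eq_univ]; exact univ_mem)
    exact h₃.comp_hasDerivAt t (hγ' t)
  -- Grönwall: a function vanishing at `0` whose derivative is bounded by `K` times itself vanishes.
  -- In `K`, the factor `C * ‖η‖` bounds each frame component of the velocity and `‖L i x‖ + 1`
  -- bounds the `i`-th coefficient near `x`.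
  have hzero := eq_zero_of_abs_deriv_le_mul_abs_self_of_eq_zero_right
    (f := fun t => f (χ.symm (γ t))) (a := 0) (b := 1)
    (K := ∑ i, (C * ‖η‖) * (‖L i x‖ + 1))
    (fun t ht => (hder t ht).continuousAt.continuousWithinAt)
    (fun t ht => (hder t (Set.Ico_subset_Icc_self ht)).hasDerivWithinAt)
    (by simpa [hγ, χ.left_inv hps] using hp) ?_ 1 (by simp)
  · simpa [hγ, hη, χ.left_inv hqs] using hzero
  intro t ht
  obtain ⟨⟨⟨hU, hLb⟩, hCb⟩, -⟩ := hball _ (hγb t (Set.Ico_subset_Icc_self ht))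
  set y := χ.symm (γ t) with hy
  set v : TangentSpace (𝓡 n) y := mfderivWithin 𝓘(ℝ, EuclideanSpace ℝ (Fin n)) (𝓡 n) χ.symm
        (Set.range (𝓡 n)) (γ t) η with hv
  -- The equation prescribes derivatives along the frame only, so the velocity is expanded in it.
  have hsum : mvfderiv (𝓡 n) f y v = ∑ i, inner ℝ (E i y) v • L i y (f y) := by
    conv_lhs => rw [← sum_inner_smul_of_orthonormal (hE.orthonormal y hU) v]
    rw [map_sum]
    exact Finset.sum_congr rfl fun i _ => by rw [map_smul, hfL y hU]
  rw [hsum, Finset.sum_mul]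
  refine norm_sum_le_of_le _ fun i _ => ?_
  have h₁ : |inner ℝ (E i y) v| ≤ C * ‖η‖ := hCb η (E i y) ((hE.orthonormal y hU).1 i)
  rw [norm_smul, mul_assoc]
  exact mul_le_mul h₁ (((L i y).le_opNorm _).trans
    (mul_le_mul_of_nonneg_right (hLb i).le (norm_nonneg _))) (norm_nonneg _)
    ((abs_nonneg _).trans h₁)

end UniqueContinuation

/-! ### Continuity of the coefficients -/

/-- Continuity at a point of a family of 1-jets of frames. -/
structure FrameJet.ContinuousFamilyAt {n : ℕ} {X : Type*} [TopologicalSpace X] (J : X → FrameJet n)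
    (x : X) : Prop where
  chr : ∀ i j k, ContinuousAt (fun y => (J y).chr i j k) x
  tor : ∀ i j k, ContinuousAt (fun y => (J y).tor i j k) x
  dchr : ∀ i j k l, ContinuousAt (fun y => (J y).dchr i j k l) x
  dtor : ∀ i j k l, ContinuousAt (fun y => (J y).dtor i j k l) x

namespace FrameJet.ContinuousFamilyAt

variable {n : ℕ} {X : Type*} [TopologicalSpace X] {J : X → FrameJet n} {x : X}
  {F : Type*} [NormedAddCommGroup F] [NormedSpace ℝ F] (l : Cl n →ₗ[ℝ] F)

theorem _root_.TwistorTorsion.continuousAt_finsetSum {κ G : Type*} [TopologicalSpace G]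
    [AddCommMonoid G] [ContinuousAdd G] {s : Finset κ} {f : κ → X → G}
    (h : ∀ k, ContinuousAt (f k) x) : ContinuousAt (fun y => ∑ k ∈ s, f k y) x :=
  tendsto_finsetSum _ fun k _ => h k

theorem cof (h : ContinuousFamilyAt J x) (s : ℝ) (i j k : Fin n) :
    ContinuousAt (fun y => (J y).cof s i j k) x :=
  (h.chr i j k).add (continuousAt_const.mul (h.tor i j k))

theorem dcof (h : ContinuousFamilyAt J x) (s : ℝ) (i j k l : Fin n) :
    ContinuousAt (fun y => (J y).dcof s i j k l) x :=
  (h.dchr i j k l).add (continuousAt_const.mul (h.dtor i j k l))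

theorem str (h : ContinuousFamilyAt J x) (i j k : Fin n) :
    ContinuousAt (fun y => (J y).str i j k) x :=
  (h.chr i j k).sub (h.chr j i k)

theorem ric (h : ContinuousFamilyAt J x) (s : ℝ) (i k : Fin n) :
    ContinuousAt (fun y => (J y).ric s i k) x :=
  continuousAt_finsetSum fun _ => ((h.dcof s _ _ _ _).sub (h.dcof s _ _ _ _)).add <|
    continuousAt_finsetSum fun _ => (((h.cof s _ _ _).mul (h.cof s _ _ _)).sub
      ((h.cof s _ _ _).mul (h.cof s _ _ _))).sub ((h.str _ _ _).mul (h.cof s _ _ _))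

theorem sig (h : ContinuousFamilyAt J x) (i j k l : Fin n) :
    ContinuousAt (fun y => (J y).sig i j k l) x :=
  continuousAt_finsetSum fun _ => (((h.tor _ _ _).mul (h.tor _ _ _)).sub
    ((h.tor _ _ _).mul (h.tor _ _ _))).add ((h.tor _ _ _).mul (h.tor _ _ _))

theorem ext (h : ContinuousFamilyAt J x) (i j k l : Fin n) :
    ContinuousAt (fun y => (J y).ext i j k l) x := by
  simp only [FrameJet.ext_eq]
  exact continuousAt_const.mul (h.sig i j k l)

theorem bivCl_cof (h : ContinuousFamilyAt J x) (s : ℝ) (i : Fin n) :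
    ContinuousAt (fun y => l (bivCl ((J y).cof s i))) x := by
  simp only [bivCl, map_smul, map_sum]
  exact (continuousAt_finsetSum fun _ => continuousAt_finsetSum fun _ =>
    (h.cof s _ _ _).smul continuousAt_const).const_smul _

theorem contrTor (h : ContinuousFamilyAt J x) (i : Fin n) :
    ContinuousAt (fun y => l ((J y).contrTor i)) x := by
  simp only [FrameJet.contrTor, map_smul, map_sum]
  exact (continuousAt_finsetSum fun _ => continuousAt_finsetSum fun _ =>
    (h.tor _ _ _).smul continuousAt_const).const_smul _

theorem torForm (h : ContinuousFamilyAt J x) : ContinuousAt (fun y => l (J y).torForm) x := by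
  simp only [FrameJet.torForm, map_smul, map_sum]
  exact (continuousAt_finsetSum fun _ => continuousAt_finsetSum fun _ =>
    continuousAt_finsetSum fun _ => (h.tor _ _ _).smul continuousAt_const).const_smul _

theorem contrSig (h : ContinuousFamilyAt J x) (i : Fin n) :
    ContinuousAt (fun y => l ((J y).contrSig i)) x := by
  simp only [FrameJet.contrSig, map_smul, map_sum]
  exact (continuousAt_finsetSum fun _ => continuousAt_finsetSum fun _ =>
    continuousAt_finsetSum fun _ => (h.sig _ _ _ _).smul continuousAt_const).const_smul _

theorem extForm (h : ContinuousFamilyAt J x) : ContinuousAt (fun y => l (J y).extForm) x := by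
  simp only [FrameJet.extForm, map_smul, map_sum]
  exact (continuousAt_finsetSum fun _ => continuousAt_finsetSum fun _ =>
    continuousAt_finsetSum fun _ => continuousAt_finsetSum fun _ =>
    (h.ext _ _ _ _).smul continuousAt_const).const_smul _

theorem schouten (h : ContinuousFamilyAt J x) (s : ℝ) (i : Fin n) :
    ContinuousAt (fun y => l ((J y).schouten s i)) x := by
  simp only [FrameJet.schouten, map_smul, map_sum, map_add, map_neg]
  refine ContinuousAt.const_smul (ContinuousAt.add (ContinuousAt.neg ?_) ?_) _
  · exact continuousAt_finsetSum fun _ => (h.ric s _ _).smul continuousAt_const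
  · exact ((continuousAt_finsetSum fun _ => h.ric s _ _).div_const _).smul continuousAt_const

end FrameJet.ContinuousFamilyAt

/-! ### The kernel of the twistor operator -/

namespace FrameJet

variable {n : ℕ} (J : FrameJet n) (ρ : SpinRep n) (s : ℝ) (i : Fin n)

/-- The coefficient of `u` in the derivative of the Dirac derivative `w` of a twistor spinor `u`. -/
def prolongFst : SpinorSpace n →L[ℝ] SpinorSpace n :=
  ((n : ℝ) / 2) • repLin ρ (J.schouten s i)
    + (s * n * (3 - 4 * s) / (((n : ℝ) - 1) * ((n : ℝ) - 2))) •
      ((repLin ρ ∘ₗ LinearMap.mulLeft ℝ (gen i)) J.extForm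
        + ((n : ℝ) - 1) • repLin ρ (J.contrSig i))

/-- The coefficient of `w` in the derivative of the Dirac derivative `w` of a twistor spinor `u`. -/
def prolongSnd : SpinorSpace n →L[ℝ] SpinorSpace n :=
  (s * n / (((n : ℝ) - 1) * ((n : ℝ) - 2))) •
      ((8 * ((n : ℝ) - 1) / n) • repLin ρ (J.contrTor i)
        + (12 / (n : ℝ)) • (repLin ρ ∘ₗ LinearMap.mulLeft ℝ (gen i)) J.torForm)
    - repLin ρ (bivCl (J.cof s i))

/-- The coefficients of the linear total differential equation satisfied by a twistor spinor
together with its Dirac derivative. -/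
def prolong : (SpinorSpace n × SpinorSpace n) →L[ℝ] (SpinorSpace n × SpinorSpace n) :=
  (ContinuousLinearMap.inl ℝ (SpinorSpace n) (SpinorSpace n)).comp
      ((-repLin ρ (bivCl (J.cof s i))).comp (ContinuousLinearMap.fst ℝ _ _)
        - ((1 / (n : ℝ)) • repLin ρ (gen i)).comp (ContinuousLinearMap.snd ℝ _ _))
    + (ContinuousLinearMap.inr ℝ (SpinorSpace n) (SpinorSpace n)).comp
      ((J.prolongFst ρ s i).comp (ContinuousLinearMap.fst ℝ _ _)
        + (J.prolongSnd ρ s i).comp (ContinuousLinearMap.snd ℝ _ _))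

theorem prolong_fst (u w : SpinorSpace n) : (J.prolong ρ s i (u, w)).1 =
    -repCLM ρ (bivCl (J.cof s i)) u - (1 / (n : ℝ)) • repCLM ρ (gen i) w :=
  add_zero _

theorem prolong_snd (u w : SpinorSpace n) : (J.prolong ρ s i (u, w)).2 =
    ((n : ℝ) / 2) • repAlg ρ (J.schouten s i) u
      + (s * n * (3 - 4 * s) / (((n : ℝ) - 1) * ((n : ℝ) - 2))) •
        repAlg ρ (gen i * J.extForm + ((n : ℝ) - 1) • J.contrSig i) u
      + (s * n / (((n : ℝ) - 1) * ((n : ℝ) - 2))) •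
        repAlg ρ ((8 * ((n : ℝ) - 1) / n) • J.contrTor i + (12 / (n : ℝ)) • (gen i * J.torForm)) w
      - repAlg ρ (bivCl (J.cof s i)) w := by
  have h : (J.prolong ρ s i (u, w)).2 = J.prolongFst ρ s i u + J.prolongSnd ρ s i w := zero_add _
  rw [h, add_sub_assoc, map_add, map_add, map_smul, map_smul, map_smul]
  rfl

theorem ContinuousFamilyAt.prolong {X : Type*} [TopologicalSpace X] {J : X → FrameJet n} {x : X}
    (h : ContinuousFamilyAt J x) : ContinuousAt (fun y => (J y).prolong ρ s i) x := by
  have hA : ContinuousAt (fun y => (J y).prolongFst ρ s i) x := by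
    -- Left multiplication by `e_i` is absorbed into the linear map, so every coefficient is a fixed
    -- linear image of a continuous family.
    have h₁ := h.schouten (repLin ρ) s i
    have h₂ := h.extForm (repLin ρ ∘ₗ LinearMap.mulLeft ℝ (gen i))
    have h₃ := h.contrSig (repLin ρ) i
    unfold prolongFst
    fun_prop
  have hB : ContinuousAt (fun y => (J y).prolongSnd ρ s i) x := by
    have h₁ := h.contrTor (repLin ρ) i
    have h₂ := h.torForm (repLin ρ ∘ₗ LinearMap.mulLeft ℝ (gen i))
    have h₃ := h.bivCl_cof (repLin ρ) s i
    unfold prolongSnd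
    fun_prop
  have hC := h.bivCl_cof (repLin ρ) s i
  unfold FrameJet.prolong
  fun_prop

end FrameJet

namespace SpinStructure

variable {n : ℕ} {M : Type*} [TopologicalSpace M] [ChartedSpace (EuclideanSpace ℝ (Fin n)) M]
  [RiemannianBundle (fun x : M => TangentSpace (𝓡 n) x)] [IsManifold (𝓡 n) ∞ M]
  {ι : Type*} (S : SpinStructure n M ι) (ρ : SpinRep n)
  {nab : TangentConn n M} {T : Form3 n M} {x : M}

theorem localRep_eq_zero_iff {a : ι} (hx : x ∈ S.baseSet a) (φ : Π x, S.Spinor ρ x) :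
    S.localRep ρ a φ x = 0 ↔ φ x = 0 := by
  constructor
  · intro h
    have h' := S.localRep_change ρ (S.indexAt x) a φ (S.mem_baseSet_at x) hx
    rw [h, map_zero, localRep_self] at h'
    exact h'
  · intro h
    rw [localRep_eq_repCLM, h]
    exact map_zero (repCLM ρ _)

variable [IsContMDiffRiemannianBundle (𝓡 n) ∞ (EuclideanSpace ℝ (Fin n))
  (fun x : M => TangentSpace (𝓡 n) x)]

theorem exists_continuousFamilyAt_frameJet (hnab : IsLeviCivita nab) (hT : IsSmooth3 T)
    (hpar : S.ParallelTorsion nab T) {a : ι} (hx : x ∈ S.baseSet a) :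
    ∃ J : M → FrameJet n, FrameJet.ContinuousFamilyAt J x ∧
      ∀ y (hy : y ∈ S.baseSet a), J y = frameJet S hnab hpar (S.isFrameOn a) hy := by
  classical
  have hE := S.isFrameOn a
  -- The jet makes sense only over the domain of the frame. The value elsewhere is arbitrary and
  -- harmless, because that domain is a neighbourhood of `x`.
  refine ⟨fun y => if hy : y ∈ S.baseSet a then frameJet S hnab hpar hE hy else
    frameJet S hnab hpar hE hx, ?_, fun y hy => dif_pos hy⟩
  have hU := hE.isOpen.eventually_mem hx
  refine ⟨fun i j k => ?_, fun i j k => ?_, fun i j k l => ?_, fun i j k l => ?_⟩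
  · refine (contMDiffAt_chrFun hnab hE hx i j k).continuousAt.congr ?_
    filter_upwards [hU] with y hy
    rw [dif_pos hy]
    rfl
  · refine (contMDiffAt_torFun hT hE hx i j k).continuousAt.congr ?_
    filter_upwards [hU] with y hy
    rw [dif_pos hy]
    rfl
  · refine (contMDiffAt_mvfderiv_apply hE.isOpen (f := chrFun nab (S.frame a) j k l)
      (fun y hy => (contMDiffAt_chrFun hnab hE hy j k l).contMDiffWithinAt) (hE.smooth i)
      hx).continuousAt.congr ?_
    filter_upwards [hU] with y hy
    rw [dif_pos hy]
    rfl
  · refine (contMDiffAt_mvfderiv_apply hE.isOpen (f := torFun T (S.frame a) j k l)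
      (fun y hy => (contMDiffAt_torFun hT hE hy j k l).contMDiffWithinAt) (hE.smooth i)
      hx).continuousAt.congr ?_
    filter_upwards [hU] with y hy
    rw [dif_pos hy]
    rfl

/-- Near each point, a twistor spinor and its Dirac derivative either vanish identically or have no
common zero. -/
theorem exists_nhds_dirac_eq_zero (hnab : IsLeviCivita nab) (hT : IsSmooth3 T)
    (hpar : S.ParallelTorsion nab T) (hn : 3 ≤ n) (s : ℝ) {φ : Π x, S.Spinor ρ x}
    (hφ : S.IsSmoothSpinor ρ φ) (hP : ∀ x, S.twistorOp ρ nab T s φ x = 0) (x : M) :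
    ∃ V ∈ 𝓝 x, ∀ p ∈ V, φ p = 0 ∧ S.dirac ρ nab T s φ p = 0 →
      ∀ q ∈ V, φ q = 0 ∧ S.dirac ρ nab T s φ q = 0 := by
  set a := S.indexAt x
  have hx : x ∈ S.baseSet a := S.mem_baseSet_at x
  have hE := S.isFrameOn a
  obtain ⟨J, hJ, hJy⟩ := S.exists_continuousFamilyAt_frameJet hnab hT hpar hx
  have hψ := IsSmoothSpinor.dirac S ρ hnab hT s hφ
  set u := S.localRep ρ a φ with hud
  set w := S.localRep ρ a (S.dirac ρ nab T s φ) with hwd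
  have hu : ∀ y ∈ S.baseSet a, MDifferentiableAt (𝓡 n) 𝓘(ℝ, SpinorSpace n) u y := fun y hy =>
    ((S.contMDiffOn_localRep ρ hφ a).contMDiffAt (hE.isOpen.mem_nhds hy)).mdifferentiableAt
      (by simp)
  have hw : ∀ y ∈ S.baseSet a, MDifferentiableAt (𝓡 n) 𝓘(ℝ, SpinorSpace n) w y := fun y hy =>
    ((S.contMDiffOn_localRep ρ hψ a).contMDiffAt (hE.isOpen.mem_nhds hy)).mdifferentiableAt
      (by simp)
  have hd : ∀ y ∈ S.baseSet a, HasMFDerivAt (𝓡 n) 𝓘(ℝ, SpinorSpace n × SpinorSpace n)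
      (fun y => (u y, w y)) y ((mfderiv (𝓡 n) 𝓘(ℝ, SpinorSpace n) u y).prod
        (mfderiv (𝓡 n) 𝓘(ℝ, SpinorSpace n) w y)) := fun y hy =>
    ⟨(hu y hy).hasMFDerivAt.1.prodMk (hw y hy).hasMFDerivAt.1,
      (hu y hy).hasMFDerivAt.2.prodMk (hw y hy).hasMFDerivAt.2⟩
  obtain ⟨V, hV, hVU, h⟩ := exists_nhds_eq_zero (f := fun y => (u y, w y)) hE
    (fun y hy => (hd y hy).mdifferentiableAt) hx
    (fun i => hJ.prolong ρ s i) fun y hy i => by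
      have h₁ := S.mvfderiv_localRep_of_twistorOp ρ hnab s hy (hφ.mdiff S ρ y) (hP y) i
      have h₂ := S.mvfderiv_localRep_dirac ρ hnab hT hpar hn s hφ hP hy (hJy y hy) i
      have h₃ := congrArg (fun L => L (S.frame a i y)) (hd y hy).mfderiv
      refine h₃.trans (Prod.ext ?_ ?_)
      · rw [FrameJet.prolong_fst, hJy y hy]
        exact h₁
      · rw [FrameJet.prolong_snd]
        exact eq_sub_of_add_eq h₂
  refine ⟨V, hV, fun p hp h₀ q hq => ?_⟩
  have h₁ := h p hp (Prod.ext ((S.localRep_eq_zero_iff ρ (hVU hp) φ).2 h₀.1)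
    ((S.localRep_eq_zero_iff ρ (hVU hp) _).2 h₀.2)) q hq
  exact ⟨(S.localRep_eq_zero_iff ρ (hVU hq) φ).1 (congrArg Prod.fst h₁),
    (S.localRep_eq_zero_iff ρ (hVU hq) _).1 (congrArg Prod.snd h₁)⟩

variable [ConnectedSpace M]

/-- A twistor spinor which vanishes at a point together with its Dirac derivative is zero. -/
theorem eq_zero_of_dirac_eq_zero (hnab : IsLeviCivita nab) (hT : IsSmooth3 T)
    (hpar : S.ParallelTorsion nab T) (hn : 3 ≤ n) (s : ℝ) {φ : Π x, S.Spinor ρ x}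
    (hφ : φ ∈ S.kerTwistor ρ nab T s) {p : M} (h₁ : φ p = 0)
    (h₂ : S.dirac ρ nab T s φ p = 0) : φ = 0 := by
  have h := S.exists_nhds_dirac_eq_zero ρ hnab hT hpar hn s hφ.1 hφ.2
  -- The local dichotomy works both ways: if `x` is a common zero then so is all of `V`, and if `V`
  -- contains a common zero then `x` is one.
  have hclopen : IsClopen {x | φ x = 0 ∧ S.dirac ρ nab T s φ x = 0} := by
    constructor
    · refine ⟨isOpen_iff_mem_nhds.2 fun x hx => ?_⟩
      obtain ⟨V, hV, hVz⟩ := h x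
      filter_upwards [hV] with y hy hyz
      exact hx (hVz y hy hyz x (mem_of_mem_nhds hV))
    · refine isOpen_iff_mem_nhds.2 fun x hx => ?_
      obtain ⟨V, hV, hVz⟩ := h x
      filter_upwards [hV] with y hy
      exact hVz x (mem_of_mem_nhds hV) hx y hy
  have huniv := hclopen.eq_univ ⟨p, h₁, h₂⟩
  funext x
  exact (huniv.symm ▸ Set.mem_univ x : x ∈ {x | φ x = 0 ∧ S.dirac ρ nab T s φ x = 0}).1

/-- The space of twistor spinors has complex dimension at most twice that of the spinors. -/
theorem finrank_kerTwistor_le (hnab : IsLeviCivita nab) (hT : IsSmooth3 T)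
    (hpar : S.ParallelTorsion nab T) (hn : 3 ≤ n) (s : ℝ) :
    Module.Finite ℂ (S.kerTwistor ρ nab T s) ∧
      Module.finrank ℂ (S.kerTwistor ρ nab T s) ≤ 2 ^ (n / 2 + 1) := by
  obtain ⟨p⟩ : Nonempty M := inferInstance
  -- Evaluation of `(φ, Dˢφ)` at one point is injective by unique continuation, and its target has
  -- complex dimension `2 · 2^[n/2]`.
  let ev : S.kerTwistor ρ nab T s →ₗ[ℂ] SpinorSpace n × SpinorSpace n :=
    { toFun := fun φ => (φ.1 p, S.dirac ρ nab T s φ.1 p)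
      map_add' := fun φ φ' => Prod.ext rfl
        (S.dirac_add ρ nab T s (φ.2.1.mdiff S ρ p) (φ'.2.1.mdiff S ρ p))
      map_smul' := fun c φ => Prod.ext rfl
        (S.dirac_smulC ρ nab T s c (φ.2.1.mdiff S ρ p)) }
  have hinj : Function.Injective ev := by
    rw [injective_iff_map_eq_zero]
    intro φ h
    exact Subtype.ext (S.eq_zero_of_dirac_eq_zero ρ hnab hT hpar hn s φ.2
      (congrArg Prod.fst h) (congrArg Prod.snd h))
  refine ⟨Module.Finite.of_injective ev hinj, (ev.finrank_le_finrank_of_injective hinj).trans ?_⟩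
  rw [Module.finrank_prod, Module.finrank_fin_fun, pow_succ]
  omega

end SpinStructure

end TwistorTorsion

end

/-! ### Twistor spinors with torsion as parallel sections -/

theorem theorem2p6 {n : ℕ} (hn : 3 ≤ n)
    {M : Type*} [TopologicalSpace M] [T2Space M] [SecondCountableTopology M] [ConnectedSpace M]
    [ChartedSpace (EuclideanSpace ℝ (Fin n)) M] [IsManifold (𝓡 n) ∞ M]
    [RiemannianBundle (fun x : M => TangentSpace (𝓡 n) x)]
    [IsContMDiffRiemannianBundle (𝓡 n) ∞ (EuclideanSpace ℝ (Fin n))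
      (fun x : M => TangentSpace (𝓡 n) x)]
    {ι : Type*} (S : SpinStructure n M ι) (ρ : SpinRep n)
    (nab : TangentConn n M) (hnab : IsLeviCivita nab)
    (T : Form3 n M) (hT : IsSmooth3 T) (hpar : S.ParallelTorsion nab T) (s : ℝ) :
    (∀ φ ∈ S.kerTwistor ρ nab T s,
      S.IsSmoothSpinor ρ (S.dirac ρ nab T s φ) ∧
        S.twistorConn ρ nab T s (fun x => (φ x, S.dirac ρ nab T s φ x)) = 0) ∧
    (∀ φ ψ : Π x, S.Spinor ρ x, S.IsSmoothSpinor ρ φ → S.IsSmoothSpinor ρ ψ →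
      S.twistorConn ρ nab T s (fun x => (φ x, ψ x)) = 0 →
        φ ∈ S.kerTwistor ρ nab T s ∧ S.dirac ρ nab T s φ = ψ) ∧
    (Module.Finite ℂ (S.kerTwistor ρ nab T s) ∧
      Module.finrank ℂ (S.kerTwistor ρ nab T s) ≤ 2 ^ (n / 2 + 1)) ∧
    (∀ φ ∈ S.kerTwistor ρ nab T s, ∀ p : M,
      φ p = 0 → S.dirac ρ nab T s φ p = 0 → φ = 0) := by
  refine ⟨fun φ hφ => ⟨TwistorTorsion.SpinStructure.IsSmoothSpinor.dirac S ρ hnab hT s hφ.1,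
    S.twistorConn_eq_zero ρ hnab hT hpar hn s hφ.1 hφ.2⟩, fun φ ψ hφ _ h => ?_,
    S.finrank_kerTwistor_le ρ hnab hT hpar hn s,
    fun φ hφ p h₁ h₂ => S.eq_zero_of_dirac_eq_zero ρ hnab hT hpar hn s hφ h₁ h₂⟩
  have h' := S.twistorOp_eq_zero ρ (by omega) s h
  exact ⟨⟨hφ, h'.1⟩, h'.2⟩
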